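/- Let $N\ge 1$, $p,q>1$, $a,b>0$, and let $G\in C^1(\mathbb R^2)$ satisfy $G(0,0)=0$ and $G(s,\sigma)\ge a|s|^q+b|\sigma|^p$ for all $(s,\sigma)\in\mathbb R^2$. Let $f,g\in C_c^\infty(\mathbb R^N)$ with $\int_{\mathbb R^N}g\,dx>0$, and put $r_0=\sup\{|x|: x\in \operatorname{supp} f\cup\operatorname{supp} g\}$. Define $$\Gamma_S(N,q)=\Big(1+\frac1q\Big)\frac1{q-1}-\frac{N-1}2,\qquad \Gamma_G(N,p)=\frac1{p-1}-\frac{N-1}2,\qquad \Gamma_{\rm comb}(N,p,q)=\frac{q+1}{p(q-1)}-\frac{N-1}2,$$ $$p_S(N)=\sup\{r>1:\ 2+(N+1)r-(N-1)r^2>0\},\qquad p_G(N)=\frac{N+1}{N-1}\ (N\ge2),\qquad p_S(1)=p_G(1)=\infty .$$ For $\varepsilon,T>0$, a weak solution in $(0,T)$ of $$\partial_t^2u-\Delta u=G(u,\partial_tu),\qquad u(0)=\varepsilon f,\quad \partial_tu(0)=\varepsilon g$$ is a function $u\in C([0,T);H^1(\mathbb R^N))\cap C^1([0,T);L^2(\mathbb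 R^N))$ with $G(u,\partial_tu)\in L^1(0,T;L^1(\mathbb R^N))$, with these initial values, such that for every $\Psi\in C_c^\infty(\mathbb R^N\times[0,T))$ $$\varepsilon\int_{\mathbb R^N} g\,\Psi(\cdot,0)\,dx+\int_0^T\!\!\int_{\mathbb R^N}G(u,\partial_tu)\Psi\,dx\,dt=\int_0^T\!\!\int_{\mathbb R^N}\big(-\partial_tu\,\partial_t\Psi+\nabla u\cdot\nabla\Psi\big)\,dx\,dt .$$ Assume that $\max\{\Gamma_S(N,q),\Gamma_G(N,p)\}\ge0$ or $\Gamma_{\rm comb}(N,p,q)>0$. Then at least one of the five cases below occurs, and there are constants $\varepsilon_0>0$ and $C>0$, independent of $\varepsilon$, $T$ and $u$, such that for every $\varepsilon\in(0,\varepsilon_0]$, every $T>0$ and every weak solution $u$ in $(0,T)$ with $\operatorname{supp}u\subset\{(x,t)\in\mathbb R^N\times[0,T):|x|\le r_0+t\}$, $$T\le\begin{cases} \exp\big(C\varepsilon^{-(p-1)}\big) & \text{if } p=p_G(N),\ q\ge 1+\frac4{N-1},\\ C\varepsilon^{-\Gamma_G(N,p)^{-1}} & \text{if } p<p_G(N),\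 q>2p-1,\\ C\varepsilon^{-\Gamma_{\rm comb}(N,p,q)^{-1}} & \text{if } p\le q\le 2p-1,\ \Gamma_{\rm comb}(N,p,q)>0,\\ C\varepsilon^{-\Gamma_S(N,q)^{-1}} & \text{if } p>q,\ q<p_S(N),\\ \exp\big(C\varepsilon^{-q(q-1)}\big) & \text{if } p\ge q=p_S(N). \end{cases}$$ -/

import Mathlib

open MeasureTheory Set
open scoped ContDiff

namespace CombWave

/-- The spatial domain: `N`-dimensional Euclidean space. -/
abbrev Space (N : ℕ) : Type := EuclideanSpace ℝ (Fin N)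

/-- Real-valued square-integrable functions on space. -/
abbrev L2 (N : ℕ) : Type := Lp ℝ 2 (volume : Measure (Space N))

/-- Square-integrable vector fields on space. -/
abbrev L2Vec (N : ℕ) : Type := Lp (Space N) 2 (volume : Measure (Space N))

/-- Integrable functions on space. -/
abbrev L1 (N : ℕ) : Type := Lp ℝ 1 (volume : Measure (Space N))

/-- `w` is the weak (distributional) gradient of `u`. For `u` and `w` square-integrable this says
that `u` belongs to the Sobolev space `H¹` and `∇u = w`. -/
def IsWeakGradient {N : ℕ} (u : L2 N) (w : L2Vec N) : Prop :=
  ∀ φ : Space N → ℝ, ContDiff ℝ ∞ φ → HasCompactSupport φ → ∀ i : Fin N,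
    ∫ x, u x * (gradient φ x) i = - ∫ x, (w x) i * φ x

/-- Test functions: restrictions to `t ≥ 0` of these are exactly the elements of
`C_c^∞(ℝ^N × [0,T))`. -/
def IsTestFunction {N : ℕ} (T : ℝ) (Ψ : Space N × ℝ → ℝ) : Prop :=
  ContDiff ℝ ∞ Ψ ∧ HasCompactSupport Ψ ∧ ∀ z ∈ tsupport Ψ, z.2 < T

/-- `u` is a weak solution in `(0,T)` of `∂ₜ²u - Δu = G(u, ∂ₜu)` with `u(0) = ε f`,
`∂ₜu(0) = ε g`. Here `v` is `∂ₜu`, `w` is `∇u`, and `H` is `G(u, ∂ₜu)`; only the values at times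
in `[0,T)` matter. -/
def IsWeakSolution {N : ℕ} (G : ℝ × ℝ → ℝ) (f g : Space N → ℝ) (ε T : ℝ) (u : ℝ → L2 N) : Prop :=
  ∃ (v : ℝ → L2 N) (w : ℝ → L2Vec N) (H : ℝ → L1 N),
    -- `u ∈ C([0,T); H¹)`
    ContinuousOn u (Ico 0 T) ∧ (∀ t ∈ Ico 0 T, IsWeakGradient (u t) (w t)) ∧
    ContinuousOn w (Ico 0 T) ∧
    -- `u ∈ C¹([0,T); L²)` with time derivative `v`
    (∀ t ∈ Ico 0 T, HasDerivWithinAt u (v t) (Ico 0 T) t) ∧ ContinuousOn v (Ico 0 T) ∧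
    -- `G(u, ∂ₜu) ∈ L¹(0,T; L¹)`
    (∀ᵐ t ∂(volume.restrict (Ioo 0 T)), ∀ᵐ x, H t x = G (u t x, v t x)) ∧
    IntegrableOn H (Ioo 0 T) ∧
    -- initial values
    (∀ᵐ x, u 0 x = ε * f x) ∧ (∀ᵐ x, v 0 x = ε * g x) ∧
    -- the weak form of the equation
    ∀ Ψ : Space N × ℝ → ℝ, IsTestFunction T Ψ →
      ε * (∫ x, g x * Ψ (x, 0)) +
          ∫ t in Ioo 0 T, ∫ x, G (u t x, v t x) * Ψ (x, t) =
        ∫ t in Ioo 0 T, ∫ x,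
          (-(v t x * deriv (fun s => Ψ (x, s)) t) +
            inner ℝ (w t x) (gradient (fun y => Ψ (y, t)) x))

/-- `r₀ = sup {|x| : x ∈ supp (f,g)}`. -/
noncomputable def dataRadius {N : ℕ} (f g : Space N → ℝ) : ℝ :=
  sSup ((fun x => ‖x‖) '' (tsupport f ∪ tsupport g))

/-- `supp u ⊆ {(x,t) : 0 ≤ t < T, |x| ≤ r₀ + t}`. -/
def SupportedInCone {N : ℕ} (r₀ T : ℝ) (u : ℝ → L2 N) : Prop :=
  ∀ t ∈ Ico 0 T, ∀ᵐ x, r₀ + t < ‖x‖ → u t x = 0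

/-- `Γ_S(N,p)`. -/
noncomputable def GammaS (N : ℕ) (p : ℝ) : ℝ :=
  (1 + 1 / p) * (p - 1)⁻¹ - ((N : ℝ) - 1) / 2

/-- `Γ_G(N,p)`. -/
noncomputable def GammaG (N : ℕ) (p : ℝ) : ℝ :=
  1 / (p - 1) - ((N : ℝ) - 1) / 2

/-- `Γ_comb(N,p,q)`. -/
noncomputable def GammaComb (N : ℕ) (p q : ℝ) : ℝ :=
  (q + 1) / (p * (q - 1)) - ((N : ℝ) - 1) / 2

/-- `γ_S(N,p)`. -/
def gammaStrauss (N : ℕ) (p : ℝ) : ℝ :=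
  2 + ((N : ℝ) + 1) * p - ((N : ℝ) - 1) * p ^ 2

/-- The Strauss exponent `p_S(N) = sup {p > 1 : γ_S(N,p) > 0}`, with `p_S(1) = ∞`. -/
noncomputable def pS (N : ℕ) : EReal :=
  sSup ((fun p : ℝ => (p : EReal)) '' {p : ℝ | 1 < p ∧ 0 < gammaStrauss N p})

/-- The Glassey exponent `p_G(N) = (N+1)/(N-1)`, with `p_G(1) = ∞`. -/
noncomputable def pG (N : ℕ) : EReal :=
  if N = 1 then ⊤ else (((N : ℝ) + 1) / ((N : ℝ) - 1) : ℝ)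

/-- The five parameter regions. -/
def CaseGlasseyCritical (N : ℕ) (p q : ℝ) : Prop :=
  (p : EReal) = pG N ∧ 1 + 4 / ((N : ℝ) - 1) ≤ q

def CaseGlasseySubcritical (N : ℕ) (p q : ℝ) : Prop :=
  (p : EReal) < pG N ∧ 2 * p - 1 < q

def CaseCombined (N : ℕ) (p q : ℝ) : Prop :=
  p ≤ q ∧ q ≤ 2 * p - 1 ∧ 0 < GammaComb N p q

def CaseStraussSubcritical (N : ℕ) (p q : ℝ) : Prop :=
  q < p ∧ (q : EReal) < pS N

def CaseStraussCritical (N : ℕ) (p q : ℝ) : Prop :=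
  q ≤ p ∧ (q : EReal) = pS N

end CombWave

namespace CombWave

/-! ### The radial profile of the positive solutions of `Δφ = l² φ` -/

/-! For `l ≥ 0` let `φ_l` be the positive radial solution of `Δφ = l²φ` with `φ(0) = 1`, and set `m
= (N-1)/2`. It is at most of order `(1+l|x|)^(-m) e^(l|x|)`, so inside the light cone the mass of
`e^(-lt) φ_l` sits near the boundary sphere. All information about the solution comes from the
pairings `F(t) = ∫ u φ_l` and `h(t) = ∫ G(u,∂ₜu) φ_l ≥ 0`. They satisfy `F'' - l²F = h`, which
factors as `(e^(-lt)(F' + lF))' = e^(-lt) h`. Only `∫ g > 0` is assumed, but since `φ_l → 1` as `l →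
0`, the data still pair positively with `φ_l` for small `l` (`exists_data_pairing_pos`). Integrating
once more (`pairing_lower_bounds`) bounds `e^(-lt)F` and `e^(-lt)F'` below by a multiple of `ε`
after a fixed time. Hölder's inequality in the cone then gives the concentration bounds `∫|u|^q ≥
cε^q (1+t)^((N-1)(1-q/2))` and `∫|∂ₜu|^p ≥ cε^p (1+t)^((N-1)(1-p/2))` (`exists_solution_bounds`).

Glassey cases: `e^(-lt)F' ≥ ει + K/2` with `K' = e^(-lt)h`, and Hölder bounds `K'` below by a
constant times `(1+t)^(-m(p-1)) (e^(-lt)F')^p`. This closes into a scalar inequality `Z' ≥ w Z^p`,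
whose blow-up time is read off from the primitive of `w`: a logarithm at `p = p_G`, a power below
it.

Combined and subcritical Strauss cases: take `l = 0` and test in time with `(R-t)^(n+2)`. Young's
inequality absorbs the resulting mean of `u` into `a∫|u|^q`. What remains is a source of size `ε^r
(1+t)^((N-1)(1-r/2))`, and scaling in `R` gives `ε R^Γ ≤ C` with `Γ = Γ_comb(N,r,q)`
(`exists_lifespan_of_source`). The choice `r = p` uses the concentration of `∂ₜu`; the choice `r =
q` uses that of `u`, and `Γ_comb(N,q,q) = Γ_S(N,q)`.

Critical Strauss case: scaling alone gives nothing, so the `φ_l` are superposed over `l_j = l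
2^(-j)` with weights `l_j^γ`. For `γ = β = m - 1/q` the superposition is comparable to `(t+A)^(-β)`
in the cone. For `γ = β + 1` it is at most of order `(t+A)^(-m) (t+A-|x|)^(-(1-1/q))`, whose
`q/(q-1)`-th power is borderline integrable and costs one logarithm. At the critical exponent the
pairing `B` of the nonlinearity is at least `dε^q/(t+A)`. The weighted mean `M(ρ)` of `B` over times
with `t + A < ρ` then satisfies `M ≥ c ε^q log ρ` and `M^q ≤ K (log ρ)^(q-1) ρ M'`. Separating
variables between `e^x` and `e^(2x)` gives `log T ≤ Cε^(-q(q-1))`.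

That the five regions cover the hypothesis follows from the signs of `Γ_comb - Γ_S` and `Γ_comb -
Γ_G`, which change at `q = p` and `q = 2p - 1` (`exists_case`). -/

/-- The coefficients `1 / (4^k k! (ν)_k)`. -/
noncomputable def profileCoeff (ν : ℝ) (k : ℕ) : ℝ :=
  ∏ i ∈ Finset.range k, (4 * ((i : ℝ) + 1) * (ν + i))⁻¹

/-- The entire solution of `4 s P'' + 4 ν P' = P` with `P(0) = 1`. -/
noncomputable def profile (ν s : ℝ) : ℝ := ∑' k, profileCoeff ν k * s ^ k

lemma profileCoeff_zero (ν : ℝ) : profileCoeff ν 0 = 1 := by simp [profileCoeff]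

lemma profileCoeff_succ (ν : ℝ) (k : ℕ) :
    profileCoeff ν (k + 1) = profileCoeff ν k * (4 * ((k : ℝ) + 1) * (ν + k))⁻¹ := by
  simp [profileCoeff, Finset.prod_range_succ]

lemma profileCoeff_pos {ν : ℝ} (hν : 1 / 2 ≤ ν) (k : ℕ) : 0 < profileCoeff ν k :=
  Finset.prod_pos fun i _ => by positivity

lemma profileCoeff_le {ν : ℝ} (hν : 1 / 2 ≤ ν) (k : ℕ) :
    profileCoeff ν k ≤ 1 / (k.factorial : ℝ) := by
  induction k with
  | zero => simp [profileCoeff]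
  | succ k ih =>
    rw [profileCoeff_succ, Nat.factorial_succ, Nat.cast_mul, one_div, mul_inv (((k + 1 : ℕ) : ℝ)),
      mul_comm]
    have h1 : (4 * ((k : ℝ) + 1) * (ν + k))⁻¹ ≤ ((k + 1 : ℕ) : ℝ)⁻¹ := by
      apply inv_anti₀ (by positivity)
      push_cast
      nlinarith [Nat.cast_nonneg (α := ℝ) k]
    have h2 := (profileCoeff_pos hν k).le
    rw [one_div] at ih
    exact mul_le_mul h1 ih h2 (by positivity)

/-- Differentiating the series shifts the parameter: this is the coefficient form of `P_ν' =
P_(ν+1)/(4ν)`. Smoothness and the differential equation of the profile both rest on it. -/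
lemma succ_mul_profileCoeff_succ {ν : ℝ} (hν : 1 / 2 ≤ ν) (k : ℕ) :
    ((k : ℝ) + 1) * profileCoeff ν (k + 1) = profileCoeff (ν + 1) k / (4 * ν) := by
  have hν0 : 0 < ν := by linarith
  induction k with
  | zero => simp [profileCoeff_succ, profileCoeff_zero]
  | succ k ih =>
    rw [profileCoeff_succ ν (k + 1), profileCoeff_succ (ν + 1) k]
    have h : profileCoeff (ν + 1) k = (4 * ν) * (((k : ℝ) + 1) * profileCoeff ν (k + 1)) := by
      rw [ih]; field_simp
    rw [h]
    push_cast
    have : ν + 1 + (k : ℝ) ≠ 0 := by positivity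
    have : ν + ((k : ℝ) + 1) ≠ 0 := by positivity
    field_simp
    ring

/-- Coefficient form of the contiguous relation between `P_ν`, `P_(ν+1)` and `P_(ν+2)`. With the
derivative rule this relation is the second-order equation of the profile. -/
lemma profileCoeff_recurrence {ν : ℝ} (hν : 1 / 2 ≤ ν) (k : ℕ) :
    profileCoeff ν (k + 1) =
      profileCoeff (ν + 1) (k + 1) + profileCoeff (ν + 2) k / (4 * ν * (4 * (ν + 1))) * 4 := by
  have hν0 : 0 < ν := by linarith
  have h1 := succ_mul_profileCoeff_succ (ν := ν + 1) (by linarith) k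
  have h2 := succ_mul_profileCoeff_succ hν (k + 1)
  have h3 := profileCoeff_succ ν (k + 1)
  rw [show ν + 1 + 1 = ν + 2 by ring] at h1
  rw [h3] at h2
  push_cast at h2
  have h5 : (0 : ℝ) < k + 1 := by positivity
  have h6 : (0 : ℝ) < ν + (k + 1) := by positivity
  have h4 : profileCoeff (ν + 1) (k + 1) = ν / (ν + (k + 1)) * profileCoeff ν (k + 1) := by
    field_simp at h2 ⊢
    linarith
  have h7 : profileCoeff (ν + 2) k = 4 * (ν + 1) * (((k : ℝ) + 1) * profileCoeff (ν + 1) (k + 1)) := by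
    rw [h1]; field_simp
  rw [h7, h4]
  field_simp

lemma summable_profile {ν : ℝ} (hν : 1 / 2 ≤ ν) (s : ℝ) :
    Summable fun k => profileCoeff ν k * s ^ k := by
  refine Summable.of_norm_bounded (Real.summable_pow_div_factorial |s|) fun k => ?_
  rw [Real.norm_eq_abs, abs_mul, abs_pow, abs_of_pos (profileCoeff_pos hν k), div_eq_mul_one_div,
    mul_comm]
  exact mul_le_mul_of_nonneg_left (profileCoeff_le hν k) (by positivity)

lemma hasDerivAt_profile {ν : ℝ} (hν : 1 / 2 ≤ ν) (s : ℝ) :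
    HasDerivAt (profile ν) (profile (ν + 1) s / (4 * ν)) s := by
  set r : ℝ := |s| + 1
  have hu : Summable fun k : ℕ => (k : ℝ) * (1 / (k.factorial : ℝ)) * r ^ (k - 1) := by
    rw [← summable_nat_add_iff 1]
    refine (Real.summable_pow_div_factorial r).congr fun k => ?_
    rw [Nat.factorial_succ]
    push_cast
    have : (k : ℝ) + 1 ≠ 0 := by positivity
    field_simp
  have key := hasDerivAt_tsum_of_isPreconnected (𝕜 := ℝ) (F := ℝ)
    (g := fun k s => profileCoeff ν k * s ^ k)
    (g' := fun k s => profileCoeff ν k * (k * s ^ (k - 1)))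
    (t := Metric.ball (0 : ℝ) r) (y₀ := 0) (y := s) hu Metric.isOpen_ball
    (convex_ball (0 : ℝ) r).isPreconnected
    (fun n y _ => (hasDerivAt_pow n y).const_mul _)
    (fun n y hy => by
      rw [Real.norm_eq_abs, abs_mul, abs_mul, abs_pow, abs_of_pos (profileCoeff_pos hν n),
        Nat.abs_cast]
      have hy' : |y| ≤ r := by
        rw [mem_ball_zero_iff, Real.norm_eq_abs] at hy; exact hy.le
      have := profileCoeff_le hν n
      calc profileCoeff ν n * (n * |y| ^ (n - 1)) ≤ 1 / (n.factorial : ℝ) * (n * r ^ (n - 1)) := by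
            gcongr
        _ = _ := by ring)
    (by simp [r]; positivity) (summable_profile hν 0) (by simp [r])
  have hval : ∑' k, profileCoeff ν k * ((k : ℝ) * s ^ (k - 1)) = profile (ν + 1) s / (4 * ν) := by
    have hs : Summable fun k : ℕ => profileCoeff ν k * ((k : ℝ) * s ^ (k - 1)) := by
      rw [← summable_nat_add_iff 1]
      refine ((summable_profile (ν := ν + 1) (by linarith) s).div_const (4 * ν)).congr fun k => ?_
      have := succ_mul_profileCoeff_succ hν k
      push_cast
      linear_combination (-s ^ k) * this
    rw [hs.tsum_eq_zero_add]
    simp only [Nat.cast_zero, zero_mul, mul_zero, zero_add, profile]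
    rw [← tsum_div_const]
    refine tsum_congr fun k => ?_
    have := succ_mul_profileCoeff_succ hν k
    push_cast
    linear_combination (s ^ k) * this
  rw [hval] at key
  exact key

lemma profile_recurrence {ν : ℝ} (hν : 1 / 2 ≤ ν) (s : ℝ) :
    profile ν s = profile (ν + 1) s + s * profile (ν + 2) s / (4 * ν * (ν + 1)) := by
  have hν0 : 0 < ν := by linarith
  have h0 := summable_profile hν s
  have h1 := summable_profile (ν := ν + 1) (by linarith) s
  have h2 := summable_profile (ν := ν + 2) (by linarith) s
  unfold profile
  rw [h0.tsum_eq_zero_add, h1.tsum_eq_zero_add]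
  simp only [profileCoeff_zero, pow_zero, mul_one]
  rw [← tsum_mul_left, ← tsum_div_const, add_assoc,
    ← ((summable_nat_add_iff 1).2 h1).tsum_add ((h2.mul_left s).div_const _)]
  congr 1
  refine tsum_congr fun k => ?_
  rw [profileCoeff_recurrence hν k]
  field_simp
  ring

lemma one_le_profile {ν s : ℝ} (hν : 1 / 2 ≤ ν) (hs : 0 ≤ s) : 1 ≤ profile ν s := by
  have := (summable_profile hν s).le_tsum 0
    (fun k _ => mul_nonneg (profileCoeff_pos hν k).le (pow_nonneg hs k))
  simpa [profile, profileCoeff_zero] using this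

lemma profile_zero (ν : ℝ) : profile ν 0 = 1 := by
  unfold profile
  rw [tsum_eq_single 0 (fun k hk => by simp [hk])]
  simp [profileCoeff_zero]

lemma profile_mono {ν s s' : ℝ} (hν : 1 / 2 ≤ ν) (hs : 0 ≤ s) (h : s ≤ s') :
    profile ν s ≤ profile ν s' :=
  (summable_profile hν s).tsum_le_tsum
    (fun k => mul_le_mul_of_nonneg_left (pow_le_pow_left₀ hs h k) (profileCoeff_pos hν k).le)
    (summable_profile hν s')

lemma contDiff_profile_nat (n : ℕ) : ∀ {ν : ℝ}, 1 / 2 ≤ ν → ContDiff ℝ n (profile ν) := by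
  induction n with
  | zero =>
    intro ν hν
    exact contDiff_zero.2 (continuous_iff_continuousAt.2 fun s =>
      (hasDerivAt_profile hν s).continuousAt)
  | succ n ih =>
    intro ν hν
    rw [Nat.cast_add, Nat.cast_one, contDiff_succ_iff_deriv]
    refine ⟨fun s => (hasDerivAt_profile hν s).differentiableAt, by simp, ?_⟩
    rw [funext fun s => (hasDerivAt_profile hν s).deriv]
    exact (ih (by linarith)).div_const _

lemma contDiff_profile {ν : ℝ} (hν : 1 / 2 ≤ ν) : ContDiff ℝ ∞ (profile ν) :=
  contDiff_infty.2 fun n => contDiff_profile_nat n hν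

/-- `P` and `4 s P'' + 4 ν P'` agree. -/
lemma profile_ode {ν : ℝ} (hν : 1 / 2 ≤ ν) (s : ℝ) :
    4 * s * (profile (ν + 1 + 1) s / (4 * (ν + 1)) / (4 * ν)) +
      4 * ν * (profile (ν + 1) s / (4 * ν)) = profile ν s := by
  have hν0 : 0 < ν := by linarith
  rw [profile_recurrence hν s, show ν + 1 + 1 = ν + 2 by ring]
  field_simp
  ring

/-- With `w(r) = r^m P(r²)` the bracket is `w + w'`, and the first-order term of the radial equation
is removed: `w'' = (1 + m(m-1)/r²) w`. Hence `(e^(-r)(w + w'))' = e^(-r) m(m-1) w/r²`. The factor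
`e^(m²/r)`, bounded on `[1,∞)`, contributes `-m²(w + w')/r²` to the logarithmic balance and so makes
the product nonincreasing. This gives `w = O(e^r)` without Bessel asymptotics. -/
lemma antitoneOn_profile_energy {ν m : ℝ} (hν : 1 / 2 ≤ ν) (hm : m = (2 * ν - 1) / 2) :
    AntitoneOn (fun r : ℝ => (Real.exp (-r) * (r ^ m * profile ν (r ^ 2) +
      2 * (r ^ (m + 1) * (profile (ν + 1) (r ^ 2) / (4 * ν))) +
      m * (r ^ (m - 1) * profile ν (r ^ 2)))) * Real.exp (m ^ 2 * r⁻¹)) (Ici 1) := by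
  have hν0 : 0 < ν := by linarith
  have hm0 : 0 ≤ m := by rw [hm]; linarith
  set D : ℝ → ℝ := fun s => profile (ν + 1) s / (4 * ν)
  set D' : ℝ → ℝ := fun s => profile (ν + 1 + 1) s / (4 * (ν + 1)) / (4 * ν)
  have hd : ∀ r : ℝ, 0 < r → HasDerivAt (fun r : ℝ => (Real.exp (-r) * (r ^ m * profile ν (r ^ 2) +
      2 * (r ^ (m + 1) * D (r ^ 2)) + m * (r ^ (m - 1) * profile ν (r ^ 2)))) *
        Real.exp (m ^ 2 * r⁻¹))
      (Real.exp (-r) * Real.exp (m ^ 2 * r⁻¹) * (m * (m - 1) * r ^ (m - 2) * profile ν (r ^ 2) -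
        m ^ 2 * r ^ (-2 : ℝ) * (r ^ m * profile ν (r ^ 2) +
      2 * (r ^ (m + 1) * D (r ^ 2)) + m * (r ^ (m - 1) * profile ν (r ^ 2))))) r := by
    intro r hr
    have hsq : HasDerivAt (fun r : ℝ => r ^ 2) (2 * r) r := by simpa using hasDerivAt_pow 2 r
    have hP : HasDerivAt (fun r : ℝ => profile ν (r ^ 2)) (D (r ^ 2) * (2 * r)) r :=
      HasDerivAt.comp (h₂ := profile ν) r (hasDerivAt_profile hν (r ^ 2)) hsq
    have hD : HasDerivAt (fun r : ℝ => D (r ^ 2)) (D' (r ^ 2) * (2 * r)) r :=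
      HasDerivAt.comp (h₂ := D) r
        ((hasDerivAt_profile (ν := ν + 1) (by linarith) (r ^ 2)).div_const (4 * ν)) hsq
    have hpow : ∀ c : ℝ, HasDerivAt (fun r : ℝ => r ^ c) (c * r ^ (c - 1)) r := fun c =>
      Real.hasDerivAt_rpow_const (Or.inl hr.ne')
    have he : HasDerivAt (fun r : ℝ => Real.exp (-r)) (Real.exp (-r) * (-1)) r :=
      (hasDerivAt_neg r).exp
    have hi : HasDerivAt (fun r : ℝ => Real.exp (m ^ 2 * r⁻¹))
        (Real.exp (m ^ 2 * r⁻¹) * (m ^ 2 * (-(r ^ 2)⁻¹))) r :=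
      ((hasDerivAt_inv hr.ne').const_mul _).exp
    have h := (he.mul ((((hpow m).mul hP).add (((hpow (m + 1)).mul hD).const_mul 2)).add
      (((hpow (m - 1)).mul hP).const_mul m))).mul hi
    refine h.congr_deriv ?_
    have e1 : r ^ (m + 1) = r ^ (m - 2) * r ^ 3 := by
      rw [← Real.rpow_natCast, ← Real.rpow_add hr]; congr 1; push_cast; ring
    have e2 : r ^ m = r ^ (m - 2) * r ^ 2 := by
      rw [← Real.rpow_natCast, ← Real.rpow_add hr]; congr 1; push_cast; ring
    have e3 : r ^ (m - 1) = r ^ (m - 2) * r := by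
      nth_rw 3 [← Real.rpow_one r]; rw [← Real.rpow_add hr]; congr 1; ring
    have e4 : r ^ (-2 : ℝ) = (r ^ 2)⁻¹ := by
      rw [Real.rpow_neg hr.le]; norm_cast
    have ode : 4 * r ^ 2 * D' (r ^ 2) + 4 * ν * D (r ^ 2) = profile ν (r ^ 2) :=
      profile_ode hν (r ^ 2)
    simp only [Pi.add_apply, Pi.mul_apply]
    rw [show m + 1 - 1 = m by ring, show m - 1 - 1 = m - 2 by ring, e1, e2, e3, e4]
    have hνm : ν = m + 1 / 2 := by rw [hm]; ring
    have ode' : 4 * r ^ 2 * D' (r ^ 2) = profile ν (r ^ 2) - (4 * m + 2) * D (r ^ 2) := by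
      rw [← ode, hνm]; ring
    clear_value D D'
    linear_combination (Real.exp (-r) * Real.exp (m ^ 2 * r⁻¹) * r ^ (m - 2) * r ^ 2) * ode'
  apply antitoneOn_of_deriv_nonpos (convex_Ici 1)
  · intro r hr
    exact (hd r (by rw [mem_Ici] at hr; linarith)).continuousAt.continuousWithinAt
  · intro r hr
    rw [interior_Ici, mem_Ioi] at hr
    exact (hd r (by linarith)).differentiableAt.differentiableWithinAt
  · intro r hr
    rw [interior_Ici, mem_Ioi] at hr
    have hr0 : 0 < r := by linarith
    rw [(hd r hr0).deriv]
    have hP : 0 < profile ν (r ^ 2) := by linarith [one_le_profile hν (sq_nonneg r)]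
    have hD : 0 < D (r ^ 2) := by
      have := one_le_profile (ν := ν + 1) (by linarith) (sq_nonneg r)
      simp only [D]; positivity
    have e2 : r ^ m = r ^ (m - 2) * r ^ 2 := by
      rw [← Real.rpow_natCast, ← Real.rpow_add hr0]; congr 1; push_cast; ring
    have e4 : r ^ (-2 : ℝ) = (r ^ 2)⁻¹ := by
      rw [Real.rpow_neg hr0.le]; norm_cast
    apply mul_nonpos_of_nonneg_of_nonpos (by positivity)
    have h1 : m ^ 2 * r ^ (-2 : ℝ) * (r ^ m * profile ν (r ^ 2)) =
        m ^ 2 * r ^ (m - 2) * profile ν (r ^ 2) := by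
      rw [e2, e4]; field_simp
    have h2 : 0 ≤ m ^ 2 * r ^ (-2 : ℝ) *
        (2 * (r ^ (m + 1) * D (r ^ 2)) + m * (r ^ (m - 1) * profile ν (r ^ 2))) := by positivity
    have h3 : 0 ≤ m * r ^ (m - 2) * profile ν (r ^ 2) := by positivity
    nlinarith

/-- The profile grows at most like `r^{-m} e^r`, where `m = ν - 1/2`. -/
theorem exists_profile_le {ν m : ℝ} (hν : 1 / 2 ≤ ν) (hm : m = (2 * ν - 1) / 2) :
    ∃ C > 0, ∀ r : ℝ, 0 ≤ r → profile ν (r ^ 2) ≤ C * ((1 + r) ^ (-m) * Real.exp r) := by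
  have hν0 : 0 < ν := by linarith
  have hm0 : 0 ≤ m := by rw [hm]; linarith
  set E : ℝ → ℝ := fun r : ℝ => (Real.exp (-r) * (r ^ m * profile ν (r ^ 2) +
      2 * (r ^ (m + 1) * (profile (ν + 1) (r ^ 2) / (4 * ν))) +
      m * (r ^ (m - 1) * profile ν (r ^ 2)))) * Real.exp (m ^ 2 * r⁻¹) with hE
  have hanti : AntitoneOn E (Ici 1) := antitoneOn_profile_energy hν hm
  have hP : ∀ r : ℝ, 1 ≤ profile ν (r ^ 2) := fun r => one_le_profile hν (sq_nonneg r)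
  have hP' : ∀ r : ℝ, 1 ≤ profile (ν + 1) (r ^ 2) := fun r =>
    one_le_profile (by linarith) (sq_nonneg r)
  have hlow : ∀ r : ℝ, 1 ≤ r → Real.exp (-r) * (r ^ m * profile ν (r ^ 2)) ≤ E r := by
    intro r hr
    have h0 : 0 < r := by linarith
    have h1 := hP r
    have h2 := hP' r
    have h3 : 1 ≤ Real.exp (m ^ 2 * r⁻¹) := Real.one_le_exp (by positivity)
    have h4 : Real.exp (-r) * (r ^ m * profile ν (r ^ 2)) ≤
        Real.exp (-r) * (r ^ m * profile ν (r ^ 2) +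
      2 * (r ^ (m + 1) * (profile (ν + 1) (r ^ 2) / (4 * ν))) +
      m * (r ^ (m - 1) * profile ν (r ^ 2))) := by
      apply mul_le_mul_of_nonneg_left _ (Real.exp_pos _).le
      have : 0 ≤ 2 * (r ^ (m + 1) * (profile (ν + 1) (r ^ 2) / (4 * ν))) := by positivity
      have : 0 ≤ m * (r ^ (m - 1) * profile ν (r ^ 2)) := by positivity
      linarith
    refine h4.trans (le_mul_of_one_le_right ?_ h3)
    have : 0 ≤ Real.exp (-r) * (r ^ m * profile ν (r ^ 2)) := by positivity
    linarith
  have hE1 : 0 < E 1 := by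
    refine lt_of_lt_of_le ?_ (hlow 1 le_rfl)
    have := hP 1
    positivity
  have h2pos : (0 : ℝ) < 2 ^ m := by positivity
  -- `E 1` controls `r ≥ 1` through monotonicity and `profile ν 1` controls `r ≤ 1`. The factor
  -- `2^m` pays for replacing `r^(-m)`, respectively `1`, by `(1+r)^(-m)`.
  refine ⟨2 ^ m * (E 1 + profile ν 1), by have := hP 1; simp at this; positivity, fun r hr => ?_⟩
  have hP1 := hP 1
  simp only [one_pow] at hP1
  rcases le_total r 1 with h | h
  · have h1 : profile ν (r ^ 2) ≤ profile ν 1 := profile_mono hν (sq_nonneg r) (by nlinarith)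
    have h2 : (2 : ℝ) ^ (-m) ≤ (1 + r) ^ (-m) :=
      Real.rpow_le_rpow_of_nonpos (by linarith) (by linarith) (by linarith)
    have h3 : 1 ≤ Real.exp r := Real.one_le_exp hr
    have h4 : (2 : ℝ) ^ m * 2 ^ (-m) = 1 := by
      rw [← Real.rpow_add two_pos]; simp
    calc profile ν (r ^ 2) ≤ (E 1 + profile ν 1) * 1 := by linarith
      _ = (2 ^ m * (E 1 + profile ν 1)) * (2 ^ (-m) * 1) := by
        linear_combination (-(E 1 + profile ν 1)) * h4
      _ ≤ _ := by gcongr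
  · have h0 : 0 < r := by linarith
    have h1 := (hlow r h).trans (hanti self_mem_Ici h h)
    have h2 : (2 * r) ^ (-m) ≤ (1 + r) ^ (-m) :=
      Real.rpow_le_rpow_of_nonpos (by linarith) (by linarith) (by linarith)
    have h3 : (2 : ℝ) ^ m * 2 ^ (-m) = 1 := by
      rw [← Real.rpow_add two_pos]; simp
    have h4 : r ^ m * r ^ (-m) = 1 := by
      rw [← Real.rpow_add h0]; simp
    have h5 : Real.exp r * Real.exp (-r) = 1 := by rw [← Real.exp_add]; simp
    rw [Real.mul_rpow two_pos.le hr] at h2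
    calc profile ν (r ^ 2) = (Real.exp r * Real.exp (-r)) * (r ^ m * r ^ (-m)) *
          profile ν (r ^ 2) := by rw [h4, h5]; ring
      _ = (Real.exp r * r ^ (-m)) * (Real.exp (-r) * (r ^ m * profile ν (r ^ 2))) := by ring
      _ ≤ (Real.exp r * r ^ (-m)) * E 1 := by gcongr
      _ ≤ (Real.exp r * r ^ (-m)) * (E 1 + profile ν 1) := by gcongr; linarith
      _ = (2 ^ m * (E 1 + profile ν 1)) * ((2 ^ (-m) * r ^ (-m)) * Real.exp r) := by
        linear_combination (-(Real.exp r * r ^ (-m)) * (E 1 + profile ν 1)) * h3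
      _ ≤ _ := by gcongr


/-! ### One-dimensional calculus -/

/-- Integration by parts against the primitive of an integrable function. -/
theorem integral_mul_eq_sub_integral_primitive {k η η' : ℝ → ℝ} {R : ℝ} (hR : 0 ≤ R)
    (hk : IntegrableOn k (Ioo 0 R)) (hη : ∀ t, HasDerivAt η (η' t) t) (hη' : Continuous η') :
    ∫ t in Ioo 0 R, η t * k t =
      η R * (∫ s in (0 : ℝ)..R, k s) - ∫ t in Ioo 0 R, η' t * ∫ s in (0 : ℝ)..t, k s := by
  have hki : IntervalIntegrable k volume 0 R := by
    rw [intervalIntegrable_iff_integrableOn_Ioo_of_le hR]; exact hk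
  -- `k` is merely integrable, so its primitive is only absolutely continuous and integration by
  -- parts is done in that class.
  have hKac := hki.absolutelyContinuousOnInterval_intervalIntegral (c := 0) left_mem_uIcc
  have hd : deriv η = η' := funext fun t => (hη t).deriv
  have hηac : AbsolutelyContinuousOnInterval η 0 R := by
    apply ContDiffOn.absolutelyContinuousOnInterval
    apply ContDiff.contDiffOn
    rw [contDiff_one_iff_deriv, hd]
    exact ⟨fun t => (hη t).differentiableAt, hη'⟩
  have h := hηac.integral_mul_deriv_eq_deriv_mul hKac
  simp only [intervalIntegral.integral_same, mul_zero, sub_zero, hd] at h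
  have e : ∀ F : ℝ → ℝ, ∫ t in Ioo 0 R, F t = ∫ t in (0 : ℝ)..R, F t := fun F => by
    rw [intervalIntegral.integral_of_le hR, integral_Ioc_eq_integral_Ioo]
  rw [e, e, ← h]
  apply intervalIntegral.integral_congr_ae
  filter_upwards [hki.ae_hasDerivAt_integral] with t ht ht'
  rw [(ht (uIoc_subset_uIcc ht') 0 left_mem_uIcc).deriv]

/-- Du Bois-Reymond: the weak form of `m' = k`, `m(0) = c` on `[0,T)` implies the integrated
form. -/
theorem eq_add_integral_of_weak {k m : ℝ → ℝ} {c T : ℝ} (hT : 0 < T)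
    (hk : IntegrableOn k (Ioo 0 T)) (hm : ContinuousOn m (Ico 0 T))
    (h : ∀ η : ℝ → ℝ, ContDiff ℝ ∞ η → HasCompactSupport η → (∀ t ∈ tsupport η, t < T) →
      c * η 0 + ∫ t in Ioo 0 T, η t * k t = - ∫ t in Ioo 0 T, deriv η t * m t) :
    ∀ t ∈ Ico 0 T, m t = c + ∫ s in (0 : ℝ)..t, k s := by
  have hki : IntervalIntegrable k volume 0 T := by
    rw [intervalIntegrable_iff_integrableOn_Ioo_of_le hT.le]; exact hk
  have hKc : ContinuousOn (fun t => ∫ s in (0 : ℝ)..t, k s) (Icc 0 T) := by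
    have := (hki.absolutelyContinuousOnInterval_intervalIntegral (c := 0) left_mem_uIcc).continuousOn
    rwa [uIcc_of_le hT.le] at this
  have hc2 : ContinuousOn (fun t => c + ∫ s in (0 : ℝ)..t, k s) (Ico 0 T) :=
    continuousOn_const.add (hKc.mono Ico_subset_Icc_self)
  refine Measure.eqOn_Ico_of_ae_eq (μ := volume) ?_ hm hc2
  have hdc : ContinuousOn (fun t => m t - (c + ∫ s in (0 : ℝ)..t, k s)) (Ioo 0 T) :=
    (hm.sub hc2).mono Ioo_subset_Ico_self
  have key : ∀ᵐ t, t ∈ Ioo 0 T → m t - (c + ∫ s in (0 : ℝ)..t, k s) = 0 := by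
    refine isOpen_Ioo.ae_eq_zero_of_integral_contDiff_smul_eq_zero
      (hdc.locallyIntegrableOn measurableSet_Ioo) fun g hg hgc hgs => ?_
    -- the test function: a cut-off primitive of `g`
    set P : ℝ → ℝ := fun t => (∫ s in (0 : ℝ)..t, g s) - ∫ s in (0 : ℝ)..T, g s with hP
    have hgcont : Continuous g := hg.continuous
    have hPd : ∀ t, HasDerivAt P (g t) t := fun t =>
      (intervalIntegral.integral_hasDerivAt_right (hgcont.intervalIntegrable _ _)
        (hgcont.stronglyMeasurableAtFilter _ _) hgcont.continuousAt).sub_const _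
    have hPsm : ContDiff ℝ ∞ P := by
      rw [contDiff_infty_iff_deriv, funext fun t => (hPd t).deriv]
      exact ⟨fun t => (hPd t).differentiableAt, hg⟩
    obtain ⟨α, β, hα, hαβ, hβ, hsub⟩ : ∃ α β : ℝ, 0 < α ∧ α ≤ β ∧ β < T ∧ tsupport g ⊆ Icc α β := by
      rcases (tsupport g).eq_empty_or_nonempty with he | hne
      · exact ⟨T / 2, T / 2, by linarith, le_rfl, by linarith, by simp [he]⟩
      · obtain ⟨x, hx, hx'⟩ := hgc.isCompact.exists_isLeast hne
        obtain ⟨y, hy, hy'⟩ := hgc.isCompact.exists_isGreatest hne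
        exact ⟨x, y, (hgs hx).1, hx' hy, (hgs hy).2, fun z hz => ⟨hx' hz, hy' hz⟩⟩
    have hg0 : ∀ t, t ∉ Icc α β → g t = 0 := fun t ht => image_eq_zero_of_notMem_tsupport
      fun h => ht (hsub h)
    have hPT : ∀ t, β ≤ t → P t = 0 := by
      intro t ht
      simp only [hP]
      rw [intervalIntegral.integral_interval_sub_left (hgcont.intervalIntegrable _ _)
        (hgcont.intervalIntegrable _ _)]
      refine (intervalIntegral.integral_congr_ae (g := fun _ => 0) ?_).trans (by simp)
      have hne : ∀ᵐ x : ℝ, x ≠ β := by simp [ae_iff]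
      filter_upwards [hne] with x hx hx'
      refine hg0 x fun h => hx ?_
      have : min T t < x := hx'.1
      have h3 : β ≤ min T t := le_min hβ.le ht
      linarith [h.2]
    -- `P` already vanishes beyond `supp g` on the right. The smooth transition cuts it off between
    -- times `-2` and `-1`, which is invisible on `[0,T)`, so that `η` has compact support on the
    -- whole line.
    set η : ℝ → ℝ := fun t => Real.smoothTransition (t + 2) * P t with hη
    have hηsm : ContDiff ℝ ∞ η :=
      (Real.smoothTransition.contDiff.comp (contDiff_id.add contDiff_const)).mul hPsm
    have hηP : ∀ t, -1 < t → η t = P t := fun t ht => by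
      simp only [hη]; rw [Real.smoothTransition.one_of_one_le (by linarith), one_mul]
    have hsupp : Function.support η ⊆ Icc (-2) β := by
      intro t ht
      rw [Function.mem_support] at ht
      by_contra hc
      apply ht
      simp only [hη]
      rw [mem_Icc, not_and_or] at hc
      rcases hc with hc | hc
      · rw [Real.smoothTransition.zero_of_nonpos (by linarith), zero_mul]
      · rw [hPT t (by linarith), mul_zero]
    have htsupp : tsupport η ⊆ Icc (-2) β := closure_minimal hsupp isClosed_Icc
    have hw := h η hηsm (HasCompactSupport.of_support_subset_isCompact isCompact_Icc hsupp)
      fun t ht => lt_of_le_of_lt (htsupp ht).2 hβ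
    have hηd : ∀ t ∈ Ioo 0 T, deriv η t = g t := fun t ht => by
      have : η =ᶠ[nhds t] P := by
        filter_upwards [Ioi_mem_nhds (show (-1 : ℝ) < t by linarith [ht.1])] with s hs
        exact hηP s hs
      rw [this.deriv_eq, (hPd t).deriv]
    have e1 : ∫ t in Ioo 0 T, η t * k t = ∫ t in Ioo 0 T, P t * k t :=
      setIntegral_congr_fun measurableSet_Ioo fun t ht => by
        show η t * k t = P t * k t
        rw [hηP t (by linarith [ht.1])]
    have e2 : ∫ t in Ioo 0 T, deriv η t * m t = ∫ t in Ioo 0 T, g t * m t :=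
      setIntegral_congr_fun measurableSet_Ioo fun t ht => by
        show deriv η t * m t = g t * m t
        rw [hηd t ht]
    have hP0 : η 0 = - ∫ t in Ioo 0 T, g t := by
      rw [hηP 0 (by norm_num)]
      simp only [hP, intervalIntegral.integral_same, zero_sub]
      rw [intervalIntegral.integral_of_le hT.le, integral_Ioc_eq_integral_Ioo]
    rw [e1, e2, hP0, integral_mul_eq_sub_integral_primitive hT.le hk hPd hgcont,
      hPT T hβ.le] at hw
    have hint : ∀ F : ℝ → ℝ, ContinuousOn F (Ioo 0 T) →
        IntegrableOn (fun t => g t * F t) (Ioo 0 T) := by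
      intro F hF
      have hsub' : Icc α β ⊆ Ioo 0 T := fun t ht => ⟨by linarith [ht.1], by linarith [ht.2]⟩
      have h1 : IntegrableOn (fun t => g t * F t) (Icc α β) :=
        (hgcont.continuousOn.mul (hF.mono hsub')).integrableOn_compact isCompact_Icc
      exact h1.of_forall_sdiff_eq_zero measurableSet_Ioo fun t ht => by
        rw [hg0 t ht.2, zero_mul]
    have i1 := hint m (hm.mono Ioo_subset_Ico_self)
    have i2 := hint (fun t => ∫ s in (0 : ℝ)..t, k s)
      (hKc.mono Ioo_subset_Icc_self)
    have i3 := hint (fun t => c) continuousOn_const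
    have hfin : ∫ t in Ioo 0 T, g t * (m t - (c + ∫ s in (0 : ℝ)..t, k s)) = 0 := by
      have : ∀ t, g t * (m t - (c + ∫ s in (0 : ℝ)..t, k s)) =
          g t * m t - (g t * c + g t * ∫ s in (0 : ℝ)..t, k s) := fun t => by ring
      simp_rw [this]
      have i4 : IntegrableOn (fun t => g t * c + g t * ∫ s in (0 : ℝ)..t, k s) (Ioo 0 T) := i3.add i2
      rw [integral_sub i1 i4, integral_add i3 i2, integral_mul_const]
      linarith
    simp only [smul_eq_mul]
    refine (setIntegral_eq_integral_of_forall_compl_eq_zero (s := Ioo 0 T) fun t ht => ?_).symm.trans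
      hfin
    rw [hg0 t fun h => ht ⟨by linarith [h.1], by linarith [h.2]⟩, zero_mul]
  rw [Filter.EventuallyEq, ae_restrict_iff' measurableSet_Ico]
  have hne : ∀ᵐ x : ℝ, x ≠ 0 := by simp [ae_iff]
  filter_upwards [key, hne] with t ht h0 ht'
  linarith [ht ⟨lt_of_le_of_ne ht'.1 (Ne.symm h0), ht'.2⟩]


/-! ### The positive solutions of `Δφ = l² φ` -/

/-- The radial solution `φ_l` of `Δφ = l² φ` with `φ(0) = 1`. -/
noncomputable def waveProfile (N : ℕ) (l : ℝ) (x : Space N) : ℝ :=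
  profile ((N : ℝ) / 2) (l ^ 2 * ‖x‖ ^ 2)

lemma half_le_dim {N : ℕ} (hN : 1 ≤ N) : (1 : ℝ) / 2 ≤ (N : ℝ) / 2 := by
  have : (1 : ℝ) ≤ N := by exact_mod_cast hN
  linarith

lemma contDiff_waveProfile {N : ℕ} (hN : 1 ≤ N) (l : ℝ) : ContDiff ℝ ∞ (waveProfile N l) :=
  (contDiff_profile (half_le_dim hN)).comp (contDiff_const.mul (contDiff_norm_sq ℝ))

lemma one_le_waveProfile {N : ℕ} (hN : 1 ≤ N) (l : ℝ) (x : Space N) : 1 ≤ waveProfile N l x :=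
  one_le_profile (half_le_dim hN) (by positivity)

lemma waveProfile_pos {N : ℕ} (hN : 1 ≤ N) (l : ℝ) (x : Space N) : 0 < waveProfile N l x :=
  one_pos.trans_le (one_le_waveProfile hN l x)

lemma waveProfile_zero {N : ℕ} (x : Space N) : waveProfile N 0 x = 1 := by
  simp [waveProfile, profile_zero]

/-- Upper bound for `φ_l`. -/
theorem exists_waveProfile_le {N : ℕ} (hN : 1 ≤ N) : ∃ C > 0, ∀ l : ℝ, 0 ≤ l → ∀ x : Space N,
    waveProfile N l x ≤
      C * ((1 + l * ‖x‖) ^ (-(((N : ℝ) - 1) / 2)) * Real.exp (l * ‖x‖)) := by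
  obtain ⟨C, hC, h⟩ := exists_profile_le (m := ((N : ℝ) - 1) / 2) (half_le_dim hN) (by ring)
  refine ⟨C, hC, fun l hl x => ?_⟩
  rw [waveProfile, ← mul_pow]
  exact h _ (by positivity)

lemma hasFDerivAt_waveProfile {N : ℕ} (hN : 1 ≤ N) (l : ℝ) (x : Space N) :
    HasFDerivAt (waveProfile N l)
      ((profile ((N : ℝ) / 2 + 1) (l ^ 2 * ‖x‖ ^ 2) / (4 * ((N : ℝ) / 2)) * (l ^ 2 * 2)) •
        innerSL ℝ x) x := by
  have h1 := (hasStrictFDerivAt_norm_sq x).hasFDerivAt.const_mul (l ^ 2)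
  have h2 := (hasDerivAt_profile (half_le_dim hN) (l ^ 2 * ‖x‖ ^ 2)).comp_hasFDerivAt x h1
  refine h2.congr_fderiv ?_
  ext v
  simp
  ring

/-- With `s = l²|x|²` the `i`-th second derivative is `2l²P'(s) + 4l⁴ x_i² P''(s)`. Summing over `i`
gives `l²(4sP'' + 2N P')`, and `2N = 4ν` turns this into `l²P` by `profile_ode`. -/
lemma sum_fderiv_fderiv_waveProfile {N : ℕ} (hN : 1 ≤ N) (l : ℝ) (x : Space N) :
    ∑ i : Fin N, fderiv ℝ (fun y => fderiv ℝ (waveProfile N l) y (EuclideanSpace.single i 1)) x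
      (EuclideanSpace.single i 1) = l ^ 2 * waveProfile N l x := by
  set ν : ℝ := (N : ℝ) / 2 with hν
  have hν2 : 1 / 2 ≤ ν := half_le_dim hN
  have hν0 : 0 < ν := by linarith
  set s : ℝ := l ^ 2 * ‖x‖ ^ 2 with hs
  have hi : ∀ i : Fin N,
      fderiv ℝ (fun y => fderiv ℝ (waveProfile N l) y (EuclideanSpace.single i 1)) x
        (EuclideanSpace.single i 1) =
      l ^ 2 * 2 * (profile (ν + 1) s / (4 * ν)) + 4 * l ^ 4 *
        (profile (ν + 1 + 1) s / (4 * (ν + 1)) / (4 * ν)) * (x i) ^ 2 := by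
    intro i
    have e : (fun y => fderiv ℝ (waveProfile N l) y (EuclideanSpace.single i 1)) =
        fun y : Space N => profile (ν + 1) (l ^ 2 * ‖y‖ ^ 2) * (l ^ 2 * 2 / (4 * ν) * y i) := by
      funext y
      rw [(hasFDerivAt_waveProfile hN l y).fderiv]
      simp [EuclideanSpace.inner_single_right, hν]
      ring
    have h1 := (hasStrictFDerivAt_norm_sq x).hasFDerivAt.const_mul (l ^ 2)
    have h2 := (hasDerivAt_profile (ν := ν + 1) (by linarith) s).comp_hasFDerivAt x h1
    have h3 : HasFDerivAt (fun y : Space N => l ^ 2 * 2 / (4 * ν) * y i)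
        ((l ^ 2 * 2 / (4 * ν)) • (EuclideanSpace.proj i : Space N →L[ℝ] ℝ)) x :=
      (EuclideanSpace.proj i : Space N →L[ℝ] ℝ).hasFDerivAt.const_mul _
    have h4 := h2.mul h3
    rw [e]
    have h5 := h4.fderiv
    rw [show (fun y : Space N => profile (ν + 1) (l ^ 2 * ‖y‖ ^ 2) * (l ^ 2 * 2 / (4 * ν) * y i)) =
      ((profile (ν + 1) ∘ fun y : Space N => l ^ 2 * ‖y‖ ^ 2) *
        fun y : Space N => l ^ 2 * 2 / (4 * ν) * y i) from rfl]
    rw [h5]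
    simp [EuclideanSpace.inner_single_right]
    rw [← hs]
    field_simp
    ring
  simp_rw [hi]
  have hn : ∑ i : Fin N, (x i) ^ 2 = ‖x‖ ^ 2 := by
    rw [EuclideanSpace.norm_sq_eq]; simp
  rw [Finset.sum_add_distrib, Finset.sum_const, ← Finset.mul_sum, hn]
  simp only [Finset.card_univ, Fintype.card_fin, nsmul_eq_mul]
  have hN2 : (N : ℝ) = 2 * ν := by rw [hν]; ring
  have ode := profile_ode hν2 s
  rw [waveProfile, ← hν, ← hs, ← ode, hN2, hs]
  ring

lemma gradient_apply {N : ℕ} (ψ : Space N → ℝ) (x : Space N) (i : Fin N) :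
    gradient ψ x i = fderiv ℝ ψ x (EuclideanSpace.single i 1) := by
  have : inner ℝ (gradient ψ x) (EuclideanSpace.single i (1 : ℝ)) =
      fderiv ℝ ψ x (EuclideanSpace.single i 1) := by
    simp [gradient]
  rw [← this, EuclideanSpace.inner_single_right]
  simp

/-- Partial derivatives of test functions are test functions. -/
lemma contDiff_partial {N : ℕ} {θ : Space N → ℝ} (h : ContDiff ℝ ∞ θ) (i : Fin N) :
    ContDiff ℝ ∞ (fun y => fderiv ℝ θ y (EuclideanSpace.single i 1)) :=
  (h.fderiv_right (m := ∞) (by simp)).clm_apply contDiff_const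

lemma memLp_two_of_smooth {N : ℕ} {θ : Space N → ℝ} (h : Continuous θ)
    (hc : HasCompactSupport θ) : MemLp θ 2 (volume : Measure (Space N)) :=
  h.memLp_of_hasCompactSupport hc

/-- Green's formula for a Sobolev function and a test function. -/
theorem IsWeakGradient.integral_inner_gradient {N : ℕ} {u : L2 N} {w : L2Vec N}
    (h : IsWeakGradient u w) {θ : Space N → ℝ} (hθ : ContDiff ℝ ∞ θ) (hc : HasCompactSupport θ) :
    ∫ x, inner ℝ (w x) (gradient θ x) =
      - ∫ x, u x * ∑ i : Fin N, fderiv ℝ (fun y => fderiv ℝ θ y (EuclideanSpace.single i 1)) x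
        (EuclideanSpace.single i 1) := by
  have hpc : ∀ i : Fin N, HasCompactSupport
      (fun y => fderiv ℝ θ y (EuclideanSpace.single i 1)) := fun i =>
    (hc.fderiv (𝕜 := ℝ)).comp_left (g := fun L : Space N →L[ℝ] ℝ => L (EuclideanSpace.single i 1))
      (by simp)
  have hw : ∀ i : Fin N, MemLp (fun x => (w x) i) 2 (volume : Measure (Space N)) := fun i =>
    (EuclideanSpace.proj i : Space N →L[ℝ] ℝ).comp_memLp' (Lp.memLp w)
  have hi1 : ∀ i : Fin N, Integrable
      (fun x => (w x) i * fderiv ℝ θ x (EuclideanSpace.single i 1)) := fun i =>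
    (hw i).integrable_mul (memLp_two_of_smooth (contDiff_partial hθ i).continuous (hpc i))
  have hi2 : ∀ i : Fin N, Integrable
      (fun x => u x * fderiv ℝ (fun y => fderiv ℝ θ y (EuclideanSpace.single i 1)) x
        (EuclideanSpace.single i 1)) := fun i =>
    (Lp.memLp u).integrable_mul (memLp_two_of_smooth
      (contDiff_partial (contDiff_partial hθ i) i).continuous
      (((hpc i).fderiv (𝕜 := ℝ)).comp_left
        (g := fun L : Space N →L[ℝ] ℝ => L (EuclideanSpace.single i 1)) (by simp)))
  have e1 : ∀ x, inner ℝ (w x) (gradient θ x) =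
      ∑ i : Fin N, (w x) i * fderiv ℝ θ x (EuclideanSpace.single i 1) := fun x => by
    rw [PiLp.inner_apply]
    refine Finset.sum_congr rfl fun i _ => ?_
    rw [gradient_apply]
    simp [mul_comm]
  simp_rw [e1, Finset.mul_sum]
  rw [integral_finsetSum _ fun i _ => hi1 i, integral_finsetSum _ fun i _ => hi2 i,
    ← Finset.sum_neg_distrib]
  refine Finset.sum_congr rfl fun i _ => ?_
  have := h _ (contDiff_partial hθ i) (hpc i) i
  simp_rw [gradient_apply] at this
  rw [this, neg_neg]

/-- A test function that agrees with `φ_l` on a ball. -/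
theorem exists_cutoff_waveProfile {N : ℕ} (hN : 1 ≤ N) (l : ℝ) {ρ : ℝ} (hρ : 0 < ρ) :
    ∃ θ : Space N → ℝ, ContDiff ℝ ∞ θ ∧ HasCompactSupport θ ∧
      (∀ x, ‖x‖ ≤ ρ → θ x = waveProfile N l x) ∧
      ∀ x, ‖x‖ ≤ ρ → ∑ i : Fin N,
        fderiv ℝ (fun y => fderiv ℝ θ y (EuclideanSpace.single i 1)) x
          (EuclideanSpace.single i 1) = l ^ 2 * waveProfile N l x := by
  -- The bump equals `1` up to radius `ρ + 1`, so second derivatives also agree on the closed ball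
  -- of radius `ρ`, boundary included.
  let χ : ContDiffBump (0 : Space N) := ⟨ρ + 1, ρ + 2, by linarith, by linarith⟩
  have hχ : ∀ x : Space N, ‖x‖ ≤ ρ + 1 → χ x = 1 := fun x hx =>
    χ.one_of_mem_closedBall (by simpa using hx)
  refine ⟨fun x => χ x * waveProfile N l x, χ.contDiff.mul (contDiff_waveProfile hN l),
    χ.hasCompactSupport.mul_right, fun x hx => by
      simp only [hχ x (by linarith), one_mul], fun x hx => ?_⟩
  rw [← sum_fderiv_fderiv_waveProfile hN l x]
  refine Finset.sum_congr rfl fun i _ => ?_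
  have h1 : ∀ y : Space N, ‖y‖ < ρ + 1 →
      (fun x => χ x * waveProfile N l x) =ᶠ[nhds y] waveProfile N l := fun y hy => by
    have : {z : Space N | ‖z‖ < ρ + 1} ∈ nhds y :=
      (isOpen_lt continuous_norm continuous_const).mem_nhds hy
    filter_upwards [this] with z hz
    rw [hχ z (le_of_lt hz), one_mul]
  have h2 : (fun y => fderiv ℝ (fun x => χ x * waveProfile N l x) y (EuclideanSpace.single i 1))
      =ᶠ[nhds x] fun y => fderiv ℝ (waveProfile N l) y (EuclideanSpace.single i 1) := by
    have : {z : Space N | ‖z‖ < ρ + 1} ∈ nhds x :=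
      (isOpen_lt continuous_norm continuous_const).mem_nhds (by simp; linarith)
    filter_upwards [this] with z hz
    rw [(h1 z hz).fderiv_eq]
  rw [h2.fderiv_eq]


/-! ### Pairing a weak solution with `φ_l` -/

/-- What the estimates use of a weak solution `u` supported in the light cone, with `v = ∂ₜu` and
`H = G(u,v)`: the pairings with `φ_l` solve a scalar equation. -/
structure ConeSolution {N : ℕ} (p q a b : ℝ) (f g : Space N → ℝ) (ε T r₀ : ℝ)
    (u v H : ℝ → Space N → ℝ) : Prop where
  memLp_u : ∀ t, MemLp (u t) 2
  memLp_v : ∀ t, MemLp (v t) 2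
  supp_u : ∀ t ∈ Ico 0 T, ∀ᵐ x, r₀ + t < ‖x‖ → u t x = 0
  supp_v : ∀ t ∈ Ico 0 T, ∀ᵐ x, r₀ + t < ‖x‖ → v t x = 0
  integrable_H : ∀ t, Integrable (H t)
  supp_H : ∀ᵐ t ∂(volume.restrict (Ioo 0 T)), ∀ᵐ x, r₀ + t < ‖x‖ → H t x = 0
  lower : ∀ᵐ t ∂(volume.restrict (Ioo 0 T)), ∀ᵐ x, a * |u t x| ^ q + b * |v t x| ^ p ≤ H t x
  hasDeriv : ∀ l, 0 ≤ l → ∀ t ∈ Ico 0 T, HasDerivWithinAt (fun s => ∫ x, u s x * waveProfile N l x)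
    (∫ x, v t x * waveProfile N l x) (Ico 0 T) t
  integrable_pairing : ∀ l, 0 ≤ l →
    IntegrableOn (fun t => ∫ x, H t x * waveProfile N l x) (Ioo 0 T)
  duhamel : ∀ l, 0 ≤ l → ∀ t ∈ Ico 0 T,
    Real.exp (-(l * t)) * ((∫ x, v t x * waveProfile N l x) + l * ∫ x, u t x * waveProfile N l x) =
      ε * (∫ x, (g x + l * f x) * waveProfile N l x) +
        ∫ s in (0 : ℝ)..t, Real.exp (-(l * s)) * ∫ x, H s x * waveProfile N l x
  initial : ∀ l, 0 ≤ l → ∫ x, u 0 x * waveProfile N l x = ε * ∫ x, f x * waveProfile N l x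

/-- Functions vanishing in the exterior of the cone at all later times have a derivative
vanishing there. -/
lemma supported_deriv {N : ℕ} {r₀ T : ℝ} {u v : ℝ → L2 N} (hs : SupportedInCone r₀ T u)
    (hd : ∀ t ∈ Ico 0 T, HasDerivWithinAt u (v t) (Ico 0 T) t) :
    SupportedInCone r₀ T v := by
  intro t ht
  have key : ∀ n : ℕ, ∀ᵐ x, r₀ + t + 1 / ((n : ℝ) + 1) < ‖x‖ → v t x = 0 := by
    -- The cone widens with time, so a margin `δ` is left: outside radius `r₀ + t + δ` all `u(s)`
    -- with `t ≤ s < t + δ` vanish, hence so does the one-sided derivative at `t`. The margin is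
    -- then sent to zero along `1/(n+1)`.
    intro n
    set δ : ℝ := 1 / ((n : ℝ) + 1) with hδ
    have hδ0 : 0 < δ := by positivity
    set S : Set (Space N) := {x | r₀ + t + δ < ‖x‖}
    have hS : MeasurableSet S := measurableSet_lt measurable_const measurable_norm
    set L := LpToLpRestrictCLM (Space N) ℝ ℝ (volume : Measure (Space N)) 2 S
    have hLz : ∀ w : L2 N, L w = 0 ↔ ∀ᵐ x, x ∈ S → w x = 0 := by
      intro w
      rw [← ae_restrict_iff' hS, Lp.eq_zero_iff_ae_eq_zero]
      have := LpToLpRestrictCLM_coeFn ℝ (μ := (volume : Measure (Space N))) S w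
      constructor
      · intro h
        filter_upwards [this, h] with x h1 h2
        rw [← h1, h2]; rfl
      · intro h
        filter_upwards [this, h] with x h1 h2
        rw [h1, h2]; rfl
    set b := min T (t + δ)
    have hb : t < b := lt_min ht.2 (by linarith)
    have h1 : HasDerivWithinAt (fun s => L (u s)) (L (v t)) (Ico t b) t :=
      (L.hasFDerivAt.comp_hasDerivWithinAt t (hd t ht)).mono fun s hs =>
        ⟨ht.1.trans hs.1, hs.2.trans_le (min_le_left _ _)⟩
    have h0 : ∀ s ∈ Ico t b, L (u s) = 0 := by
      intro s hs'
      rw [hLz]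
      filter_upwards [hs s ⟨ht.1.trans hs'.1, hs'.2.trans_le (min_le_left _ _)⟩] with x hx hxS
      apply hx
      have := hs'.2.trans_le (min_le_right _ _)
      have hxS' : r₀ + t + δ < ‖x‖ := hxS
      linarith
    have h2 : HasDerivWithinAt (fun s => L (u s)) 0 (Ico t b) t :=
      (hasDerivWithinAt_const t (Ico t b) 0).congr h0 (h0 t ⟨le_rfl, hb⟩)
    have hu : UniqueDiffWithinAt ℝ (Ico t b) t := uniqueDiffOn_Ico t b t ⟨le_rfl, hb⟩
    exact (hLz _).1 (hu.eq_deriv _ h1 h2)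
  filter_upwards [ae_all_iff.2 key] with x hx hxt
  obtain ⟨n, hn⟩ := exists_nat_one_div_lt (sub_pos.2 hxt)
  exact hx n (by linarith)

lemma dataRadius_nonneg {N : ℕ} (f g : Space N → ℝ) : 0 ≤ dataRadius f g := by
  apply Real.sSup_nonneg
  rintro _ ⟨x, -, rfl⟩
  exact norm_nonneg x

lemma norm_le_dataRadius {N : ℕ} {f g : Space N → ℝ} (hf : HasCompactSupport f)
    (hg : HasCompactSupport g) {x : Space N} (hx : x ∈ tsupport f ∪ tsupport g) :
    ‖x‖ ≤ dataRadius f g :=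
  le_csSup ((hf.isCompact.union hg.isCompact).image continuous_norm).bddAbove ⟨x, hx, rfl⟩

lemma isTestFunction_mul {N : ℕ} {T : ℝ} {η : ℝ → ℝ} {θ : Space N → ℝ} (hη : ContDiff ℝ ∞ η)
    (hηc : HasCompactSupport η) (hηT : ∀ t ∈ tsupport η, t < T) (hθ : ContDiff ℝ ∞ θ)
    (hθc : HasCompactSupport θ) : IsTestFunction T fun z : Space N × ℝ => η z.2 * θ z.1 := by
  have hsub : Function.support (fun z : Space N × ℝ => η z.2 * θ z.1) ⊆ tsupport θ ×ˢ tsupport η := by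
    intro z hz
    rw [Function.mem_support] at hz
    exact ⟨subset_tsupport _ (right_ne_zero_of_mul hz), subset_tsupport _ (left_ne_zero_of_mul hz)⟩
  refine ⟨(hη.comp contDiff_snd).mul (hθ.comp contDiff_fst),
    HasCompactSupport.of_support_subset_isCompact (hθc.isCompact.prod hηc.isCompact) hsub,
    fun z hz => hηT _ ?_⟩
  exact (closure_minimal hsub ((isClosed_tsupport θ).prod (isClosed_tsupport η)) hz).2

/-- Pairing an integrable function with a bounded continuous function. -/
lemma exists_pairingCLM {N : ℕ} {θ : Space N → ℝ} (h : Continuous θ) (hc : HasCompactSupport θ) :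
    ∃ Λ : L1 N →L[ℝ] ℝ, ∀ w : L1 N, Λ w = ∫ x, w x * θ x := by
  obtain ⟨C, hC⟩ := hc.exists_bound_of_continuous h
  have hint : ∀ w : L1 N, Integrable fun x => w x * θ x := fun w =>
    (L1.integrable_coeFn w).mul_bdd (c := C) h.aestronglyMeasurable (Filter.Eventually.of_forall hC)
  let Λ : L1 N →ₗ[ℝ] ℝ :=
    { toFun := fun w => ∫ x, w x * θ x
      map_add' := fun w z => by
        rw [← integral_add (hint w) (hint z)]
        refine integral_congr_ae ?_
        filter_upwards [Lp.coeFn_add w z] with x hx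
        rw [hx, Pi.add_apply, add_mul]
      map_smul' := fun c w => by
        rw [RingHom.id_apply, smul_eq_mul, ← integral_const_mul]
        refine integral_congr_ae ?_
        filter_upwards [Lp.coeFn_smul c w] with x hx
        rw [hx, Pi.smul_apply, smul_eq_mul, mul_assoc] }
  refine ⟨Λ.mkContinuous C fun w => ?_, fun w => rfl⟩
  rw [L1.norm_eq_integral_norm, ← integral_const_mul]
  refine norm_integral_le_of_norm_le ((L1.integrable_coeFn w).norm.const_mul C) ?_
  refine Filter.Eventually.of_forall fun x => ?_
  rw [norm_mul, mul_comm]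
  exact mul_le_mul_of_nonneg_right (hC x) (norm_nonneg _)

/-- Pairing a square-integrable function with a test function. -/
lemma exists_pairingCLM_two {N : ℕ} {θ : Space N → ℝ} (h : Continuous θ)
    (hc : HasCompactSupport θ) : ∃ Λ : L2 N →L[ℝ] ℝ, ∀ w : L2 N, Λ w = ∫ x, w x * θ x := by
  have hθ := memLp_two_of_smooth h hc
  refine ⟨innerSL ℝ hθ.toLp, fun w => ?_⟩
  rw [innerSL_apply_apply, L2.inner_def]
  refine integral_congr_ae ?_
  filter_upwards [hθ.coeFn_toLp] with x hx
  rw [hx]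
  simp

lemma integral_mul_congr_of_supp {N : ℕ} {w θ φ : Space N → ℝ} {ρ R : ℝ} (hR : ρ ≤ R)
    (hw : ∀ᵐ x, ρ < ‖x‖ → w x = 0) (hθ : ∀ x, ‖x‖ ≤ R → θ x = φ x) :
    ∫ x, w x * θ x = ∫ x, w x * φ x := by
  refine integral_congr_ae ?_
  filter_upwards [hw] with x hx
  rcases le_or_gt ‖x‖ ρ with h | h
  · rw [hθ x (h.trans hR)]
  · rw [hx h, zero_mul, zero_mul]

/-- The weak form of the equation, tested with a product. -/
lemma weak_product {N : ℕ} {G : ℝ × ℝ → ℝ} {g : Space N → ℝ} {ε T : ℝ} {u v : ℝ → L2 N}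
    {w : ℝ → L2Vec N} {H : ℝ → L1 N}
    (hw : ∀ t ∈ Ico 0 T, IsWeakGradient (u t) (w t))
    (hH : ∀ᵐ t ∂(volume.restrict (Ioo 0 T)), ∀ᵐ x, H t x = G (u t x, v t x))
    (hweak : ∀ Ψ : Space N × ℝ → ℝ, IsTestFunction T Ψ →
      ε * (∫ x, g x * Ψ (x, 0)) +
          ∫ t in Ioo 0 T, ∫ x, G (u t x, v t x) * Ψ (x, t) =
        ∫ t in Ioo 0 T, ∫ x,
          (-(v t x * deriv (fun s => Ψ (x, s)) t) +
            inner ℝ (w t x) (gradient (fun y => Ψ (y, t)) x)))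
    {η : ℝ → ℝ} {θ : Space N → ℝ} (hη : ContDiff ℝ ∞ η)
    (hηc : HasCompactSupport η) (hηT : ∀ t ∈ tsupport η, t < T) (hθ : ContDiff ℝ ∞ θ)
    (hθc : HasCompactSupport θ) :
    ε * (η 0 * ∫ x, g x * θ x) + ∫ t in Ioo 0 T, η t * ∫ x, H t x * θ x =
      ∫ t in Ioo 0 T, (-(deriv η t * ∫ x, v t x * θ x) - η t * ∫ x, u t x *
        ∑ i : Fin N, fderiv ℝ (fun y => fderiv ℝ θ y (EuclideanSpace.single i 1)) x
          (EuclideanSpace.single i 1)) := by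
  have h := hweak _ (isTestFunction_mul hη hηc hηT hθ hθc)
  have e1 : ∫ x, g x * (η 0 * θ x) = η 0 * ∫ x, g x * θ x := by
    rw [← integral_const_mul]; congr 1; funext x; ring
  have e2 : ∫ t in Ioo 0 T, ∫ x, G (u t x, v t x) * (η t * θ x) =
      ∫ t in Ioo 0 T, η t * ∫ x, H t x * θ x := by
    refine integral_congr_ae ?_
    filter_upwards [hH] with t ht
    rw [← integral_const_mul]
    refine integral_congr_ae ?_
    filter_upwards [ht] with x hx
    rw [hx]; ring
  have hgrad : ∀ (c : ℝ) (x : Space N), gradient (fun y => c * θ y) x = c • gradient θ x := by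
    intro c x
    have hd : DifferentiableAt ℝ θ x := (hθ.differentiable (by simp)).differentiableAt
    unfold gradient
    rw [show (fun y => c * θ y) = c • θ from rfl, fderiv_const_smul hd c]
    simp
  have e3 : ∀ t ∈ Ioo 0 T, ∫ x, (-(v t x * deriv (fun s => η s * θ x) t) +
      inner ℝ (w t x) (gradient (fun y => η t * θ y) x)) =
      (-(deriv η t * ∫ x, v t x * θ x) - η t * ∫ x, u t x *
        ∑ i : Fin N, fderiv ℝ (fun y => fderiv ℝ θ y (EuclideanSpace.single i 1)) x
          (EuclideanSpace.single i 1)) := by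
    intro t ht
    have hdη : DifferentiableAt ℝ η t := (hη.differentiable (by simp)).differentiableAt
    have e : ∀ x, (-(v t x * deriv (fun s => η s * θ x) t) +
      inner ℝ (w t x) (gradient (fun y => η t * θ y) x)) =
        -deriv η t * (v t x * θ x) + η t * inner ℝ (w t x) (gradient θ x) := by
      intro x
      rw [deriv_mul_const hdη, hgrad, inner_smul_right]
      ring
    simp_rw [e]
    have i1 : Integrable fun x => v t x * θ x :=
      (Lp.memLp (v t)).integrable_mul (memLp_two_of_smooth hθ.continuous hθc)
    have hgc : Continuous (gradient θ) :=
      (InnerProductSpace.toDual ℝ (Space N)).symm.continuous.comp (hθ.continuous_fderiv (by simp))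
    have hgs : HasCompactSupport (gradient θ) :=
      (hθc.fderiv (𝕜 := ℝ)).comp_left
        (g := (InnerProductSpace.toDual ℝ (Space N)).symm) (map_zero _)
    have i2 : Integrable fun x => inner ℝ (w t x) (gradient θ x) := by
      have hm : MemLp (gradient θ) 2 (volume : Measure (Space N)) :=
        hgc.memLp_of_hasCompactSupport hgs
      refine (L2.integrable_inner (𝕜 := ℝ) (w t) hm.toLp).congr ?_
      filter_upwards [hm.coeFn_toLp] with x hx
      rw [hx]
    rw [integral_add (i1.const_mul _) (i2.const_mul _), integral_const_mul, integral_const_mul,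
      (hw t ⟨ht.1.le, ht.2⟩).integral_inner_gradient hθ hθc]
    ring
  simp only at h
  rw [e1, e2, setIntegral_congr_fun measurableSet_Ioo e3] at h
  exact h

/-- Finite propagation allows the non-compactly supported `φ_l` as spatial test function: on the
cone up to time `T` it agrees with a test function `θ`, and so does its Laplacian. Everything is
reduced to scalar functions of `t` through the continuous functionals `w ↦ ∫ w θ`. -/
theorem IsWeakSolution.exists_coneSolution {N : ℕ} (hN : 1 ≤ N) {p q a b : ℝ}
    {G : ℝ × ℝ → ℝ} (hG0 : G (0, 0) = 0)
    (hGlow : ∀ s σ : ℝ, a * |s| ^ q + b * |σ| ^ p ≤ G (s, σ))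
    {f g : Space N → ℝ} (hf : ContDiff ℝ ∞ f) (hfc : HasCompactSupport f)
    (hg : ContDiff ℝ ∞ g) (hgc : HasCompactSupport g) {ε T : ℝ} (hT : 0 < T) {u : ℝ → L2 N}
    (hu : IsWeakSolution G f g ε T u) (hs : SupportedInCone (dataRadius f g) T u) :
    ∃ v H : ℝ → Space N → ℝ,
      ConeSolution p q a b f g ε T (dataRadius f g) (fun t x => u t x) v H := by
  obtain ⟨v, w, H, huc, hw, hwc, hd, hvc, hH, hHi, hu0, hv0, hweak⟩ := hu
  set r₀ := dataRadius f g with hr₀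
  have hr0 : 0 ≤ r₀ := dataRadius_nonneg f g
  have hsv := supported_deriv hs hd
  have hsH : ∀ᵐ t ∂(volume.restrict (Ioo 0 T)), ∀ᵐ x, r₀ + t < ‖x‖ → H t x = 0 := by
    filter_upwards [hH, ae_restrict_mem measurableSet_Ioo] with t ht htT
    filter_upwards [ht, hs t ⟨htT.1.le, htT.2⟩, hsv t ⟨htT.1.le, htT.2⟩] with x h1 h2 h3 hx
    rw [h1, h2 hx, h3 hx, hG0]
  have hdata : ∀ θ φ : Space N → ℝ, ∀ F : Space N → ℝ, (∀ x, ‖x‖ ≤ r₀ + T → θ x = φ x) →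
      (∀ x, r₀ < ‖x‖ → F x = 0) → ∫ x, F x * θ x = ∫ x, F x * φ x := fun θ φ F h1 h2 =>
    integral_mul_congr_of_supp (show r₀ ≤ r₀ + T by linarith) (Filter.Eventually.of_forall h2) h1
  have hf0 : ∀ x, r₀ < ‖x‖ → f x = 0 := fun x hx => image_eq_zero_of_notMem_tsupport fun h =>
    absurd (norm_le_dataRadius hfc hgc (Or.inl h)) (not_le.2 hx)
  have hg0 : ∀ x, r₀ < ‖x‖ → g x = 0 := fun x hx => image_eq_zero_of_notMem_tsupport fun h =>
    absurd (norm_le_dataRadius hfc hgc (Or.inr h)) (not_le.2 hx)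
  have main : ∀ l, 0 ≤ l → (∀ t ∈ Ico 0 T,
      HasDerivWithinAt (fun s => ∫ x, u s x * waveProfile N l x)
      (∫ x, v t x * waveProfile N l x) (Ico 0 T) t) ∧
      IntegrableOn (fun t => ∫ x, H t x * waveProfile N l x) (Ioo 0 T) ∧
      (∀ t ∈ Ico 0 T,
        Real.exp (-(l * t)) * ((∫ x, v t x * waveProfile N l x) +
          l * ∫ x, u t x * waveProfile N l x) =
        ε * (∫ x, (g x + l * f x) * waveProfile N l x) +
        ∫ s in (0 : ℝ)..t, Real.exp (-(l * s)) * ∫ x, H s x * waveProfile N l x) ∧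
      ∫ x, u 0 x * waveProfile N l x = ε * ∫ x, f x * waveProfile N l x := by
    intro l hl
    obtain ⟨θ, hθ, hθc, hθe, hθl⟩ := exists_cutoff_waveProfile hN l (ρ := r₀ + T) (by linarith)
    obtain ⟨Λ, hΛ⟩ := exists_pairingCLM_two hθ.continuous hθc
    obtain ⟨Λ₁, hΛ₁⟩ := exists_pairingCLM hθ.continuous hθc
    have eu : ∀ t ∈ Ico 0 T, Λ (u t) = ∫ x, u t x * waveProfile N l x := fun t ht => by
      rw [hΛ]
      exact integral_mul_congr_of_supp (by linarith [ht.2]) (hs t ht) hθe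
    have ev : ∀ t ∈ Ico 0 T, Λ (v t) = ∫ x, v t x * waveProfile N l x := fun t ht => by
      rw [hΛ]
      exact integral_mul_congr_of_supp (by linarith [ht.2]) (hsv t ht) hθe
    have eH : ∀ᵐ t ∂(volume.restrict (Ioo 0 T)),
        Λ₁ (H t) = ∫ x, H t x * waveProfile N l x := by
      filter_upwards [hsH, ae_restrict_mem measurableSet_Ioo] with t ht htT
      rw [hΛ₁]
      exact integral_mul_congr_of_supp (by linarith [htT.2]) ht hθe
    have el : ∀ t ∈ Ico 0 T, ∫ x, u t x *
        ∑ i : Fin N, fderiv ℝ (fun y => fderiv ℝ θ y (EuclideanSpace.single i 1)) x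
          (EuclideanSpace.single i 1) = l ^ 2 * Λ (u t) := fun t ht => by
      rw [eu t ht, ← integral_const_mul, integral_mul_congr_of_supp (by linarith [ht.2]) (hs t ht) hθl]
      congr 1; funext x; ring
    have hFd : ∀ t ∈ Ico 0 T, HasDerivWithinAt (fun s => Λ (u s)) (Λ (v t)) (Ico 0 T) t :=
      fun t ht => Λ.hasFDerivAt.comp_hasDerivWithinAt t (hd t ht)
    have hFc : ContinuousOn (fun s => Λ (u s)) (Ico 0 T) := Λ.continuous.comp_continuousOn huc
    have hVc : ContinuousOn (fun s => Λ (v s)) (Ico 0 T) := Λ.continuous.comp_continuousOn hvc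
    have hhi : IntegrableOn (fun t => Λ₁ (H t)) (Ioo 0 T) := Λ₁.integrable_comp hHi
    have hcexp : Continuous fun t : ℝ => Real.exp (-(l * t)) := by fun_prop
    have hinit : Λ (u 0) = ε * ∫ x, f x * waveProfile N l x := by
      rw [hΛ, ← hdata θ _ f hθe hf0, ← integral_const_mul]
      refine integral_congr_ae ?_
      filter_upwards [hu0] with x hx
      rw [hx]; ring
    have hki : IntegrableOn (fun t => Real.exp (-(l * t)) * Λ₁ (H t)) (Ioo 0 T) := by
      refine Integrable.bdd_mul (c := 1) hhi hcexp.aestronglyMeasurable ?_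
      filter_upwards [ae_restrict_mem measurableSet_Ioo] with t ht
      rw [Real.norm_eq_abs, abs_of_pos (Real.exp_pos _), Real.exp_le_one_iff]
      nlinarith [ht.1]
    -- Since `(e^(-lt)(F' + lF))' = e^(-lt)(F'' - l²F)`, the second-order weak equation tested with
    -- `e^(-lt) η(t) θ(x)`, together with the total derivative of `l e^(-lt) η F`, is a first-order
    -- weak equation for `e^(-lt)(F' + lF)` tested with `η`.
    have hdu := eq_add_integral_of_weak (k := fun t => Real.exp (-(l * t)) * Λ₁ (H t))
      (m := fun t => Real.exp (-(l * t)) * (Λ (v t) + l * Λ (u t)))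
      (c := ε * (∫ x, (g x + l * f x) * waveProfile N l x)) hT hki
      (hcexp.continuousOn.mul (hVc.add (continuousOn_const.mul hFc))) (by
        intro η hη hηc hηT
        have hηe : ContDiff ℝ ∞ fun t => Real.exp (-(l * t)) * η t :=
          (Real.contDiff_exp.comp (contDiff_const.mul contDiff_id).neg).mul hη
        have hsup : tsupport (fun t => Real.exp (-(l * t)) * η t) ⊆ tsupport η :=
          closure_mono fun t ht => right_ne_zero_of_mul ht
        have hw1 := weak_product hw hH hweak hηe hηc.mul_left (fun t ht => hηT t (hsup ht)) hθ hθc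
        have hηd : ∀ t, HasDerivAt η (deriv η t) t := fun t =>
          (hη.differentiable (by simp)).differentiableAt.hasDerivAt
        have hed : ∀ t, HasDerivAt (fun t => Real.exp (-(l * t))) (Real.exp (-(l * t)) * (-l)) t :=
          fun t => by
            have := ((hasDerivAt_id t).const_mul l).neg.exp
            simpa using this
        have hderiv : ∀ t, deriv (fun t => Real.exp (-(l * t)) * η t) t =
            Real.exp (-(l * t)) * (deriv η t - l * η t) := fun t => by
          have h3 := ((hed t).mul (hηd t)).deriv
          rw [show (fun t => Real.exp (-(l * t)) * η t) = (fun t => Real.exp (-(l * t))) * η from rfl,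
            h3]
          ring
        -- a time after which the test function vanishes
        obtain ⟨T', hT'0, hT'T, hT'η⟩ : ∃ T', 0 < T' ∧ T' < T ∧ ∀ t, T' ≤ t → η t = 0 ∧ deriv η t = 0 := by
          rcases (tsupport η).eq_empty_or_nonempty with he | hne
          · refine ⟨T / 2, by linarith, by linarith, fun t _ => ?_⟩
            have h0 : η = 0 := tsupport_eq_empty_iff.1 he
            simp [h0]
          · obtain ⟨y, hy, hy'⟩ := hηc.isCompact.exists_isGreatest hne
            have hyT := hηT y hy
            have hm : max y 0 < T := max_lt hyT hT
            have h1 := le_max_left y 0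
            have h2 := le_max_right y 0
            refine ⟨(max y 0 + T) / 2, by linarith, by linarith, fun t ht => ?_⟩
            have : t ∉ tsupport η := fun h => by linarith [hy' h]
            refine ⟨image_eq_zero_of_notMem_tsupport this, ?_⟩
            exact image_eq_zero_of_notMem_tsupport fun h => this (tsupport_deriv_subset h)
        -- The solution is continuous on `[0,T)` with no bound near `T`; integrability comes from
        -- the test function vanishing from `T' < T` on.
        have hint : ∀ F : ℝ → ℝ, ContinuousOn F (Ico 0 T) → (∀ t, T' ≤ t → F t = 0) →
            IntegrableOn F (Ioo 0 T) := by
          intro F hF hF0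
          have h1 : IntegrableOn F (Icc 0 T') :=
            (hF.mono fun t ht => ⟨ht.1, by linarith [ht.2]⟩).integrableOn_compact isCompact_Icc
          refine h1.of_forall_sdiff_eq_zero measurableSet_Ioo fun t ht => hF0 t ?_
          by_contra hc
          exact ht.2 ⟨ht.1.1.le, (not_le.1 hc).le⟩
        have hηc0 : Continuous η := hη.continuous
        have hηc1 : Continuous (deriv η) := hη.continuous_deriv (by simp)
        have hBc : ContinuousOn (fun t => deriv η t * (Real.exp (-(l * t)) *
            (Λ (v t) + l * Λ (u t)))) (Ico 0 T) :=
          hηc1.continuousOn.mul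
            (hcexp.continuousOn.mul (hVc.add (continuousOn_const.mul hFc)))
        have hAc : ContinuousOn (fun t => -(Real.exp (-(l * t)) * (deriv η t - l * η t) * Λ (v t)) -
            Real.exp (-(l * t)) * η t * (l ^ 2 * Λ (u t))) (Ico 0 T) :=
          ((hcexp.mul (hηc1.sub (continuous_const.mul hηc0))).continuousOn.mul hVc).neg.sub
            ((hcexp.mul hηc0).continuousOn.mul (continuousOn_const.mul hFc))
        have hB := hint _ hBc fun t ht => by rw [(hT'η t ht).2, zero_mul]
        have hA := hint _ hAc fun t ht => by rw [(hT'η t ht).1, (hT'η t ht).2]; ring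
        -- the fundamental theorem of calculus for `l η e^{-lt} F`
        have hsum : ∫ t in Ioo 0 T, ((-(Real.exp (-(l * t)) * (deriv η t - l * η t) * Λ (v t)) -
            Real.exp (-(l * t)) * η t * (l ^ 2 * Λ (u t))) +
            deriv η t * (Real.exp (-(l * t)) * (Λ (v t) + l * Λ (u t)))) =
            -(l * η 0 * Λ (u 0)) := by
          have hAB := hAc.add hBc
          have hTT' : Icc 0 T' ⊆ Ico 0 T := fun t ht => ⟨ht.1, by linarith [ht.2]⟩
          have e1 : ∫ t in Ioo 0 T, ((-(Real.exp (-(l * t)) * (deriv η t - l * η t) * Λ (v t)) -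
            Real.exp (-(l * t)) * η t * (l ^ 2 * Λ (u t))) +
            deriv η t * (Real.exp (-(l * t)) * (Λ (v t) + l * Λ (u t)))) =
            ∫ t in (0 : ℝ)..T', ((-(Real.exp (-(l * t)) * (deriv η t - l * η t) * Λ (v t)) -
            Real.exp (-(l * t)) * η t * (l ^ 2 * Λ (u t))) +
            deriv η t * (Real.exp (-(l * t)) * (Λ (v t) + l * Λ (u t)))) := by
            rw [intervalIntegral.integral_of_le hT'0.le, integral_Ioc_eq_integral_Ioo]
            refine setIntegral_eq_of_subset_of_forall_sdiff_eq_zero measurableSet_Ioo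
              (fun t ht => ⟨ht.1, by linarith [ht.2]⟩) fun t ht => ?_
            have hc : T' ≤ t := by
              by_contra hc
              exact ht.2 ⟨ht.1.1, not_le.1 hc⟩
            rw [(hT'η t hc).1, (hT'η t hc).2]; ring
          rw [e1]
          have hFTC := intervalIntegral.integral_eq_sub_of_hasDeriv_right (a := 0) (b := T')
            (f := fun t => l * (Real.exp (-(l * t)) * η t * Λ (u t)))
            (f' := fun t => (-(Real.exp (-(l * t)) * (deriv η t - l * η t) * Λ (v t)) -
            Real.exp (-(l * t)) * η t * (l ^ 2 * Λ (u t))) +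
            deriv η t * (Real.exp (-(l * t)) * (Λ (v t) + l * Λ (u t))))
            (by
              rw [uIcc_of_le hT'0.le]
              exact continuousOn_const.mul
                ((hcexp.mul hηc0).continuousOn.mul (hFc.mono hTT')))
            (by
              intro t ht
              rw [min_eq_left hT'0.le, max_eq_right hT'0.le] at ht
              have hmem : Ico 0 T ∈ nhds t :=
                Ico_mem_nhds ht.1 (by linarith [ht.2])
              have h1 := (hFd t ⟨ht.1.le, by linarith [ht.2]⟩).hasDerivAt hmem
              have h2 := ((((hed t).mul (hηd t)).mul h1).const_mul l).hasDerivWithinAt (s := Ioi t)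
              refine h2.congr_deriv ?_
              simp only [Pi.mul_apply]
              ring)
            (by
              apply ContinuousOn.intervalIntegrable
              rw [uIcc_of_le hT'0.le]
              exact hAB.mono hTT')
          rw [hFTC, (hT'η T' le_rfl).1]
          simp
          ring
        rw [integral_add hA hB] at hsum
        simp_rw [hderiv] at hw1
        have e4 : ∫ t in Ioo 0 T, Real.exp (-(l * t)) * η t * ∫ x, H t x * θ x =
            ∫ t in Ioo 0 T, η t * (Real.exp (-(l * t)) * Λ₁ (H t)) := by
          congr 1; funext t; rw [hΛ₁]; ring
        have e5 : ∫ t in Ioo 0 T,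
            (-(Real.exp (-(l * t)) * (deriv η t - l * η t) * ∫ x, v t x * θ x) -
            Real.exp (-(l * t)) * η t * ∫ x, u t x *
            ∑ i : Fin N, fderiv ℝ (fun y => fderiv ℝ θ y (EuclideanSpace.single i 1)) x
            (EuclideanSpace.single i 1)) =
            ∫ t in Ioo 0 T, (-(Real.exp (-(l * t)) * (deriv η t - l * η t) * Λ (v t)) -
            Real.exp (-(l * t)) * η t * (l ^ 2 * Λ (u t))) :=
          setIntegral_congr_fun measurableSet_Ioo fun t ht => by
            rw [el t ⟨ht.1.le, ht.2⟩, hΛ (v t)]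
        rw [e4, e5, hdata θ _ g hθe hg0] at hw1
        simp only [mul_zero, neg_zero, Real.exp_zero, one_mul] at hw1
        have hφc := (contDiff_waveProfile hN l).continuous
        have e6 : ∫ x, (g x + l * f x) * waveProfile N l x =
            (∫ x, g x * waveProfile N l x) + l * ∫ x, f x * waveProfile N l x := by
          rw [← integral_const_mul, ← integral_add]
          · congr 1; funext x; ring
          · exact (hg.continuous.mul hφc).integrable_of_hasCompactSupport hgc.mul_right
          · exact ((hf.continuous.mul hφc).integrable_of_hasCompactSupport
              hfc.mul_right).const_mul l
        rw [e6]
        linear_combination hw1 + hsum - l * η 0 * hinit)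
    refine ⟨fun t ht => ?_, hhi.congr eH, fun t ht => ?_, ?_⟩
    · rw [← ev t ht]
      exact (hFd t ht).congr (fun s hs => (eu s hs).symm) (eu t ht).symm
    · have := hdu t ht
      rw [eu t ht, ev t ht] at this
      rw [this]
      congr 1
      apply intervalIntegral.integral_congr_ae
      have eH' := (ae_restrict_iff' measurableSet_Ioo).1 eH
      have hne : ∀ᵐ x : ℝ, x ≠ t := by simp [ae_iff]
      filter_upwards [eH', hne] with s h1 h2 h3
      rw [uIoc_of_le ht.1] at h3
      rw [h1 ⟨h3.1, by linarith [h3.2, ht.2]⟩]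
    · rw [← eu 0 ⟨le_rfl, hT⟩, hinit]
  exact ⟨fun t x => v t x, fun t x => H t x,
    { memLp_u := fun t => Lp.memLp _
      memLp_v := fun t => Lp.memLp _
      supp_u := hs
      supp_v := hsv
      integrable_H := fun t => L1.integrable_coeFn _
      supp_H := hsH
      lower := by
        filter_upwards [hH] with t ht
        filter_upwards [ht] with x hx
        rw [hx]
        exact hGlow _ _
      hasDeriv := fun l hl => (main l hl).1
      integrable_pairing := fun l hl => (main l hl).2.1
      duhamel := fun l hl => (main l hl).2.2.1
      initial := fun l hl => (main l hl).2.2.2 }⟩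


/-! ### Elementary inequalities for powers -/

lemma exists_rpow_mul_exp_le (κ : ℝ) {σ : ℝ} (hσ : 0 < σ) :
    ∃ C > 0, ∀ y : ℝ, 0 ≤ y → (1 + y) ^ κ * Real.exp (-(σ * y)) ≤ C := by
  set k := |κ| + 1 with hk
  have hk0 : 0 < k := by positivity
  refine ⟨(k / σ) ^ k * Real.exp σ, by positivity, fun y hy => ?_⟩
  have h1 : (1 + y) ^ κ ≤ (1 + y) ^ k :=
    Real.rpow_le_rpow_of_exponent_le (by linarith) (by linarith [le_abs_self κ])
  have h2 : 1 + y ≤ k / σ * Real.exp (σ * (1 + y) / k) := by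
    have := Real.add_one_le_exp (σ * (1 + y) / k)
    have h3 : 1 + y = k / σ * (σ * (1 + y) / k) := by field_simp
    calc 1 + y = k / σ * (σ * (1 + y) / k) := h3
      _ ≤ _ := by gcongr; linarith
  -- The `k`-th power of the linear bound `1 + y ≤ (k/σ) e^(σ(1+y)/k)`.
  have h4 : (1 + y) ^ k ≤ (k / σ) ^ k * Real.exp (σ * (1 + y)) := by
    calc (1 + y) ^ k ≤ (k / σ * Real.exp (σ * (1 + y) / k)) ^ k :=
          Real.rpow_le_rpow (by linarith) h2 hk0.le
      _ = _ := by
        rw [Real.mul_rpow (by positivity) (by positivity), ← Real.exp_mul]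
        congr 2
        field_simp
  calc (1 + y) ^ κ * Real.exp (-(σ * y)) ≤
      (k / σ) ^ k * Real.exp (σ * (1 + y)) * Real.exp (-(σ * y)) := by
        gcongr; exact h1.trans h4
    _ = (k / σ) ^ k * Real.exp σ := by
      rw [mul_assoc, ← Real.exp_add]; congr 2; ring

/-- Powers of comparable numbers are comparable. -/
lemma rpow_le_of_comparable (κ : ℝ) {A x y : ℝ} (hA : 1 ≤ A) (hx : 0 < x) (hy : 0 < y)
    (h1 : x ≤ A * y) (h2 : y ≤ A * x) : x ^ κ ≤ A ^ |κ| * y ^ κ := by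
  rcases le_total 0 κ with h | h
  · rw [abs_of_nonneg h, ← Real.mul_rpow (by linarith) hy.le]
    exact Real.rpow_le_rpow hx.le h1 h
  · rw [abs_of_nonpos h]
    have h3 : (A * x) ^ κ ≤ y ^ κ := Real.rpow_le_rpow_of_nonpos hy h2 h
    rw [Real.mul_rpow (by linarith) hx.le] at h3
    calc x ^ κ = A ^ (-κ) * (A ^ κ * x ^ κ) := by
          rw [← mul_assoc, ← Real.rpow_add (by linarith)]; simp
      _ ≤ _ := by gcongr

/-- An exponentially weighted integral is dominated by the end point. -/
lemma exists_integral_rpow_mul_exp_le (κ : ℝ) {σ : ℝ} (hσ : 0 < σ) :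
    ∃ C > 0, ∀ ρ : ℝ, 0 ≤ ρ →
      ∫ r in (0 : ℝ)..ρ, (1 + r) ^ κ * Real.exp (-(σ * (ρ - r))) ≤ C * (1 + ρ) ^ κ := by
  obtain ⟨C, hC, h⟩ := exists_rpow_mul_exp_le |κ| (half_pos hσ)
  refine ⟨C * (2 / σ), by positivity, fun ρ hρ => ?_⟩
  have hpt : ∀ r ∈ Icc 0 ρ, (1 + r) ^ κ * Real.exp (-(σ * (ρ - r))) ≤
      C * (1 + ρ) ^ κ * Real.exp (σ / 2 * (r - ρ)) := by
    intro r hr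
    have hr0 := hr.1
    have hr1 := hr.2
    -- Moving the weight from `r` to the end point `ρ` costs `(1 + ρ - r)^|κ|`, which half of the
    -- exponential absorbs.
    have h1 : (1 + r) ^ κ ≤ (1 + (ρ - r)) ^ |κ| * (1 + ρ) ^ κ :=
      rpow_le_of_comparable κ (by linarith) (by linarith) (by linarith) (by nlinarith)
        (by nlinarith)
    have h2 := h (ρ - r) (by linarith)
    have h3 : Real.exp (-(σ * (ρ - r))) =
        Real.exp (-(σ / 2 * (ρ - r))) * Real.exp (σ / 2 * (r - ρ)) := by
      rw [← Real.exp_add]; congr 1; ring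
    rw [h3]
    calc (1 + r) ^ κ * (Real.exp (-(σ / 2 * (ρ - r))) * Real.exp (σ / 2 * (r - ρ)))
        ≤ (1 + (ρ - r)) ^ |κ| * (1 + ρ) ^ κ *
          (Real.exp (-(σ / 2 * (ρ - r))) * Real.exp (σ / 2 * (r - ρ))) := by gcongr
      _ = ((1 + (ρ - r)) ^ |κ| * Real.exp (-(σ / 2 * (ρ - r)))) * (1 + ρ) ^ κ *
          Real.exp (σ / 2 * (r - ρ)) := by ring
      _ ≤ _ := by gcongr
  have hc1 : ContinuousOn (fun r : ℝ => (1 + r) ^ κ * Real.exp (-(σ * (ρ - r)))) (uIcc 0 ρ) := by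
    rw [uIcc_of_le hρ]
    refine ContinuousOn.mul (ContinuousOn.rpow_const (by fun_prop) fun r hr => Or.inl ?_)
      (by fun_prop)
    linarith [hr.1]
  refine (intervalIntegral.integral_mono_on hρ hc1.intervalIntegrable
    (Continuous.intervalIntegrable (by fun_prop) _ _) hpt).trans ?_
  rw [intervalIntegral.integral_const_mul]
  have hint : ∫ r in (0 : ℝ)..ρ, Real.exp (σ / 2 * (r - ρ)) ≤ 2 / σ := by
    have hd : ∀ r ∈ uIcc 0 ρ, HasDerivAt (fun r => 2 / σ * Real.exp (σ / 2 * (r - ρ)))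
        (Real.exp (σ / 2 * (r - ρ))) r := by
      intro r _
      have := ((((hasDerivAt_id r).sub_const ρ).const_mul (σ / 2)).exp).const_mul (2 / σ)
      refine this.congr_deriv ?_
      simp only [id]
      field_simp
    rw [intervalIntegral.integral_eq_sub_of_hasDerivAt hd
      (Continuous.intervalIntegrable (by fun_prop) _ _)]
    have : 0 < 2 / σ * Real.exp (σ / 2 * (0 - ρ)) := by positivity
    simp at this ⊢
    linarith
  have : 0 ≤ (1 + ρ) ^ κ := by positivity
  calc C * (1 + ρ) ^ κ * ∫ r in (0 : ℝ)..ρ, Real.exp (σ / 2 * (r - ρ)) ≤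
      C * (1 + ρ) ^ κ * (2 / σ) := by gcongr
    _ = _ := by ring

/-! ### Integrals over balls -/

/-- Integration of radial functions over balls. -/
lemma exists_integral_closedBall_norm (N : ℕ) (hN : 1 ≤ N) : ∃ c > 0, ∀ (F : ℝ → ℝ) (ρ : ℝ), 0 ≤ ρ →
    ∫ x in Metric.closedBall (0 : Space N) ρ, F ‖x‖ =
      c * ∫ r in (0 : ℝ)..ρ, r ^ (N - 1) * F r := by
  have : Nonempty (Fin N) := ⟨⟨0, hN⟩⟩
  have : Nontrivial (Space N) := inferInstance
  refine ⟨N * (volume : Measure (Space N)).real (Metric.ball 0 1), ?_, fun F ρ hρ => ?_⟩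
  · have h1 : (0 : ℝ) < N := by exact_mod_cast hN
    have h2 : 0 < (volume : Measure (Space N)).real (Metric.ball 0 1) :=
      ENNReal.toReal_pos (Metric.measure_ball_pos _ _ one_pos).ne' measure_ball_lt_top.ne
    positivity
  · have h := integral_fun_norm_addHaar (volume : Measure (Space N)) ((Iic ρ).indicator F)
    have e1 : ∫ x : Space N, (Iic ρ).indicator F ‖x‖ =
        ∫ x in Metric.closedBall (0 : Space N) ρ, F ‖x‖ := by
      rw [← integral_indicator Metric.isClosed_closedBall.measurableSet]
      congr 1; funext x
      simp only [indicator, mem_Iic, mem_closedBall_zero_iff]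
    have e2 : ∫ y in Ioi (0 : ℝ), y ^ (Module.finrank ℝ (Space N) - 1) • (Iic ρ).indicator F y =
        ∫ r in (0 : ℝ)..ρ, r ^ (N - 1) * F r := by
      rw [intervalIntegral.integral_of_le hρ, ← Ioi_inter_Iic, ← setIntegral_indicator
        measurableSet_Iic]
      congr 1; funext y
      simp only [finrank_euclideanSpace, Fintype.card_fin, smul_eq_mul]
      by_cases hy : y ∈ Iic ρ
      · simp [hy]
      · simp [hy]
    rw [e1, e2] at h
    rw [h, finrank_euclideanSpace, Fintype.card_fin]
    simp only [nsmul_eq_mul, smul_eq_mul]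
    ring

/-- The mass of powers of `e^{-lt} φ_l` inside the light cone. -/
theorem exists_integral_waveProfile_rpow_le {N : ℕ} (hN : 1 ≤ N) {l s r₀ : ℝ} (hl : 0 < l)
    (hs : 0 < s) (hr₀ : 0 ≤ r₀) : ∃ C > 0, ∀ t : ℝ, 0 ≤ t →
    ∫ x in Metric.closedBall (0 : Space N) (r₀ + t), (Real.exp (-(l * t)) * waveProfile N l x) ^ s ≤
      C * (1 + t) ^ (((N : ℝ) - 1) * (1 - s / 2)) := by
  obtain ⟨C₀, hC₀, hφ⟩ := exists_waveProfile_le hN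
  set m : ℝ := ((N : ℝ) - 1) / 2 with hm
  have hN1 : (1 : ℝ) ≤ N := by exact_mod_cast hN
  have hm0 : 0 ≤ m := by rw [hm]; linarith
  set κ : ℝ := ((N : ℝ) - 1) * (1 - s / 2) with hκ
  obtain ⟨c, hc, hpolar⟩ := exists_integral_closedBall_norm N hN
  obtain ⟨C₁, hC₁, hint⟩ := exists_integral_rpow_mul_exp_le κ (σ := s * l) (by positivity)
  set A : ℝ := (C₀ * (min 1 l) ^ (-m)) ^ s * Real.exp (s * l * r₀) with hA
  have hl1 : 0 < min 1 l := lt_min one_pos hl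
  have hA0 : 0 < A := by positivity
  refine ⟨c * (A * (C₁ * (1 + r₀) ^ |κ|)), by positivity, fun t ht => ?_⟩
  have hpt : ∀ x : Space N, (Real.exp (-(l * t)) * waveProfile N l x) ^ s ≤
      A * ((1 + ‖x‖) ^ (-(m * s)) * Real.exp (-(s * l * (r₀ + t - ‖x‖)))) := by
    intro x
    have hx := norm_nonneg x
    have h1 : (1 + l * ‖x‖) ^ (-m) ≤ (min 1 l) ^ (-m) * (1 + ‖x‖) ^ (-m) := by
      rw [← Real.mul_rpow hl1.le (by linarith)]
      apply Real.rpow_le_rpow_of_nonpos (by positivity) _ (by linarith)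
      have h2 := min_le_left 1 l
      have h3 := min_le_right 1 l
      nlinarith
    have h4 : Real.exp (-(l * t)) * waveProfile N l x ≤
        (C₀ * (min 1 l) ^ (-m)) * ((1 + ‖x‖) ^ (-m) * Real.exp (l * (‖x‖ - t))) := by
      calc Real.exp (-(l * t)) * waveProfile N l x ≤ Real.exp (-(l * t)) *
            (C₀ * ((1 + l * ‖x‖) ^ (-m) * Real.exp (l * ‖x‖))) := by
            gcongr; exact hφ l hl.le x
        _ ≤ Real.exp (-(l * t)) *
            (C₀ * (((min 1 l) ^ (-m) * (1 + ‖x‖) ^ (-m)) * Real.exp (l * ‖x‖))) := by gcongr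
        _ = _ := by
          have : Real.exp (l * (‖x‖ - t)) = Real.exp (-(l * t)) * Real.exp (l * ‖x‖) := by
            rw [← Real.exp_add]; congr 1; ring
          rw [this]; ring
    have h5 : 0 ≤ Real.exp (-(l * t)) * waveProfile N l x := by
      have := waveProfile_pos hN l x; positivity
    refine (Real.rpow_le_rpow h5 h4 hs.le).trans_eq ?_
    have h6 : 0 ≤ (1 + ‖x‖) ^ (-m) := by positivity
    rw [Real.mul_rpow (show 0 ≤ C₀ * (min 1 l) ^ (-m) by positivity)
      (mul_nonneg h6 (Real.exp_pos _).le), Real.mul_rpow h6 (Real.exp_pos _).le,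
      ← Real.rpow_mul (show 0 ≤ 1 + ‖x‖ by linarith), ← Real.exp_mul, hA, neg_mul,
      show l * (‖x‖ - t) * s = s * l * r₀ + -(s * l * (r₀ + t - ‖x‖)) by ring, Real.exp_add]
    ring
  have hφc := (contDiff_waveProfile hN l).continuous
  have hcn : Continuous fun x : Space N => 1 + ‖x‖ := by fun_prop
  have hi1 : IntegrableOn (fun x => (Real.exp (-(l * t)) * waveProfile N l x) ^ s)
      (Metric.closedBall (0 : Space N) (r₀ + t)) :=
    (Continuous.continuousOn ((continuous_const.mul hφc).rpow_const
      fun x => Or.inr hs.le)).integrableOn_compact (isCompact_closedBall _ _)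
  have hi2 : IntegrableOn (fun x => A * ((1 + ‖x‖) ^ (-(m * s)) *
      Real.exp (-(s * l * (r₀ + t - ‖x‖))))) (Metric.closedBall (0 : Space N) (r₀ + t)) := by
    refine (Continuous.continuousOn (continuous_const.mul ((hcn.rpow_const fun x => Or.inl ?_).mul
      (by fun_prop)))).integrableOn_compact (isCompact_closedBall _ _)
    linarith [norm_nonneg x]
  refine (setIntegral_mono hi1 hi2 hpt).trans ?_
  rw [hpolar (fun r => A * ((1 + r) ^ (-(m * s)) * Real.exp (-(s * l * (r₀ + t - r))))) (r₀ + t)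
    (by linarith), mul_assoc c]
  apply mul_le_mul_of_nonneg_left _ hc.le
  have hr : (0 : ℝ) ≤ r₀ + t := by linarith
  have hc3 : ContinuousOn (fun r : ℝ => (1 + r) ^ κ * Real.exp (-(s * l * (r₀ + t - r))))
      (uIcc 0 (r₀ + t)) := by
    rw [uIcc_of_le hr]
    refine ContinuousOn.mul (ContinuousOn.rpow_const (by fun_prop) fun r hr => Or.inl ?_)
      (by fun_prop)
    linarith [hr.1]
  have hc4 : ContinuousOn (fun r : ℝ => (1 + r) ^ (-(m * s)) * Real.exp (-(s * l * (r₀ + t - r))))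
      (uIcc 0 (r₀ + t)) := by
    rw [uIcc_of_le hr]
    refine ContinuousOn.mul (ContinuousOn.rpow_const (by fun_prop) fun r hr => Or.inl ?_)
      (by fun_prop)
    linarith [hr.1]
  -- The surface factor `r^(N-1)` and the decay `(1+r)^(-ms)` combine to the exponent `κ`; the
  -- exponential then localises the integral at `r = r₀ + t`.
  have hstep : ∫ r in (0 : ℝ)..(r₀ + t), r ^ (N - 1) *
      (A * ((1 + r) ^ (-(m * s)) * Real.exp (-(s * l * (r₀ + t - r))))) ≤
      ∫ r in (0 : ℝ)..(r₀ + t), A * ((1 + r) ^ κ * Real.exp (-(s * l * (r₀ + t - r)))) := by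
    refine intervalIntegral.integral_mono_on hr ?_ (hc3.intervalIntegrable.const_mul A) ?_
    · exact (ContinuousOn.mul (by fun_prop) (continuousOn_const.mul hc4)).intervalIntegrable
    · intro r hr
      have hr0 := hr.1
      have h1 : r ^ (N - 1) ≤ (1 + r) ^ ((N : ℝ) - 1) := by
        rw [show ((N : ℝ) - 1) = ((N - 1 : ℕ) : ℝ) by rw [Nat.cast_sub hN]; simp,
          Real.rpow_natCast]
        exact pow_le_pow_left₀ hr0 (by linarith) _
      have h2 : (1 + r) ^ κ = (1 + r) ^ ((N : ℝ) - 1) * (1 + r) ^ (-(m * s)) := by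
        rw [← Real.rpow_add (by linarith)]; congr 1; rw [hκ, hm]; ring
      rw [h2]
      calc r ^ (N - 1) * (A * ((1 + r) ^ (-(m * s)) * Real.exp (-(s * l * (r₀ + t - r)))))
          = A * (r ^ (N - 1) * (1 + r) ^ (-(m * s)) * Real.exp (-(s * l * (r₀ + t - r)))) := by ring
        _ ≤ _ := by gcongr
  refine hstep.trans ?_
  rw [intervalIntegral.integral_const_mul, mul_assoc A]
  apply mul_le_mul_of_nonneg_left _ hA0.le
  refine (hint (r₀ + t) hr).trans ?_
  rw [mul_assoc]
  apply mul_le_mul_of_nonneg_left _ hC₁.le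
  exact rpow_le_of_comparable κ (by linarith) (by linarith) (by linarith) (by nlinarith)
    (by nlinarith)

/-! ### Hölder's inequality on the light cone -/

theorem abs_integral_mul_rpow_le {N : ℕ} {q ρ : ℝ} (hq : 1 < q) {U Ψ : Space N → ℝ}
    (hU : AEStronglyMeasurable U) (hUi : Integrable fun x => |U x| ^ q)
    (hUs : ∀ᵐ x, ρ < ‖x‖ → U x = 0) (hΨ : Continuous Ψ) (hΨ0 : ∀ x, 0 ≤ Ψ x) :
    |∫ x, U x * Ψ x| ^ q ≤ (∫ x, |U x| ^ q) *
      (∫ x in Metric.closedBall (0 : Space N) ρ, Ψ x ^ (q / (q - 1))) ^ (q - 1) := by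
  have hq0 : 0 < q := by linarith
  have hq1 : 0 < q - 1 := by linarith
  have hconj : q.HolderConjugate (q / (q - 1)) := Real.HolderConjugate.conjExponent hq
  set B := Metric.closedBall (0 : Space N) ρ with hB
  have hBm : MeasurableSet B := Metric.isClosed_closedBall.measurableSet
  have e1 : |∫ x, U x * Ψ x| ≤ ∫ x, |U x| * B.indicator Ψ x := by
    refine (abs_integral_le_integral_abs).trans_eq ?_
    refine integral_congr_ae ?_
    filter_upwards [hUs] with x hx
    rw [abs_mul, abs_of_nonneg (hΨ0 x)]
    by_cases h : x ∈ B
    · rw [indicator_of_mem h]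
    · rw [hB, mem_closedBall_zero_iff, not_le] at h
      rw [hx h]; simp
  have hp1 : MemLp (fun x => |U x|) (ENNReal.ofReal q) (volume : Measure (Space N)) := by
    have h1 : ENNReal.ofReal q ≠ 0 := by simpa using hq0
    rw [← integrable_norm_rpow_iff (by exact hU.norm) h1 ENNReal.ofReal_ne_top]
    simpa [ENNReal.toReal_ofReal hq0.le] using hUi
  have hp2 : MemLp (B.indicator Ψ) (ENNReal.ofReal (q / (q - 1)))
      (volume : Measure (Space N)) := by
    rw [memLp_indicator_iff_restrict hBm]
    obtain ⟨C, hC⟩ := (isCompact_closedBall (0 : Space N) ρ).exists_bound_of_continuousOn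
      hΨ.continuousOn
    have : IsFiniteMeasure ((volume : Measure (Space N)).restrict B) :=
      ⟨by rw [Measure.restrict_apply_univ]; exact measure_closedBall_lt_top⟩
    refine MemLp.of_bound hΨ.aestronglyMeasurable C ?_
    filter_upwards [ae_restrict_mem hBm] with x hx using hC x hx
  have h := integral_mul_le_Lp_mul_Lq_of_nonneg hconj
    (Filter.Eventually.of_forall fun x => abs_nonneg (U x))
    (Filter.Eventually.of_forall fun x => indicator_nonneg (fun x _ => hΨ0 x) x) hp1 hp2
  have e2 : ∫ x, (B.indicator Ψ x) ^ (q / (q - 1)) = ∫ x in B, Ψ x ^ (q / (q - 1)) := by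
    rw [← integral_indicator hBm]
    congr 1; funext x
    by_cases h : x ∈ B
    · simp [h]
    · simp only [indicator_of_notMem h]
      exact Real.zero_rpow (by positivity)
  rw [e2] at h
  have hA0 : 0 ≤ ∫ x, |U x| ^ q := integral_nonneg fun x => by positivity
  have hB0 : 0 ≤ ∫ x in B, Ψ x ^ (q / (q - 1)) := integral_nonneg fun x =>
    Real.rpow_nonneg (hΨ0 x) _
  calc |∫ x, U x * Ψ x| ^ q ≤ ((∫ x, |U x| ^ q) ^ (1 / q) *
        (∫ x in B, Ψ x ^ (q / (q - 1))) ^ (1 / (q / (q - 1)))) ^ q :=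
        Real.rpow_le_rpow (abs_nonneg _) (e1.trans h) hq0.le
    _ = _ := by
      rw [Real.mul_rpow (by positivity) (by positivity), ← Real.rpow_mul hA0, ← Real.rpow_mul hB0]
      congr 2
      · rw [one_div, inv_mul_cancel₀ hq0.ne', Real.rpow_one]
      · field_simp

/-- Split `UΨ = (UΨ^(1/q)) Ψ^((q-1)/q)` and apply the unweighted inequality: the first factor to the
power `q` carries the weight `Ψ`, the second to the conjugate power is `Ψ` itself. -/
theorem abs_integral_mul_rpow_le_weighted {N : ℕ} {q ρ : ℝ} (hq : 1 < q) {U Ψ : Space N → ℝ}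
    (hU : AEStronglyMeasurable U) (hUi : Integrable fun x => |U x| ^ q)
    (hUs : ∀ᵐ x, ρ < ‖x‖ → U x = 0) (hΨ : Continuous Ψ) (hΨ0 : ∀ x, 0 < Ψ x) :
    |∫ x, U x * Ψ x| ^ q ≤ (∫ x, |U x| ^ q * Ψ x) *
      (∫ x in Metric.closedBall (0 : Space N) ρ, Ψ x) ^ (q - 1) := by
  have hq0 : 0 < q := by linarith
  have hq1 : 0 < q - 1 := by linarith
  have hc : Continuous fun x => Ψ x ^ (1 / q) := hΨ.rpow_const fun x => Or.inr (by positivity)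
  have e1 : ∀ x, |U x * Ψ x ^ (1 / q)| ^ q = |U x| ^ q * Ψ x := by
    intro x
    rw [abs_mul, abs_of_pos (Real.rpow_pos_of_pos (hΨ0 x) _), Real.mul_rpow (abs_nonneg _)
      (Real.rpow_nonneg (hΨ0 x).le _), ← Real.rpow_mul (hΨ0 x).le, one_div, inv_mul_cancel₀ hq0.ne',
      Real.rpow_one]
  have e2 : ∀ x, U x * Ψ x ^ (1 / q) * Ψ x ^ ((q - 1) / q) = U x * Ψ x := by
    intro x
    rw [mul_assoc, ← Real.rpow_add (hΨ0 x), show 1 / q + (q - 1) / q = 1 by field_simp; ring,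
      Real.rpow_one]
  have e3 : ∀ x, (Ψ x ^ ((q - 1) / q)) ^ (q / (q - 1)) = Ψ x := by
    intro x
    rw [← Real.rpow_mul (hΨ0 x).le, show (q - 1) / q * (q / (q - 1)) = 1 by field_simp,
      Real.rpow_one]
  have hi : Integrable fun x => |U x| ^ q * Ψ x := by
    obtain ⟨C, hC⟩ := (isCompact_closedBall (0 : Space N) ρ).exists_bound_of_continuousOn
      hΨ.continuousOn
    refine Integrable.mono' (hUi.mul_const C) (hUi.aestronglyMeasurable.mul
      hΨ.aestronglyMeasurable) ?_
    filter_upwards [hUs] with x hx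
    rcases le_or_gt ‖x‖ ρ with h | h
    · rw [norm_mul, Real.norm_of_nonneg (by positivity)]
      exact mul_le_mul_of_nonneg_left (hC x (by simpa using h)) (by positivity)
    · rw [hx h]; simp [Real.zero_rpow hq0.ne']
  have h := abs_integral_mul_rpow_le hq (U := fun x => U x * Ψ x ^ (1 / q))
    (Ψ := fun x => Ψ x ^ ((q - 1) / q)) (ρ := ρ) (hU.mul hc.aestronglyMeasurable)
    (by simp_rw [e1]; exact hi) (by filter_upwards [hUs] with x hx h; rw [hx h, zero_mul])
    (hΨ.rpow_const fun x => Or.inr (by positivity)) (fun x => Real.rpow_nonneg (hΨ0 x).le _)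
  simp_rw [e1, e2, e3] at h
  exact h


/-! ### Lower bounds for the pairings -/

/-- For small `l` the data pair positively with `φ_l`. -/
theorem exists_data_pairing_pos {N : ℕ} (hN : 1 ≤ N) {f g : Space N → ℝ}
    (hf : Continuous f) (hfc : HasCompactSupport f) (hg : Continuous g)
    (hgc : HasCompactSupport g) (hI : 0 < ∫ x, g x) :
    ∃ l₀ > 0, ∀ l, 0 ≤ l → l ≤ l₀ → ∀ μ, 0 ≤ μ → μ ≤ l₀ →
      0 < ∫ x, (g x + μ * f x) * waveProfile N l x := by
  obtain ⟨R, hR⟩ : ∃ R, ∀ x ∈ tsupport f ∪ tsupport g, ‖x‖ ≤ R := by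
    obtain ⟨R, hR⟩ := (hfc.isCompact.union hgc.isCompact).isBounded.exists_norm_le
    exact ⟨R, hR⟩
  set P : ℝ → ℝ := fun l => profile ((N : ℝ) / 2) (l ^ 2 * R ^ 2) with hP
  have hPc : Continuous P := (contDiff_profile (half_le_dim hN)).continuous.comp (by fun_prop)
  have hP0 : P 0 = 1 := by simp [hP, profile_zero]
  -- `J l` bounds what can be lost against `∫ g` when `φ` is replaced by its maximum `P l` on the
  -- supports and `μ ≤ l`. It is continuous and vanishes at `0`.
  set J : ℝ → ℝ := fun l => (P l - 1) * (∫ x, |g x|) + l * (P l * ∫ x, |f x|) with hJ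
  have hJc : Continuous J := by
    exact ((hPc.sub continuous_const).mul continuous_const).add
      (continuous_id.mul (hPc.mul continuous_const))
  have hJ0 : J 0 = 0 := by simp [hJ, hP0]
  have hev : ∀ᶠ l in nhds (0 : ℝ), J l < ∫ x, g x :=
    hJc.continuousAt.eventually_lt continuousAt_const (by rw [hJ0]; exact hI)
  obtain ⟨δ, hδ, hball⟩ := Metric.eventually_nhds_iff.1 hev
  refine ⟨δ / 2, by linarith, fun l hl hll μ hμ hμl => ?_⟩
  have hJδ : J (δ / 2) < ∫ x, g x := hball (by
    rw [Real.dist_eq, sub_zero, abs_of_pos (by linarith)]; linarith)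
  have hφ : ∀ x ∈ tsupport f ∪ tsupport g, waveProfile N l x ≤ P (δ / 2) := fun x hx => by
    refine profile_mono (half_le_dim hN) (by positivity) ?_
    have := hR x hx
    gcongr
  have hφ1 : ∀ x, 1 ≤ waveProfile N l x := one_le_waveProfile hN l
  have hP1 : 1 ≤ P (δ / 2) := one_le_profile (half_le_dim hN) (by positivity)
  have hφc := (contDiff_waveProfile hN l).continuous
  have ig : Integrable g := hg.integrable_of_hasCompactSupport hgc
  have jf : Integrable f := hf.integrable_of_hasCompactSupport hfc
  have igf : Integrable fun x => (g x + μ * f x) * waveProfile N l x := by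
    refine ((hg.add (continuous_const.mul hf)).mul hφc).integrable_of_hasCompactSupport ?_
    exact HasCompactSupport.mul_right (hgc.add (hfc.mul_left))
  have hpt : ∀ x, g x - ((P (δ / 2) - 1) * |g x| + δ / 2 * (P (δ / 2) * |f x|)) ≤
      (g x + μ * f x) * waveProfile N l x := by
    intro x
    by_cases hx : x ∈ tsupport f ∪ tsupport g
    · have h1 := hφ x hx
      have h2 := hφ1 x
      have h3 : -((P (δ / 2) - 1) * |g x|) ≤ g x * (waveProfile N l x - 1) := by
        have := neg_abs_le (g x)
        have h4 := abs_nonneg (g x)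
        nlinarith
      have h5 : -(δ / 2 * (P (δ / 2) * |f x|)) ≤ μ * f x * waveProfile N l x := by
        have h6 : |μ * f x * waveProfile N l x| ≤ δ / 2 * (P (δ / 2) * |f x|) := by
          rw [abs_mul, abs_mul, abs_of_nonneg hμ, abs_of_nonneg (show 0 ≤ waveProfile N l x by linarith)]
          calc μ * |f x| * waveProfile N l x ≤ δ / 2 * |f x| * P (δ / 2) := by gcongr
            _ = _ := by ring
        linarith [neg_abs_le (μ * f x * waveProfile N l x)]
      linarith
    · rw [mem_union, not_or] at hx
      rw [image_eq_zero_of_notMem_tsupport hx.1, image_eq_zero_of_notMem_tsupport hx.2]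
      simp
  have i2 : Integrable fun x => (P (δ / 2) - 1) * |g x| + δ / 2 * (P (δ / 2) * |f x|) :=
    (ig.abs.const_mul _).add ((jf.abs.const_mul _).const_mul _)
  have h := integral_mono (ig.sub i2) igf hpt
  have e : ∫ x, (g x - ((P (δ / 2) - 1) * |g x| + δ / 2 * (P (δ / 2) * |f x|))) =
      (∫ x, g x) - J (δ / 2) := by
    rw [integral_sub ig i2, integral_add (ig.abs.const_mul _) ((jf.abs.const_mul _).const_mul _),
      integral_const_mul, integral_const_mul, integral_const_mul]
  have h' : (∫ x, g x) - J (δ / 2) ≤ ∫ x, (g x + μ * f x) * waveProfile N l x := e ▸ h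
  linarith

/-- Growth of `F` and of `F'` when `e^{-lt}(F' + lF) = εI + K` with `K` nondecreasing. -/
theorem pairing_lower_bounds {F V K : ℝ → ℝ} {l ε T I M t₀ : ℝ} (hl : 0 < l) (hε : 0 < ε)
    (hI : 0 < I) (hFd : ∀ t ∈ Ico 0 T, HasDerivWithinAt F (V t) (Ico 0 T) t)
    (hK : ∀ t ∈ Ico 0 T, Real.exp (-(l * t)) * (V t + l * F t) = ε * I + K t)
    (hKm : MonotoneOn K (Ico 0 T)) (hK0 : ∀ t ∈ Ico 0 T, 0 ≤ K t) (hF0 : |F 0| ≤ ε * M)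
    (ht₀ : 0 ≤ t₀) (ht₀' : Real.exp (-(2 * l * t₀)) * (I + 2 * l * M) ≤ I / 2) :
    ∀ t ∈ Ico t₀ T, ε * (I / 4) + K t / 2 ≤ Real.exp (-(l * t)) * V t ∧
      ε * (I / (4 * l)) ≤ Real.exp (-(l * t)) * F t := by
  intro t ht
  have ht0 : 0 ≤ t := ht₀.trans ht.1
  have htT : t ∈ Ico 0 T := ⟨ht0, ht.2⟩
  have hM : 0 ≤ M := by
    by_contra hc
    have := mul_neg_of_pos_of_neg hε (not_le.1 hc)
    linarith [abs_nonneg (F 0)]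
  -- `X = e^(ls)F` has derivative `e^(2ls)(εI + K(s))`. Comparing it with the primitive of `c
  -- e^(2ls)` for `c = εI` bounds `F` from below. For `c = εI + K(t)` it bounds `F(t)` from above,
  -- as `K` is monotone, and subtracting that from the equation at `t` leaves half of `εI + K(t)`
  -- for `V`, up to an error that is small after `t₀`.
  have hXd : ∀ c : ℝ, ∀ s ∈ Ico 0 T, HasDerivWithinAt
      (fun s => Real.exp (l * s) * F s - c * (Real.exp (2 * l * s) / (2 * l)))
      (Real.exp (2 * l * s) * (ε * I + K s - c)) (Ico 0 T) s := by
    intro c s hs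
    have h1 : HasDerivAt (fun s => Real.exp (l * s)) (Real.exp (l * s) * l) s := by
      simpa using ((hasDerivAt_id s).const_mul l).exp
    have h2 : HasDerivAt (fun s => Real.exp (2 * l * s)) (Real.exp (2 * l * s) * (2 * l)) s := by
      simpa using ((hasDerivAt_id s).const_mul (2 * l)).exp
    have h3 := (h1.hasDerivWithinAt.mul (hFd s hs)).sub
      (((h2.div_const (2 * l)).const_mul c).hasDerivWithinAt (s := Ico 0 T))
    refine h3.congr_deriv ?_
    have e : Real.exp (2 * l * s) * Real.exp (-(l * s)) = Real.exp (l * s) := by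
      rw [← Real.exp_add]; congr 1; ring
    have := hK s hs
    rw [mul_div_cancel_right₀ _ (show 2 * l ≠ 0 by positivity)]
    linear_combination (-V s - l * F s) * e + Real.exp (2 * l * s) * this
  have hsub : Icc 0 t ⊆ Ico 0 T := fun s hs => ⟨hs.1, hs.2.trans_lt ht.2⟩
  have hmono : ∀ c : ℝ, (∀ s ∈ Icc 0 t, c ≤ ε * I + K s) →
      F 0 - c * (1 / (2 * l)) ≤ Real.exp (l * t) * F t - c * (Real.exp (2 * l * t) / (2 * l)) := by
    intro c hc
    have := monotoneOn_of_hasDerivWithinAt_nonneg (convex_Icc 0 t)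
      (f := fun s => Real.exp (l * s) * F s - c * (Real.exp (2 * l * s) / (2 * l)))
      (f' := fun s => Real.exp (2 * l * s) * (ε * I + K s - c))
      (fun s hs => ((hXd c s (hsub hs)).mono hsub).continuousWithinAt)
      (fun s hs => (hXd c s (hsub (interior_subset hs))).mono (interior_subset.trans hsub))
      (fun s hs => mul_nonneg (Real.exp_pos _).le (sub_nonneg.2 (hc s (interior_subset hs))))
      (left_mem_Icc.2 ht0) (right_mem_Icc.2 ht0) ht0
    simpa using this
  have hanti : Real.exp (l * t) * F t - (ε * I + K t) * (Real.exp (2 * l * t) / (2 * l)) ≤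
      F 0 - (ε * I + K t) * (1 / (2 * l)) := by
    have := antitoneOn_of_deriv_nonpos (convex_Icc 0 t)
      (f := fun s => Real.exp (l * s) * F s - (ε * I + K t) * (Real.exp (2 * l * s) / (2 * l)))
      (fun s hs => ((hXd _ s (hsub hs)).mono hsub).continuousWithinAt)
      (fun s hs => ((hXd _ s (hsub (interior_subset hs))).mono
        (interior_subset.trans hsub)).differentiableWithinAt)
      (fun s hs => by
        have h1 : Ico 0 T ∈ nhds s := by
          rw [interior_Icc] at hs
          exact Ico_mem_nhds hs.1 (hs.2.trans ht.2)
        rw [((hXd _ s (hsub (interior_subset hs))).hasDerivAt h1).deriv]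
        have h2 := hKm (hsub (interior_subset hs)) htT (interior_subset hs).2
        exact mul_nonpos_of_nonneg_of_nonpos (Real.exp_pos _).le (by linarith))
      (left_mem_Icc.2 ht0) (right_mem_Icc.2 ht0) ht0
    simpa using this
  have hlow := hmono (ε * I) fun s hs => by linarith [hK0 s (hsub hs)]
  have hE : Real.exp (-(2 * l * t)) * (I + 2 * l * M) ≤ I / 2 := by
    refine le_trans ?_ ht₀'
    have h1 : Real.exp (-(2 * l * t)) ≤ Real.exp (-(2 * l * t₀)) := by
      apply Real.exp_le_exp.2
      have := ht.1
      nlinarith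
    gcongr
  set e1 := Real.exp (-(2 * l * t)) with he1
  have he1p : 0 < e1 := Real.exp_pos _
  have e2 : e1 * Real.exp (l * t) = Real.exp (-(l * t)) := by
    rw [he1, ← Real.exp_add]; congr 1; ring
  have e3 : e1 * Real.exp (2 * l * t) = 1 := by
    rw [he1, ← Real.exp_add]; simp
  obtain ⟨hF1, hF2⟩ := abs_le.1 hF0
  have hA := mul_le_mul_of_nonneg_left hlow he1p.le
  have hB := mul_le_mul_of_nonneg_left hanti he1p.le
  have hA' : ε * I / (2 * l) - e1 * (ε * (I + 2 * l * M)) / (2 * l) ≤ Real.exp (-(l * t)) * F t := by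
    have h1 : e1 * (Real.exp (l * t) * F t - ε * I * (Real.exp (2 * l * t) / (2 * l))) =
        Real.exp (-(l * t)) * F t - ε * I / (2 * l) := by
      linear_combination F t * e2 - ε * I / (2 * l) * e3
    have h2 : e1 * (-(ε * M) - ε * I * (1 / (2 * l))) ≤ e1 * (F 0 - ε * I * (1 / (2 * l))) := by
      gcongr
    have h3 : e1 * (-(ε * M) - ε * I * (1 / (2 * l))) =
        - (e1 * (ε * (I + 2 * l * M)) / (2 * l)) := by
      field_simp; ring
    linarith
  have hEε : e1 * (ε * (I + 2 * l * M)) ≤ ε * (I / 2) := by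
    calc e1 * (ε * (I + 2 * l * M)) = ε * (e1 * (I + 2 * l * M)) := by ring
      _ ≤ _ := by gcongr
  refine ⟨?_, ?_⟩
  · have h1 : e1 * (Real.exp (l * t) * F t - (ε * I + K t) * (Real.exp (2 * l * t) / (2 * l))) =
        Real.exp (-(l * t)) * F t - (ε * I + K t) / (2 * l) := by
      linear_combination F t * e2 - (ε * I + K t) / (2 * l) * e3
    rw [h1] at hB
    have h2 : e1 * (F 0 - (ε * I + K t) * (1 / (2 * l))) ≤ e1 * (ε * M) := by
      have : 0 ≤ (ε * I + K t) * (1 / (2 * l)) := by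
        have := hK0 t htT
        positivity
      gcongr
      linarith
    have h3 : l * (Real.exp (-(l * t)) * F t) ≤ l * (e1 * (ε * M)) + (ε * I + K t) / 2 := by
      have h4 : Real.exp (-(l * t)) * F t ≤ e1 * (ε * M) + (ε * I + K t) / (2 * l) := by linarith
      calc l * (Real.exp (-(l * t)) * F t) ≤
          l * (e1 * (ε * M) + (ε * I + K t) / (2 * l)) := by gcongr
        _ = _ := by field_simp
    have h5 := hK t htT
    have h6 : 0 ≤ e1 * (ε * I) := by positivity
    nlinarith
  · have h1 : e1 * (ε * (I + 2 * l * M)) / (2 * l) ≤ ε * (I / 2) / (2 * l) := by gcongr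
    have h2 : ε * I / (2 * l) - ε * (I / 2) / (2 * l) = ε * (I / (4 * l)) := by
      field_simp; ring
    linarith

/-- The lower bound on `G` makes both powers dominated by multiples of the integrable `H`, so no
embedding theorem is needed. Continuous weights may be unbounded because `H` lives in a ball at each
time. -/
lemma ConeSolution.ae_integrable {N : ℕ} {p q a b : ℝ} {f g : Space N → ℝ} {ε T r₀ : ℝ}
    {u v H : ℝ → Space N → ℝ} (h : ConeSolution p q a b f g ε T r₀ u v H)
    (ha : 0 < a) (hb : 0 < b) :
    ∀ᵐ t ∂(volume.restrict (Ioo 0 T)), (Integrable fun x => |u t x| ^ q) ∧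
      (Integrable fun x => |v t x| ^ p) ∧
      ∀ ψ : Space N → ℝ, Continuous ψ → (∀ x, 0 ≤ ψ x) →
        (a * ∫ x, |u t x| ^ q * ψ x) + (b * ∫ x, |v t x| ^ p * ψ x) ≤ ∫ x, H t x * ψ x := by
  filter_upwards [h.lower, h.supp_H, ae_restrict_mem measurableSet_Ioo] with t hlow hsH ht
  have hi := h.integrable_H t
  have hsu := h.supp_u t ⟨ht.1.le, ht.2⟩
  have hsv := h.supp_v t ⟨ht.1.le, ht.2⟩
  have hu0 : ∀ x, 0 ≤ |u t x| ^ q := fun x => by positivity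
  have hv0 : ∀ x, 0 ≤ |v t x| ^ p := fun x => by positivity
  have iu : Integrable fun x => |u t x| ^ q := by
    refine Integrable.mono' (hi.const_mul a⁻¹)
      ((h.memLp_u t).1.aemeasurable.norm.pow_const q).aestronglyMeasurable ?_
    filter_upwards [hlow] with x hx
    rw [Real.norm_of_nonneg (hu0 x), inv_mul_eq_div, le_div_iff₀ ha]
    nlinarith [hv0 x]
  have iv : Integrable fun x => |v t x| ^ p := by
    refine Integrable.mono' (hi.const_mul b⁻¹)
      ((h.memLp_v t).1.aemeasurable.norm.pow_const p).aestronglyMeasurable ?_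
    filter_upwards [hlow] with x hx
    rw [Real.norm_of_nonneg (hv0 x), inv_mul_eq_div, le_div_iff₀ hb]
    nlinarith [hu0 x]
  refine ⟨iu, iv, fun ψ hψ hψ0 => ?_⟩
  obtain ⟨C, hC⟩ := (isCompact_closedBall (0 : Space N) (r₀ + t)).exists_bound_of_continuousOn
    hψ.continuousOn
  have iH : Integrable fun x => H t x * ψ x := by
    refine Integrable.mono' (hi.norm.mul_const C)
      (hi.aestronglyMeasurable.mul hψ.aestronglyMeasurable) ?_
    filter_upwards [hsH] with x hx
    rcases le_or_gt ‖x‖ (r₀ + t) with hc | hc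
    · rw [norm_mul]
      exact mul_le_mul_of_nonneg_left (hC x (by simpa using hc)) (norm_nonneg _)
    · rw [hx hc]; simp
  have iuψ : Integrable fun x => a * (|u t x| ^ q * ψ x) := by
    refine Integrable.mono' iH ((iu.aestronglyMeasurable.mul
      hψ.aestronglyMeasurable).const_mul a) ?_
    filter_upwards [hlow] with x hx
    rw [Real.norm_of_nonneg (mul_nonneg ha.le (mul_nonneg (hu0 x) (hψ0 x))), ← mul_assoc]
    exact mul_le_mul_of_nonneg_right (by nlinarith [hv0 x]) (hψ0 x)
  have ivψ : Integrable fun x => b * (|v t x| ^ p * ψ x) := by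
    refine Integrable.mono' iH ((iv.aestronglyMeasurable.mul
      hψ.aestronglyMeasurable).const_mul b) ?_
    filter_upwards [hlow] with x hx
    rw [Real.norm_of_nonneg (mul_nonneg hb.le (mul_nonneg (hv0 x) (hψ0 x))), ← mul_assoc]
    exact mul_le_mul_of_nonneg_right (by nlinarith [hu0 x]) (hψ0 x)
  rw [← integral_const_mul, ← integral_const_mul, ← integral_add iuψ ivψ]
  refine integral_mono_ae (iuψ.add ivψ) iH ?_
  filter_upwards [hlow] with x hx
  have := mul_le_mul_of_nonneg_right hx (hψ0 x)
  linarith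

/-- A function in the light cone whose pairing with `e^{-lt} φ_l` is bounded below cannot have
small `L^r` norm. -/
theorem exists_concentration {N : ℕ} (hN : 1 ≤ N) {l r r₀ c : ℝ} (hl : 0 < l) (hr : 1 < r)
    (hr₀ : 0 ≤ r₀) (hc : 0 < c) : ∃ c' > 0, ∀ ε t : ℝ, 0 < ε → 0 ≤ t → ∀ W : Space N → ℝ,
      AEStronglyMeasurable W → (Integrable fun x => |W x| ^ r) →
      (∀ᵐ x, r₀ + t < ‖x‖ → W x = 0) →
      ε * c ≤ Real.exp (-(l * t)) * ∫ x, W x * waveProfile N l x →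
      c' * ε ^ r * (1 + t) ^ (((N : ℝ) - 1) * (1 - r / 2)) ≤ ∫ x, |W x| ^ r := by
  have hr1 : 0 < r - 1 := by linarith
  obtain ⟨C, hC, hint⟩ := exists_integral_waveProfile_rpow_le hN (s := r / (r - 1)) hl
    (by positivity) hr₀
  refine ⟨c ^ r / C ^ (r - 1), by positivity, fun ε t hε ht W hW hWi hWs hlow => ?_⟩
  have h := abs_integral_mul_rpow_le hr hW hWi hWs
    (Ψ := fun x => Real.exp (-(l * t)) * waveProfile N l x)
    (continuous_const.mul (contDiff_waveProfile hN l).continuous)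
    (fun x => mul_nonneg (Real.exp_pos _).le (waveProfile_pos hN l x).le)
  have e : ∫ x, W x * (Real.exp (-(l * t)) * waveProfile N l x) =
      Real.exp (-(l * t)) * ∫ x, W x * waveProfile N l x := by
    rw [← integral_const_mul]; congr 1; funext x; ring
  rw [e] at h
  have h1 : (ε * c) ^ r ≤ |Real.exp (-(l * t)) * ∫ x, W x * waveProfile N l x| ^ r :=
    Real.rpow_le_rpow (by positivity) (hlow.trans (le_abs_self _)) (by linarith)
  have hB0 : 0 ≤ ∫ x in Metric.closedBall (0 : Space N) (r₀ + t),
      (Real.exp (-(l * t)) * waveProfile N l x) ^ (r / (r - 1)) :=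
    integral_nonneg fun x => Real.rpow_nonneg
      (mul_nonneg (Real.exp_pos _).le (waveProfile_pos hN l x).le) _
  have h2 := Real.rpow_le_rpow hB0 (hint t ht) hr1.le
  have hA0 : 0 ≤ ∫ x, |W x| ^ r := integral_nonneg fun x => by positivity
  have ht1 : 0 < 1 + t := by linarith
  -- With `s = r/(r-1)` the mass exponent satisfies `(1 - s/2)(r - 1) = -(1 - r/2)`.
  have h3 : (ε * c) ^ r ≤ (∫ x, |W x| ^ r) * (C ^ (r - 1) *
      (1 + t) ^ (-(((N : ℝ) - 1) * (1 - r / 2)))) := by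
    refine (h1.trans h).trans ?_
    apply mul_le_mul_of_nonneg_left _ hA0
    refine h2.trans_eq ?_
    rw [Real.mul_rpow hC.le (by positivity), ← Real.rpow_mul ht1.le]
    congr 2
    field_simp
    ring
  rw [Real.mul_rpow hε.le hc.le, Real.rpow_neg ht1.le] at h3
  have hC' : 0 < C ^ (r - 1) := by positivity
  have ht' : 0 < (1 + t) ^ (((N : ℝ) - 1) * (1 - r / 2)) := by positivity
  calc c ^ r / C ^ (r - 1) * ε ^ r * (1 + t) ^ (((N : ℝ) - 1) * (1 - r / 2)) =
      (ε ^ r * c ^ r) * ((1 + t) ^ (((N : ℝ) - 1) * (1 - r / 2)) / C ^ (r - 1)) := by ring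
    _ ≤ ((∫ x, |W x| ^ r) * (C ^ (r - 1) *
      ((1 + t) ^ (((N : ℝ) - 1) * (1 - r / 2)))⁻¹)) *
        ((1 + t) ^ (((N : ℝ) - 1) * (1 - r / 2)) / C ^ (r - 1)) := by gcongr
    _ = _ := by field_simp


/-! ### Consequences for weak solutions -/

section Pairing

variable {N : ℕ} {p q a b : ℝ} {f g : Space N → ℝ} {ε T r₀ : ℝ} {u v H : ℝ → Space N → ℝ}

lemma ConeSolution.ae_pairing_nonneg (h : ConeSolution p q a b f g ε T r₀ u v H) (hN : 1 ≤ N)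
    (ha : 0 < a) (hb : 0 < b) (l : ℝ) :
    ∀ᵐ t ∂(volume.restrict (Ioo 0 T)), 0 ≤ ∫ x, H t x * waveProfile N l x := by
  filter_upwards [h.lower] with t ht
  refine integral_nonneg_of_ae ?_
  filter_upwards [ht] with x hx
  refine mul_nonneg (le_trans ?_ hx) (waveProfile_pos hN l x).le
  positivity

lemma ConeSolution.integrableOn_exp_pairing (h : ConeSolution p q a b f g ε T r₀ u v H) {l : ℝ}
    (hl : 0 ≤ l) : IntegrableOn
      (fun s => Real.exp (-(l * s)) * ∫ x, H s x * waveProfile N l x) (Ioo 0 T) := by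
  have hc : Continuous fun s : ℝ => Real.exp (-(l * s)) := by fun_prop
  refine Integrable.bdd_mul (c := 1) (h.integrable_pairing l hl) hc.aestronglyMeasurable ?_
  filter_upwards [ae_restrict_mem measurableSet_Ioo] with t ht
  rw [Real.norm_eq_abs, abs_of_pos (Real.exp_pos _), Real.exp_le_one_iff]
  nlinarith [ht.1]

lemma ConeSolution.intervalIntegrable_exp_pairing (h : ConeSolution p q a b f g ε T r₀ u v H) {l : ℝ}
    (hl : 0 ≤ l) {t₁ t₂ : ℝ} (h1 : t₁ ∈ Ico 0 T) (h2 : t₂ ∈ Ico 0 T) (h12 : t₁ ≤ t₂) :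
    IntervalIntegrable (fun s => Real.exp (-(l * s)) * ∫ x, H s x * waveProfile N l x)
      volume t₁ t₂ := by
  rw [intervalIntegrable_iff_integrableOn_Ioo_of_le h12]
  exact (h.integrableOn_exp_pairing hl).mono_set fun s hs =>
    ⟨h1.1.trans_lt hs.1, hs.2.trans h2.2⟩

lemma ConeSolution.exp_pairing_sub (h : ConeSolution p q a b f g ε T r₀ u v H) {l : ℝ}
    (hl : 0 ≤ l) {t₁ t₂ : ℝ} (h1 : t₁ ∈ Ico 0 T) (h2 : t₂ ∈ Ico 0 T) (h12 : t₁ ≤ t₂) :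
    (∫ s in (0 : ℝ)..t₁, Real.exp (-(l * s)) * ∫ x, H s x * waveProfile N l x) +
      (∫ s in t₁..t₂, Real.exp (-(l * s)) * ∫ x, H s x * waveProfile N l x) =
      ∫ s in (0 : ℝ)..t₂, Real.exp (-(l * s)) * ∫ x, H s x * waveProfile N l x :=
  intervalIntegral.integral_add_adjacent_intervals
    (h.intervalIntegrable_exp_pairing hl ⟨le_rfl, h1.1.trans_lt h1.2⟩ h1 h1.1)
    (h.intervalIntegrable_exp_pairing hl h1 h2 h12)

lemma ConeSolution.exp_pairing_integral_nonneg (h : ConeSolution p q a b f g ε T r₀ u v H)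
    (hN : 1 ≤ N) (ha : 0 < a) (hb : 0 < b) (l : ℝ) {t₁ t₂ : ℝ} (h1 : t₁ ∈ Ico 0 T)
    (h2 : t₂ ∈ Ico 0 T) (h12 : t₁ ≤ t₂) :
    0 ≤ ∫ s in t₁..t₂, Real.exp (-(l * s)) * ∫ x, H s x * waveProfile N l x := by
  rw [intervalIntegral.integral_of_le h12, integral_Ioc_eq_integral_Ioo]
  refine integral_nonneg_of_ae ?_
  have hsub : Ioo t₁ t₂ ⊆ Ioo 0 T := fun s hs => ⟨h1.1.trans_lt hs.1, hs.2.trans h2.2⟩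
  filter_upwards [ae_restrict_of_ae_restrict_of_subset hsub (h.ae_pairing_nonneg hN ha hb l)]
    with s hs
  exact mul_nonneg (Real.exp_pos _).le hs

end Pairing

/-- The basic lower bounds for a solution with small data. -/
theorem exists_solution_bounds {N : ℕ} (hN : 1 ≤ N) {p q a b r₀ : ℝ} (hp : 1 < p) (hq : 1 < q)
    (ha : 0 < a) (hb : 0 < b) (hr₀ : 0 ≤ r₀) {f g : Space N → ℝ} {l : ℝ} (hl : 0 < l)
    (hI : 0 < ∫ x, (g x + l * f x) * waveProfile N l x) :
    ∃ t₀ ≥ 0, ∃ c > 0, ∃ ι > 0, ∀ ε T : ℝ, ∀ u v H : ℝ → Space N → ℝ, 0 < ε →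
      ConeSolution p q a b f g ε T r₀ u v H →
      (∀ᵐ t ∂(volume.restrict (Ioo 0 T)), t₀ ≤ t →
        c * ε ^ q * (1 + t) ^ (((N : ℝ) - 1) * (1 - q / 2)) ≤ ∫ x, |u t x| ^ q) ∧
      (∀ᵐ t ∂(volume.restrict (Ioo 0 T)), t₀ ≤ t →
        c * ε ^ p * (1 + t) ^ (((N : ℝ) - 1) * (1 - p / 2)) ≤ ∫ x, |v t x| ^ p) ∧
      ∀ t ∈ Ico t₀ T, ε * ι +
        (∫ s in (0 : ℝ)..t, Real.exp (-(l * s)) * ∫ x, H s x * waveProfile N l x) / 2 ≤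
        Real.exp (-(l * t)) * ∫ x, v t x * waveProfile N l x := by
  set I := ∫ x, (g x + l * f x) * waveProfile N l x with hIdef
  set M := |∫ x, f x * waveProfile N l x| with hM
  obtain ⟨t₀, ht₀, ht₀'⟩ : ∃ t₀ ≥ (0 : ℝ), Real.exp (-(2 * l * t₀)) * (I + 2 * l * M) ≤ I / 2 := by
    have hM0 : 0 ≤ M := abs_nonneg _
    set A := I + 2 * l * M
    have hA : 0 < A := by positivity
    -- Chosen so that `2 l t₀ = 2A/I`; then `e^y ≥ y` suffices.
    refine ⟨A / (I * l), by positivity, ?_⟩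
    have h1 := Real.add_one_le_exp (2 * l * (A / (I * l)))
    have h2 : 2 * l * (A / (I * l)) = 2 * A / I := by field_simp
    rw [h2] at h1 ⊢
    rw [Real.exp_neg, inv_mul_le_iff₀ (Real.exp_pos _)]
    calc A = (2 * A / I) * (I / 2) := by field_simp
      _ ≤ Real.exp (2 * A / I) * (I / 2) := by gcongr; linarith
  obtain ⟨c₁, hc₁, hconc₁⟩ := exists_concentration hN (c := I / (4 * l)) hl hq hr₀ (by positivity)
  obtain ⟨c₂, hc₂, hconc₂⟩ := exists_concentration hN (c := I / 4) hl hp hr₀ (by positivity)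
  refine ⟨t₀, ht₀, min c₁ c₂, lt_min hc₁ hc₂, I / 4, by positivity, fun ε T u v H hε h => ?_⟩
  have hlow := pairing_lower_bounds (K := fun t => ∫ s in (0 : ℝ)..t, Real.exp (-(l * s)) *
    ∫ x, H s x * waveProfile N l x) hl hε hI (h.hasDeriv l hl.le) (h.duhamel l hl.le)
    (fun t₁ h1 t₂ h2 h12 => by
      have e := h.exp_pairing_sub hl.le h1 h2 h12
      have e' := h.exp_pairing_integral_nonneg hN ha hb l h1 h2 h12
      simp only
      linarith)
    (fun t ht => h.exp_pairing_integral_nonneg hN ha hb l ⟨le_rfl, ht.1.trans_lt ht.2⟩ ht ht.1)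
    (by rw [h.initial l hl.le, abs_mul, abs_of_pos hε]) ht₀ ht₀'
  refine ⟨?_, ?_, fun t ht => (hlow t ht).1⟩
  · filter_upwards [h.ae_integrable ha hb, ae_restrict_mem measurableSet_Ioo] with t ht htT ht0
    have h1 := hconc₁ ε t hε htT.1.le (u t) (h.memLp_u t).1 ht.1 (h.supp_u t ⟨htT.1.le, htT.2⟩)
      (hlow t ⟨ht0, htT.2⟩).2
    refine le_trans ?_ h1
    have ht1 : 0 < 1 + t := by linarith [htT.1]
    gcongr
    exact min_le_left _ _
  · filter_upwards [h.ae_integrable ha hb, ae_restrict_mem measurableSet_Ioo] with t ht htT ht0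
    have hK := h.exp_pairing_integral_nonneg hN ha hb l ⟨le_rfl, htT.1.trans htT.2⟩
      ⟨htT.1.le, htT.2⟩ htT.1.le
    have h1 := hconc₂ ε t hε htT.1.le (v t) (h.memLp_v t).1 ht.2.1 (h.supp_v t ⟨htT.1.le, htT.2⟩)
      (le_trans (by linarith) (hlow t ⟨ht0, htT.2⟩).1)
    refine le_trans ?_ h1
    have ht1 : 0 < 1 + t := by linarith [htT.1]
    gcongr
    exact min_le_right _ _

/-! ### The scalar differential inequality and the Glassey cases -/

/-- Blow-up for `Z' ≥ w Z^p`. -/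
theorem sub_le_of_superlinear {Z Z' Ω w : ℝ → ℝ} {p t₁ t₂ : ℝ} (hp : 1 < p) (h12 : t₁ ≤ t₂)
    (hZc : ContinuousOn Z (Icc t₁ t₂)) (hZd : ∀ t ∈ Ioo t₁ t₂, HasDerivAt Z (Z' t) t)
    (hΩc : ContinuousOn Ω (Icc t₁ t₂)) (hΩd : ∀ t ∈ Ioo t₁ t₂, HasDerivAt Ω (w t) t)
    (hZ0 : ∀ t ∈ Icc t₁ t₂, 0 < Z t) (hZ : ∀ t ∈ Ioo t₁ t₂, w t * Z t ^ p ≤ Z' t) :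
    (p - 1) * (Ω t₂ - Ω t₁) ≤ Z t₁ ^ (1 - p) := by
  -- `Z^(1-p) + (p-1)Ω` is nonincreasing, and its first term stays positive.
  have hd : ∀ t ∈ Ioo t₁ t₂, HasDerivAt (fun t => Z t ^ (1 - p) + (p - 1) * Ω t)
      (Z' t * (1 - p) * Z t ^ (1 - p - 1) + (p - 1) * w t) t := fun t ht =>
    ((hZd t ht).rpow_const (Or.inl (hZ0 t (Ioo_subset_Icc_self ht)).ne')).add
      ((hΩd t ht).const_mul _)
  have hanti := antitoneOn_of_deriv_nonpos (convex_Icc t₁ t₂)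
    (f := fun t => Z t ^ (1 - p) + (p - 1) * Ω t)
    ((hZc.rpow_const fun t ht => Or.inl (hZ0 t ht).ne').add (continuousOn_const.mul hΩc))
    (fun t ht => (hd t (by rwa [interior_Icc] at ht)).differentiableAt.differentiableWithinAt)
    (fun t ht => by
      rw [interior_Icc] at ht
      rw [(hd t ht).deriv]
      have h0 := hZ0 t (Ioo_subset_Icc_self ht)
      have h1 := hZ t ht
      have h2 : Z t ^ p * Z t ^ (1 - p - 1) = 1 := by
        rw [← Real.rpow_add h0]; simp
      have h3 : 0 < Z t ^ (1 - p - 1) := Real.rpow_pos_of_pos h0 _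
      have h4 : w t ≤ Z' t * Z t ^ (1 - p - 1) := by
        calc w t = w t * Z t ^ p * Z t ^ (1 - p - 1) := by rw [mul_assoc, h2, mul_one]
          _ ≤ _ := by gcongr
      nlinarith)
    (left_mem_Icc.2 h12) (right_mem_Icc.2 h12) h12
  simp only at hanti
  have h5 : 0 < Z t₂ ^ (1 - p) := Real.rpow_pos_of_pos (hZ0 t₂ (right_mem_Icc.2 h12)) _
  linarith

/-- The scalar inequality for `∂ₜu` leading to the Glassey exponent. -/
theorem exists_glassey_inequality {N : ℕ} (hN : 1 ≤ N) {p q a b r₀ : ℝ} (hp : 1 < p) (hq : 1 < q)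
    (ha : 0 < a) (hb : 0 < b) (hr₀ : 0 ≤ r₀) {f g : Space N → ℝ} {l : ℝ} (hl : 0 < l)
    (hI : 0 < ∫ x, (g x + l * f x) * waveProfile N l x) {Ω : ℝ → ℝ}
    (hΩ : ∀ t, 0 ≤ t → HasDerivAt Ω ((1 + t) ^ (-(((N : ℝ) - 1) / 2 * (p - 1)))) t) :
    ∃ t₀ ≥ 0, ∃ c > 0, ∀ ε T : ℝ, ∀ u v H : ℝ → Space N → ℝ, 0 < ε →
      ConeSolution p q a b f g ε T r₀ u v H → ∀ t ∈ Ico t₀ T,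
      c * (Ω t - Ω t₀) ≤ ε ^ (-(p - 1)) := by
  have hp0 : 0 < p := by linarith
  have hp1 : 0 < p - 1 := by linarith
  obtain ⟨t₀, ht₀, c, hc, ι, hι, hsol⟩ := exists_solution_bounds hN hp hq ha hb hr₀ hl hI
  obtain ⟨C, hC, hmass⟩ := exists_integral_waveProfile_rpow_le hN (s := 1) hl one_pos hr₀
  set ν : ℝ := ((N : ℝ) - 1) / 2 * (p - 1) with hν
  -- The constant from Hölder's inequality, halved because `Y` contains only `K/2`.
  set d : ℝ := b / C ^ (p - 1) / 2 with hd
  have hd0 : 0 < d := by positivity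
  refine ⟨t₀, ht₀, (p - 1) * d * ι ^ (p - 1), by positivity, fun ε T u v H hε h t ht => ?_⟩
  obtain ⟨-, -, hV⟩ := hsol ε T u v H hε h
  set k : ℝ → ℝ := fun s => Real.exp (-(l * s)) * ∫ x, H s x * waveProfile N l x with hk
  set K : ℝ → ℝ := fun t => ∫ s in (0 : ℝ)..t, k s with hK
  set Y : ℝ → ℝ := fun t => ε * ι + K t / 2 with hY
  have ht0 : 0 ≤ t := ht₀.trans ht.1
  have htT : t ∈ Ico 0 T := ⟨ht0, ht.2⟩
  have ht₀T : t₀ ∈ Ico 0 T := ⟨ht₀, ht.1.trans_lt ht.2⟩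
  have hKc : ContinuousOn K (Icc t₀ t) := by
    have hi := h.intervalIntegrable_exp_pairing hl.le ⟨le_rfl, ht0.trans_lt ht.2⟩ htT ht0
    have := (hi.absolutelyContinuousOnInterval_intervalIntegral (c := 0) left_mem_uIcc).continuousOn
    rw [uIcc_of_le ht0] at this
    exact this.mono (Icc_subset_Icc_left ht₀)
  have hYc : ContinuousOn Y (Icc t₀ t) := continuousOn_const.add (hKc.div_const 2)
  have hK0 : ∀ s ∈ Icc t₀ t, 0 ≤ K s := fun s hs =>
    h.exp_pairing_integral_nonneg hN ha hb l ⟨le_rfl, ht0.trans_lt ht.2⟩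
      ⟨ht₀.trans hs.1, hs.2.trans_lt ht.2⟩ (ht₀.trans hs.1)
  have hYpos : ∀ s ∈ Icc t₀ t, 0 < Y s := fun s hs => by
    have := hK0 s hs
    simp only [hY]; positivity
  -- the differential inequality
  have hkl : ∀ᵐ s ∂(volume.restrict (Ioo 0 T)), t₀ ≤ s → s ≤ t →
      2 * (d * ((1 + s) ^ (-ν) * Y s ^ p)) ≤ k s := by
    filter_upwards [h.ae_integrable ha hb, ae_restrict_mem measurableSet_Ioo] with s hs hsT hs0 hst
    set ψ : Space N → ℝ := fun x => Real.exp (-(l * s)) * waveProfile N l x with hψ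
    have hψc : Continuous ψ := continuous_const.mul (contDiff_waveProfile hN l).continuous
    have hψ0 : ∀ x, 0 < ψ x := fun x => mul_pos (Real.exp_pos _) (waveProfile_pos hN l x)
    have h1 := hs.2.2 ψ hψc fun x => (hψ0 x).le
    have h2 := abs_integral_mul_rpow_le_weighted hp (h.memLp_v s).1 hs.2.1
      (h.supp_v s ⟨hsT.1.le, hsT.2⟩) hψc hψ0
    have h3 := hmass s hsT.1.le
    simp only [Real.rpow_one] at h3
    have e1 : ∀ F : Space N → ℝ, ∫ x, F x * ψ x =
        Real.exp (-(l * s)) * ∫ x, F x * waveProfile N l x := fun F => by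
      rw [← integral_const_mul]; congr 1; funext x; simp only [hψ]; ring
    have h4 : k s = ∫ x, H s x * ψ x := (e1 _).symm
    have h5 : Y s ≤ ∫ x, v s x * ψ x := by rw [e1]; exact hV s ⟨hs0, hsT.2⟩
    have hYs := hYpos s ⟨hs0, hst⟩
    have h6 : Y s ^ p ≤ |∫ x, v s x * ψ x| ^ p :=
      Real.rpow_le_rpow hYs.le (h5.trans (le_abs_self _)) hp0.le
    have hA0 : 0 ≤ ∫ x, |u s x| ^ q * ψ x := integral_nonneg fun x => by
      have := hψ0 x; positivity
    have hB0 : 0 ≤ ∫ x, |v s x| ^ p * ψ x := integral_nonneg fun x => by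
      have := hψ0 x; positivity
    have hm0 : 0 ≤ ∫ x in Metric.closedBall (0 : Space N) (r₀ + s), ψ x :=
      integral_nonneg fun x => (hψ0 x).le
    have hs1 : 0 < 1 + s := by linarith [hsT.1]
    have h7 : (∫ x in Metric.closedBall (0 : Space N) (r₀ + s), ψ x) ^ (p - 1) ≤
        C ^ (p - 1) * (1 + s) ^ ν := by
      refine (Real.rpow_le_rpow hm0 h3 hp1.le).trans_eq ?_
      rw [Real.mul_rpow hC.le (by positivity), ← Real.rpow_mul hs1.le]
      congr 2
      rw [hν]; ring
    have h8 : Y s ^ p ≤ (∫ x, |v s x| ^ p * ψ x) * (C ^ (p - 1) * (1 + s) ^ ν) :=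
      (h6.trans h2).trans (mul_le_mul_of_nonneg_left h7 hB0)
    have hC' : 0 < C ^ (p - 1) := by positivity
    have hs' : 0 < (1 + s) ^ ν := by positivity
    rw [h4]
    refine le_trans ?_ ((le_add_of_nonneg_left (mul_nonneg ha.le hA0)).trans h1)
    rw [Real.rpow_neg hs1.le]
    calc 2 * (d * (((1 + s) ^ ν)⁻¹ * Y s ^ p)) ≤ 2 * (d * (((1 + s) ^ ν)⁻¹ *
          ((∫ x, |v s x| ^ p * ψ x) * (C ^ (p - 1) * (1 + s) ^ ν)))) := by gcongr
      _ = _ := by rw [hd]; field_simp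
  set w : ℝ → ℝ := fun s => d * ((1 + s) ^ (-ν) * Y s ^ p) with hw
  have hwc : ContinuousOn w (Icc t₀ t) := by
    refine continuousOn_const.mul (ContinuousOn.mul ?_ ?_)
    · exact ContinuousOn.rpow_const (by fun_prop) fun s hs => Or.inl (by linarith [hs.1])
    · exact hYc.rpow_const fun s hs => Or.inr hp0.le
  -- `Y` is only absolutely continuous and its inequality holds almost everywhere. The primitive `Z`
  -- of the continuous minorant `w` is differentiable everywhere, lies below `Y`, and therefore
  -- satisfies `Z' = w ≥ d(1+s)^(-ν) Z^p` pointwise.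
  set Z : ℝ → ℝ := fun s => ε * ι + ∫ r in t₀..s, w r with hZ
  have hwi : ∀ s ∈ Icc t₀ t, IntervalIntegrable w volume t₀ s := fun s hs => by
    apply ContinuousOn.intervalIntegrable
    rw [uIcc_of_le hs.1]
    exact hwc.mono (Icc_subset_Icc_right hs.2)
  have hw0 : ∀ s ∈ Icc t₀ t, 0 ≤ w s := fun s hs => by
    have h1 := hYpos s hs
    have h2 : 0 < 1 + s := by linarith [hs.1]
    positivity
  have hZY : ∀ s ∈ Icc t₀ t, Z s ≤ Y s := by
    intro s hs
    have hsT : s ∈ Ico 0 T := ⟨ht₀.trans hs.1, hs.2.trans_lt ht.2⟩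
    have e := h.exp_pairing_sub hl.le ht₀T hsT hs.1
    have hi := h.intervalIntegrable_exp_pairing hl.le ht₀T hsT hs.1
    have h1 : ∫ r in t₀..s, 2 * w r ≤ ∫ r in t₀..s, k r := by
      refine intervalIntegral.integral_mono_ae_restrict hs.1 ((hwi s hs).const_mul 2) hi ?_
      rw [Filter.EventuallyLE, ae_restrict_iff' measurableSet_Icc]
      have hne : ∀ᵐ x : ℝ, x ≠ 0 := by simp [ae_iff]
      filter_upwards [(ae_restrict_iff' measurableSet_Ioo).1 hkl, hne] with r hr hr0 hrs
      exact hr ⟨lt_of_le_of_ne (ht₀.trans hrs.1) (Ne.symm hr0), hrs.2.trans_lt hsT.2⟩ hrs.1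
        (hrs.2.trans hs.2)
    rw [intervalIntegral.integral_const_mul] at h1
    have h2 := hK0 t₀ (left_mem_Icc.2 ht.1)
    have h3 : K t₀ + (∫ r in t₀..s, k r) = K s := e
    simp only [hZ, hY]
    linarith
  have hZpos : ∀ s ∈ Icc t₀ t, 0 < Z s := fun s hs => by
    have : 0 ≤ ∫ r in t₀..s, w r := intervalIntegral.integral_nonneg hs.1 fun r hr =>
      hw0 r ⟨hr.1, hr.2.trans hs.2⟩
    simp only [hZ]; positivity
  have hZd : ∀ s ∈ Ioo t₀ t, HasDerivAt Z (w s) s := by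
    intro s hs
    have hnh : Icc t₀ t ∈ nhds s := Icc_mem_nhds hs.1 hs.2
    exact (intervalIntegral.integral_hasDerivAt_right (hwi s (Ioo_subset_Icc_self hs))
      (hwc.stronglyMeasurableAtFilter_nhdsWithin measurableSet_Icc s |>.filter_mono (by
        rw [nhdsWithin_eq_nhds.2 hnh])) (hwc.continuousAt hnh)).const_add _
  have hZc : ContinuousOn Z (Icc t₀ t) := by
    have hwi' := hwi t (right_mem_Icc.2 ht.1)
    have := (hwi'.absolutelyContinuousOnInterval_intervalIntegral (c := t₀)
      left_mem_uIcc).continuousOn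
    rw [uIcc_of_le ht.1] at this
    exact continuousOn_const.add this
  have hfin := sub_le_of_superlinear (Ω := fun s => d * Ω s)
    (w := fun s => d * (1 + s) ^ (-ν)) hp ht.1 hZc hZd
    (fun s hs => ((hΩ s (ht₀.trans hs.1)).const_mul d).continuousAt.continuousWithinAt)
    (fun s hs => (hΩ s (ht₀.trans hs.1.le)).const_mul d) hZpos
    (fun s hs => by
      have h1 := hZY s (Ioo_subset_Icc_self hs)
      have h2 := hZpos s (Ioo_subset_Icc_self hs)
      have h3 : 0 < 1 + s := by linarith [hs.1]
      simp only [hw]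
      rw [mul_assoc]
      gcongr)
  have e1 : Z t₀ = ε * ι := by simp [hZ]
  rw [e1, Real.mul_rpow hε.le hι.le, show 1 - p = -(p - 1) by ring, Real.rpow_neg hι.le] at hfin
  have hι' : 0 < ι ^ (p - 1) := by positivity
  calc (p - 1) * d * ι ^ (p - 1) * (Ω t - Ω t₀) =
        ι ^ (p - 1) * ((p - 1) * (d * Ω t - d * Ω t₀)) := by ring
    _ ≤ ι ^ (p - 1) * (ε ^ (-(p - 1)) * (ι ^ (p - 1))⁻¹) := by gcongr
    _ = ε ^ (-(p - 1)) := by field_simp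

/-- Lifespan estimate in the critical Glassey case. -/
theorem exists_lifespan_glassey_critical {N : ℕ} (hN : 1 ≤ N) {p q a b r₀ : ℝ} (hp : 1 < p)
    (hq : 1 < q) (ha : 0 < a) (hb : 0 < b) (hr₀ : 0 ≤ r₀) {f g : Space N → ℝ} {l : ℝ} (hl : 0 < l)
    (hI : 0 < ∫ x, (g x + l * f x) * waveProfile N l x)
    (hν : ((N : ℝ) - 1) / 2 * (p - 1) = 1) :
    ∃ C > 0, ∀ ε T : ℝ, ∀ u v H : ℝ → Space N → ℝ, 0 < ε → ε ≤ 1 →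
      ConeSolution p q a b f g ε T r₀ u v H → T ≤ Real.exp (C * ε ^ (-(p - 1))) := by
  obtain ⟨t₀, ht₀, c, hc, h⟩ := exists_glassey_inequality hN hp hq ha hb hr₀ hl hI
    (Ω := fun t => Real.log (1 + t)) (fun t ht => by
      rw [hν, Real.rpow_neg_one]
      have := ((hasDerivAt_id t).const_add 1).log (by simp only [id]; linarith)
      simpa using this)
  have hlog : 0 ≤ Real.log (1 + t₀) := Real.log_nonneg (by linarith)
  refine ⟨Real.log (1 + t₀) + 1 / c, by positivity, fun ε T u v H hε hε1 hs => ?_⟩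
  have hε' : 1 ≤ ε ^ (-(p - 1)) :=
    Real.one_le_rpow_of_pos_of_le_one_of_nonpos hε hε1 (by linarith)
  -- The estimates hold at times strictly before `T`, so `T` is approached from below. Times before
  -- `t₀` are harmless since `ε^(-(p-1)) ≥ 1`.
  refine le_of_forall_lt_imp_le_of_dense fun t ht => ?_
  have key : Real.log (1 + max t t₀) ≤ (Real.log (1 + t₀) + 1 / c) * ε ^ (-(p - 1)) := by
    rcases le_total t t₀ with h1 | h1
    · rw [max_eq_right h1]
      have : 0 ≤ 1 / c * ε ^ (-(p - 1)) := by positivity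
      nlinarith
    · rw [max_eq_left h1]
      have h2 := h ε T u v H hε hs t ⟨h1, ht⟩
      have h3 : Real.log (1 + t) - Real.log (1 + t₀) ≤ 1 / c * ε ^ (-(p - 1)) := by
        rw [one_div, inv_mul_eq_div, le_div_iff₀ hc]; linarith
      nlinarith
  calc t ≤ 1 + max t t₀ := by linarith [le_max_left t t₀]
    _ = Real.exp (Real.log (1 + max t t₀)) := by
      rw [Real.exp_log]; linarith [le_max_right t t₀]
    _ ≤ _ := Real.exp_le_exp.2 key

/-- Lifespan estimate in the subcritical Glassey case. -/
theorem exists_lifespan_glassey_subcritical {N : ℕ} (hN : 1 ≤ N) {p q a b r₀ : ℝ} (hp : 1 < p)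
    (hq : 1 < q) (ha : 0 < a) (hb : 0 < b) (hr₀ : 0 ≤ r₀) {f g : Space N → ℝ} {l : ℝ} (hl : 0 < l)
    (hI : 0 < ∫ x, (g x + l * f x) * waveProfile N l x)
    (hν : ((N : ℝ) - 1) / 2 * (p - 1) < 1) :
    ∃ C > 0, ∀ ε T : ℝ, ∀ u v H : ℝ → Space N → ℝ, 0 < ε → ε ≤ 1 →
      ConeSolution p q a b f g ε T r₀ u v H → T ≤ C * ε ^ (-(GammaG N p)⁻¹) := by
  set ν : ℝ := ((N : ℝ) - 1) / 2 * (p - 1) with hνd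
  have hp1 : 0 < p - 1 := by linarith
  have hν1 : 0 < 1 - ν := by linarith
  obtain ⟨t₀, ht₀, c, hc, h⟩ := exists_glassey_inequality hN hp hq ha hb hr₀ hl hI
    (Ω := fun t => (1 + t) ^ (1 - ν) / (1 - ν)) (fun t ht => by
      have := (((hasDerivAt_id t).const_add 1).rpow_const (p := 1 - ν)
        (Or.inl (by simp only [id]; linarith))).div_const (1 - ν)
      refine this.congr_deriv ?_
      simp only [id]
      rw [show 1 - ν - 1 = -ν by ring, one_mul, mul_div_right_comm, div_self hν1.ne', one_mul])
  set D : ℝ := (1 + t₀) ^ (1 - ν) + (1 - ν) / c with hD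
  have hD0 : 0 < D := by positivity
  refine ⟨D ^ (1 / (1 - ν)), by positivity, fun ε T u v H hε hε1 hs => ?_⟩
  have hε' : 1 ≤ ε ^ (-(p - 1)) :=
    Real.one_le_rpow_of_pos_of_le_one_of_nonpos hε hε1 (by linarith)
  refine le_of_forall_lt_imp_le_of_dense fun t ht => ?_
  set t' := max t t₀
  have ht' : 0 < 1 + t' := by linarith [le_max_right t t₀]
  have key : (1 + t') ^ (1 - ν) ≤ D * ε ^ (-(p - 1)) := by
    have hpos : 0 < (1 + t₀) ^ (1 - ν) := by positivity
    have h0 : 0 ≤ (1 - ν) / c * ε ^ (-(p - 1)) := by positivity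
    rcases le_total t t₀ with h1 | h1
    · simp only [t', max_eq_right h1]
      rw [hD]
      nlinarith
    · simp only [t', max_eq_left h1]
      have h2 := h ε T u v H hε hs t ⟨h1, ht⟩
      have h3 : (1 + t) ^ (1 - ν) - (1 + t₀) ^ (1 - ν) ≤ (1 - ν) / c * ε ^ (-(p - 1)) := by
        calc (1 + t) ^ (1 - ν) - (1 + t₀) ^ (1 - ν) = (1 - ν) / c * (c *
              ((1 + t) ^ (1 - ν) / (1 - ν) - (1 + t₀) ^ (1 - ν) / (1 - ν))) := by field_simp
          _ ≤ _ := by gcongr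
      rw [hD]
      nlinarith
  have e : (GammaG N p)⁻¹ = (p - 1) * (1 / (1 - ν)) := by
    have : GammaG N p = (1 - ν) / (p - 1) := by
      rw [GammaG, hνd]; field_simp
    rw [this]; field_simp
  calc t ≤ 1 + t' := by linarith [le_max_left t t₀]
    _ = ((1 + t') ^ (1 - ν)) ^ (1 / (1 - ν)) := by
      rw [← Real.rpow_mul ht'.le, mul_one_div_cancel hν1.ne', Real.rpow_one]
    _ ≤ (D * ε ^ (-(p - 1))) ^ (1 / (1 - ν)) := by gcongr
    _ = _ := by
      rw [Real.mul_rpow hD0.le (by positivity), ← Real.rpow_mul hε.le, e, neg_mul]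


/-! ### Testing with powers of `R - t` -/

/-- Two integrations by parts in time against `(R-t)^(n+2)`. The exponent kills the boundary terms
at `R`. Those at `0` add up to `εR^(n+2)` times the pairing of `g + (l + (n+2)/R) f` with `φ_l`,
which is nonnegative and is dropped. -/
theorem ConeSolution.test_inequality {N : ℕ} {p q a b : ℝ} {f g : Space N → ℝ} {ε T r₀ : ℝ}
    {u v H : ℝ → Space N → ℝ} (h : ConeSolution p q a b f g ε T r₀ u v H) {l R : ℝ} (hl : 0 ≤ l)
    (hR : 0 < R) (hRT : R < T) (hε : 0 ≤ ε) (n : ℕ) (hN : 1 ≤ N)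
    (hf : Continuous f) (hfc : HasCompactSupport f) (hg : Continuous g) (hgc : HasCompactSupport g)
    (hdata : 0 ≤ ∫ x, (g x + (l + (n + 2) / R) * f x) * waveProfile N l x) :
    ∫ t in Ioo 0 R, (R - t) ^ (n + 2) *
        (Real.exp (-(l * t)) * ∫ x, H t x * waveProfile N l x) ≤
      ∫ t in Ioo 0 R, Real.exp (-(l * t)) * (∫ x, u t x * waveProfile N l x) *
        ((n + 2) * (n + 1) * (R - t) ^ n + 2 * l * ((n + 2) * (R - t) ^ (n + 1))) := by
  set F : ℝ → ℝ := fun t => ∫ x, u t x * waveProfile N l x with hF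
  set V : ℝ → ℝ := fun t => ∫ x, v t x * waveProfile N l x with hV
  set k : ℝ → ℝ := fun t => Real.exp (-(l * t)) * ∫ x, H t x * waveProfile N l x with hk
  set I := ∫ x, (g x + l * f x) * waveProfile N l x with hI
  set J := ∫ x, f x * waveProfile N l x with hJ
  have hki : IntegrableOn k (Ioo 0 R) :=
    (h.integrableOn_exp_pairing hl).mono_set fun t ht => ⟨ht.1, ht.2.trans hRT⟩
  have hyd : ∀ t : ℝ, HasDerivAt (fun t => R - t) (-1) t := fun t =>
    by simpa using (hasDerivAt_id t).const_sub R
  have hηd : ∀ t : ℝ, HasDerivAt (fun t => (R - t) ^ (n + 2)) (-((n + 2) * (R - t) ^ (n + 1))) t :=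
    fun t => by
      refine ((hyd t).pow (n + 2)).congr_deriv ?_
      push_cast
      ring
  have hηd' : ∀ t : ℝ, HasDerivAt (fun t => (n + 2) * (R - t) ^ (n + 1))
      (-((n + 2) * (n + 1) * (R - t) ^ n)) t := fun t => by
      refine (((hyd t).pow (n + 1)).const_mul ((n : ℝ) + 2)).congr_deriv ?_
      push_cast
      ring
  have hsub : Icc 0 R ⊆ Ico 0 T := fun t ht => ⟨ht.1, ht.2.trans_lt hRT⟩
  have hibp := integral_mul_eq_sub_integral_primitive hR.le hki hηd (by fun_prop)
  have hFd := h.hasDeriv l hl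
  have hFc : ContinuousOn F (Icc 0 R) := fun t ht => ((hFd t (hsub ht)).mono hsub).continuousWithinAt
  have hcexp : Continuous fun t : ℝ => Real.exp (-(l * t)) := by fun_prop
  have hed : ∀ t, HasDerivAt (fun t => Real.exp (-(l * t))) (Real.exp (-(l * t)) * (-l)) t :=
    fun t => by
      have := ((hasDerivAt_id t).const_mul l).neg.exp
      simpa using this
  have hKc : ContinuousOn (fun t => ∫ s in (0 : ℝ)..t, k s) (Icc 0 R) := by
    have hi : IntervalIntegrable k volume 0 R := by
      rw [intervalIntegrable_iff_integrableOn_Ioo_of_le hR.le]; exact hki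
    have := (hi.absolutelyContinuousOnInterval_intervalIntegral (c := 0) left_mem_uIcc).continuousOn
    rwa [uIcc_of_le hR.le] at this
  have hc1 : ContinuousOn (fun t => -((n + 2) * (R - t) ^ (n + 1)) * ∫ s in (0 : ℝ)..t, k s)
      (Icc 0 R) := ContinuousOn.mul (by fun_prop) hKc
  have hc2 : ContinuousOn (fun t => Real.exp (-(l * t)) * F t *
      ((n + 2) * (n + 1) * (R - t) ^ n + 2 * l * ((n + 2) * (R - t) ^ (n + 1)))) (Icc 0 R) :=
    (hcexp.continuousOn.mul hFc).mul (by fun_prop)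
  -- The second integration by parts. In the derivative of `e^(-lt)F` the combination `e^(-lt)(V +
  -- lF)` is replaced by `εI + K`, which leaves `-2l e^(-lt)F`; this is the source of the factor
  -- `2l`.
  have hFTC := intervalIntegral.integral_eq_sub_of_hasDeriv_right (a := 0) (b := R)
    (f := fun t => (n + 2) * (R - t) ^ (n + 1) * (Real.exp (-(l * t)) * F t) +
      ε * I * (R - t) ^ (n + 2))
    (f' := fun t => -(-((n + 2) * (R - t) ^ (n + 1)) * ∫ s in (0 : ℝ)..t, k s) -
      Real.exp (-(l * t)) * F t *
      ((n + 2) * (n + 1) * (R - t) ^ n + 2 * l * ((n + 2) * (R - t) ^ (n + 1))))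
    (by
      rw [uIcc_of_le hR.le]
      exact (ContinuousOn.mul (by fun_prop) (hcexp.continuousOn.mul hFc)).add (by fun_prop))
    (by
      intro t ht
      rw [min_eq_left hR.le, max_eq_right hR.le] at ht
      have htT : t ∈ Ico 0 T := ⟨ht.1.le, ht.2.trans hRT⟩
      have h1 := (hFd t htT).hasDerivAt (Ico_mem_nhds ht.1 htT.2)
      have h2 := ((hηd' t).mul ((hed t).mul h1)).add ((hηd t).const_mul (ε * I))
      refine (h2.congr_deriv ?_).hasDerivWithinAt
      have h3 := h.duhamel l hl t htT
      simp only [Pi.mul_apply]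
      have h4 : ∫ s in (0 : ℝ)..t, k s = Real.exp (-(l * t)) * (V t + l * F t) - ε * I := by
        rw [h3]; ring
      rw [h4]
      ring)
    (by
      apply ContinuousOn.intervalIntegrable
      rw [uIcc_of_le hR.le]
      exact hc1.neg.sub hc2)
  have e : ∀ F : ℝ → ℝ, ∫ t in (0 : ℝ)..R, F t = ∫ t in Ioo 0 R, F t := fun F => by
    rw [intervalIntegral.integral_of_le hR.le, integral_Ioc_eq_integral_Ioo]
  have i1 : IntegrableOn (fun t => -((n + 2) * (R - t) ^ (n + 1)) * ∫ s in (0 : ℝ)..t, k s)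
      (Ioo 0 R) := (hc1.integrableOn_compact isCompact_Icc).mono_set Ioo_subset_Icc_self
  have i2 : IntegrableOn (fun t => Real.exp (-(l * t)) * F t *
      ((n + 2) * (n + 1) * (R - t) ^ n + 2 * l * ((n + 2) * (R - t) ^ (n + 1)))) (Ioo 0 R) :=
    (hc2.integrableOn_compact isCompact_Icc).mono_set Ioo_subset_Icc_self
  have i1' : IntegrableOn (fun t => -(-((n + 2) * (R - t) ^ (n + 1)) * ∫ s in (0 : ℝ)..t, k s))
      (Ioo 0 R) := i1.neg
  rw [e, integral_sub i1' i2, integral_neg] at hFTC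
  rw [hibp]
  have hI' : ∫ x, (g x + (l + (n + 2) / R) * f x) * waveProfile N l x = I + (n + 2) / R * J := by
    have hφc := (contDiff_waveProfile hN l).continuous
    rw [hI, hJ, ← integral_const_mul, ← integral_add]
    · congr 1; funext x; ring
    · refine ((hg.add (continuous_const.mul hf)).mul hφc).integrable_of_hasCompactSupport ?_
      exact HasCompactSupport.mul_right (hgc.add (hfc.mul_left))
    · exact ((hf.mul hφc).integrable_of_hasCompactSupport hfc.mul_right).const_mul _
  rw [hI'] at hdata
  have hF0 : F 0 = ε * J := h.initial l hl
  simp only [sub_self, sub_zero, mul_zero, neg_zero, Real.exp_zero, one_mul, hF0, ne_eq,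
    Nat.add_eq_zero_iff, one_ne_zero, OfNat.ofNat_ne_zero, and_false, not_false_eq_true, zero_pow,
    zero_mul, add_zero, zero_sub] at hFTC ⊢
  have hpos : 0 ≤ ε * R ^ (n + 2) * (I + (n + 2) / R * J) := by positivity
  have hexp : ε * R ^ (n + 2) * (I + (n + 2) / R * J) =
      (n + 2) * R ^ (n + 1) * (ε * J) + ε * I * R ^ (n + 2) := by
    field_simp; ring
  rw [hexp] at hpos
  linarith

/-! ### Lifespan from a polynomially growing source -/

/-- The spatial mean is controlled by the `L^q` norm. -/
lemma exists_mean_rpow_le {N : ℕ} {q r₀ : ℝ} (hq : 1 < q) (hr₀ : 0 ≤ r₀) :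
    ∃ C > 0, ∀ t : ℝ, 0 ≤ t → ∀ U : Space N → ℝ, AEStronglyMeasurable U →
      (Integrable fun x => |U x| ^ q) → (∀ᵐ x, r₀ + t < ‖x‖ → U x = 0) →
      |∫ x, U x| ^ q ≤ C * (1 + t) ^ ((N : ℝ) * (q - 1)) * ∫ x, |U x| ^ q := by
  have hq1 : 0 < q - 1 := by linarith
  set ω₁ := (volume : Measure (Space N)).real (Metric.ball 0 1) with hω
  have hω0 : 0 < ω₁ :=
    ENNReal.toReal_pos (Metric.measure_ball_pos _ _ one_pos).ne' measure_ball_lt_top.ne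
  refine ⟨((1 + r₀) ^ N * ω₁) ^ (q - 1), by positivity, fun t ht U hU hUi hUs => ?_⟩
  have h := abs_integral_mul_rpow_le hq hU hUi hUs (Ψ := fun _ => 1) continuous_const
    (fun _ => zero_le_one)
  simp only [mul_one, Real.one_rpow] at h
  refine h.trans ?_
  rw [mul_comm]
  have hA0 : 0 ≤ ∫ x, |U x| ^ q := integral_nonneg fun x => by positivity
  apply mul_le_mul_of_nonneg_right _ hA0
  have hvol : ∫ x in Metric.closedBall (0 : Space N) (r₀ + t), (1 : ℝ) = (r₀ + t) ^ N * ω₁ := by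
    rw [setIntegral_const, smul_eq_mul, mul_one, Measure.addHaar_real_closedBall _ _ (by linarith),
      finrank_euclideanSpace, Fintype.card_fin]
  rw [hvol, Real.rpow_mul (by linarith), ← Real.mul_rpow (by positivity) (by positivity)]
  apply Real.rpow_le_rpow (by positivity) _ hq1.le
  rw [Real.rpow_natCast]
  calc (r₀ + t) ^ N * ω₁ ≤ ((1 + r₀) * (1 + t)) ^ N * ω₁ := by
        gcongr; nlinarith
    _ = _ := by rw [mul_pow]; ring

/-- Young's inequality with the weights used below. -/
lemma young_weight {q A B X y : ℝ} {n : ℕ} (hq : 1 < q) (hA : 0 < A) (hB : 0 ≤ B) (hX : 0 ≤ X)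
    (hy : 0 < y) : B * y ^ n * X ≤ A * X ^ q * y ^ (n + 2) +
      B ^ (q / (q - 1)) * A ^ (-(1 / (q - 1))) * y ^ ((n : ℝ) + 2 - 2 * (q / (q - 1))) := by
  have hq0 : 0 < q := by linarith
  have hq1 : 0 < q - 1 := by linarith
  have hconj : q.HolderConjugate (q / (q - 1)) := Real.HolderConjugate.conjExponent hq
  set α := A ^ (1 / q) * X * y ^ (((n : ℝ) + 2) / q) with hα
  set β := B * A ^ (-(1 / q)) * y ^ ((n : ℝ) - ((n : ℝ) + 2) / q) with hβ
  have hα0 : 0 ≤ α := by positivity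
  have hβ0 : 0 ≤ β := by positivity
  have h := Real.young_inequality_of_nonneg hα0 hβ0 hconj
  have e1 : α * β = B * y ^ n * X := by
    have h1 : A ^ (1 / q) * A ^ (-(1 / q)) = 1 := by rw [← Real.rpow_add hA]; simp
    have h2 : y ^ (((n : ℝ) + 2) / q) * y ^ ((n : ℝ) - ((n : ℝ) + 2) / q) = y ^ n := by
      rw [← Real.rpow_add hy, ← Real.rpow_natCast]; congr 1; ring
    rw [hα, hβ]
    calc _ = B * X * (A ^ (1 / q) * A ^ (-(1 / q))) *
          (y ^ (((n : ℝ) + 2) / q) * y ^ ((n : ℝ) - ((n : ℝ) + 2) / q)) := by ring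
      _ = _ := by rw [h1, h2]; ring
  have e2 : α ^ q = A * X ^ q * y ^ (n + 2) := by
    rw [hα, Real.mul_rpow (by positivity) (by positivity), Real.mul_rpow (by positivity) hX,
      ← Real.rpow_mul hA.le, ← Real.rpow_mul hy.le, one_div, inv_mul_cancel₀ hq0.ne', Real.rpow_one,
      div_mul_cancel₀ _ hq0.ne', ← Real.rpow_natCast y (n + 2)]
    push_cast
    rfl
  have e3 : β ^ (q / (q - 1)) = B ^ (q / (q - 1)) * A ^ (-(1 / (q - 1))) *
      y ^ ((n : ℝ) + 2 - 2 * (q / (q - 1))) := by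
    rw [hβ, Real.mul_rpow (by positivity) (by positivity), Real.mul_rpow hB (by positivity),
      ← Real.rpow_mul hA.le, ← Real.rpow_mul hy.le]
    congr 2
    · congr 1; field_simp
    · field_simp; ring
  rw [e1] at h
  have h1 : α ^ q / q ≤ α ^ q := div_le_self (by positivity) hq.le
  have h2 : β ^ (q / (q - 1)) / (q / (q - 1)) ≤ β ^ (q / (q - 1)) := by
    refine div_le_self (by positivity) ?_
    rw [le_div_iff₀ hq1]; linarith
  rw [e2] at h1
  rw [e3] at h2
  rw [e2, e3] at h
  linarith

set_option maxHeartbeats 1000000 in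
/-- Lifespan estimate from a source term of size `ε^r (1+t)^{(N-1)(1-r/2)}`. -/
theorem exists_lifespan_of_source {N : ℕ} (hN : 1 ≤ N) {p q r a b a' d r₀ t₀ l₀ : ℝ} (hq : 1 < q)
    (hr : 1 < r) (ha : 0 < a) (hb : 0 < b) (ha' : 0 < a') (haa : a' ≤ a) (hd : 0 < d)
    (hr₀ : 0 ≤ r₀) (hl₀ : 0 < l₀) {f g : Space N → ℝ} (hf : Continuous f)
    (hfc : HasCompactSupport f) (hg : Continuous g) (hgc : HasCompactSupport g)
    (hdata : ∀ l, 0 ≤ l → l ≤ l₀ → ∀ μ, 0 ≤ μ → μ ≤ l₀ →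
      0 < ∫ x, (g x + μ * f x) * waveProfile N l x)
    (hΓ : 0 < GammaComb N r q) :
    ∃ C > 0, ∀ ε T : ℝ, ∀ u v H : ℝ → Space N → ℝ, 0 < ε → ε ≤ 1 →
      ConeSolution p q a b f g ε T r₀ u v H →
      (∀ᵐ t ∂(volume.restrict (Ioo 0 T)), t₀ ≤ t →
        (a' * ∫ x, |u t x| ^ q) + d * ε ^ r * (1 + t) ^ (((N : ℝ) - 1) * (1 - r / 2)) ≤
          ∫ x, H t x) →
      T ≤ C * ε ^ (-(GammaComb N r q)⁻¹) := by
  have hq0 : 0 < q := by linarith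
  have hq1 : 0 < q - 1 := by linarith
  have hr0 : 0 < r := by linarith
  set κ : ℝ := ((N : ℝ) - 1) * (1 - r / 2) with hκ
  set Γ := GammaComb N r q with hΓd
  obtain ⟨Cm, hCm, hmean⟩ := exists_mean_rpow_le (N := N) hq hr₀
  -- Keeps the exponent `n + 2 - 2q/(q-1)` in Young's remainder nonnegative, so that `R - t` can be
  -- replaced by `R` there.
  obtain ⟨n, hn⟩ := exists_nat_ge (2 * (q / (q - 1)))
  set B : ℝ := (n + 2) * (n + 1) with hB
  have hB0 : 0 < B := by positivity
  set A₀ : ℝ := a' / (Cm * 2 ^ ((N : ℝ) * (q - 1))) with hA₀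
  have hA₀0 : 0 < A₀ := by positivity
  set D : ℝ := B ^ (q / (q - 1)) * A₀ ^ (-(1 / (q - 1))) with hD
  have hD0 : 0 < D := by positivity
  set w₀ : ℝ := (1 / 2) ^ (n + 2) * (d * ((4 : ℝ) ^ |κ|)⁻¹) with hw₀
  have hw₀0 : 0 < w₀ := by positivity
  set C₁ : ℝ := 4 * D / w₀ with hC₁
  have hC₁0 : 0 < C₁ := by positivity
  -- `R ≥ 1` gives `1 + t ≤ 2R`. The bound `R ≥ 4t₀` puts the window `[R/4, R/2]` after `t₀`, and `R
  -- ≥ (n+2)/l₀` keeps the boundary term at time `0` in the range where the data pair positively.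
  set R₀ : ℝ := max (max 1 (4 * t₀)) ((n + 2) / l₀) with hR₀
  have hR₀1 : 1 ≤ R₀ := (le_max_left _ _).trans (le_max_left _ _)
  -- the estimate for one time
  have key : ∀ ε T : ℝ, ∀ u v H : ℝ → Space N → ℝ, 0 < ε →
      ConeSolution p q a b f g ε T r₀ u v H →
      (∀ᵐ t ∂(volume.restrict (Ioo 0 T)), t₀ ≤ t →
        (a' * ∫ x, |u t x| ^ q) + d * ε ^ r * (1 + t) ^ κ ≤ ∫ x, H t x) →
      ∀ R, R₀ ≤ R → R < T → ε ^ r * R ^ (r * Γ) ≤ C₁ := by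
    intro ε T u v H hε h hsrc R hRR hRT
    have hR1 : 1 ≤ R := hR₀1.trans hRR
    have hR0 : 0 < R := by linarith
    have hRt : 4 * t₀ ≤ R := ((le_max_right _ _).trans (le_max_left _ _)).trans hRR
    have hRl : (n + 2) / R ≤ l₀ := by
      rw [div_le_iff₀ hR0, ← div_le_iff₀' hl₀]
      exact (le_max_right _ _).trans hRR
    have htest := h.test_inequality le_rfl hR0 hRT hε.le n hN hf hfc hg hgc
      (hdata 0 le_rfl hl₀.le _ (by positivity) (by simpa using hRl)).le
    simp only [waveProfile_zero, mul_one, zero_mul, neg_zero, Real.exp_zero, one_mul, mul_zero,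
      add_zero] at htest
    set A : ℝ := A₀ * (R ^ ((N : ℝ) * (q - 1)))⁻¹ with hA
    have hA0 : 0 < A := by positivity
    -- The source is used only for `t` in `[R/4, R/2]`, where both `R - t` and `1 + t` are
    -- comparable to `R`; this makes the sign of `κ` irrelevant.
    set W : ℝ → ℝ := (Icc (R / 4) (R / 2)).indicator
      (fun _ => w₀ * ε ^ r * (R ^ (n + 2) * R ^ κ)) with hW
    set E : ℝ := B ^ (q / (q - 1)) * A ^ (-(1 / (q - 1))) *
      R ^ ((n : ℝ) + 2 - 2 * (q / (q - 1))) with hE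
    have hpt : ∀ᵐ t ∂(volume.restrict (Ioo 0 R)), W t + (∫ x, u t x) *
        ((n + 2) * (n + 1) * (R - t) ^ n) ≤ (R - t) ^ (n + 2) * (∫ x, H t x) + E := by
      have hsub : Ioo 0 R ⊆ Ioo 0 T := fun t ht => ⟨ht.1, ht.2.trans hRT⟩
      filter_upwards [ae_restrict_of_ae_restrict_of_subset hsub hsrc,
        ae_restrict_of_ae_restrict_of_subset hsub (h.ae_integrable ha hb),
        ae_restrict_mem measurableSet_Ioo] with t hsrct hint ht
      have htT := hsub ht
      set U := ∫ x, |u t x| ^ q with hU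
      have hU0 : 0 ≤ U := integral_nonneg fun x => by positivity
      set X := |∫ x, u t x| with hX
      have hX0 : 0 ≤ X := abs_nonneg _
      set y := R - t with hy
      have hy0 : 0 < y := by rw [hy]; linarith [ht.2]
      have hyR : y ≤ R := by rw [hy]; linarith [ht.1]
      have h1 := hmean t ht.1.le (u t) (h.memLp_u t).1 hint.1 (h.supp_u t ⟨htT.1.le, htT.2⟩)
      have ht1 : 0 < 1 + t := by linarith [ht.1]
      have h2 : (1 + t) ^ ((N : ℝ) * (q - 1)) ≤
          2 ^ ((N : ℝ) * (q - 1)) * R ^ ((N : ℝ) * (q - 1)) := by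
        rw [← Real.mul_rpow two_pos.le hR0.le]
        apply Real.rpow_le_rpow ht1.le (by linarith [ht.2]) (by positivity)
      have h3 : A * X ^ q ≤ a' * U := by
        have h4 : X ^ q ≤ Cm * (2 ^ ((N : ℝ) * (q - 1)) * R ^ ((N : ℝ) * (q - 1))) * U := by
          refine h1.trans ?_
          gcongr
        calc A * X ^ q ≤ A *
              (Cm * (2 ^ ((N : ℝ) * (q - 1)) * R ^ ((N : ℝ) * (q - 1))) * U) := by gcongr
          _ = a' * U := by rw [hA, hA₀]; field_simp
      have h5 := young_weight (n := n) hq hA0 hB0.le hX0 hy0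
      have h6 : y ^ ((n : ℝ) + 2 - 2 * (q / (q - 1))) ≤ R ^ ((n : ℝ) + 2 - 2 * (q / (q - 1))) :=
        Real.rpow_le_rpow hy0.le hyR (by linarith)
      have h7 : B ^ (q / (q - 1)) * A ^ (-(1 / (q - 1))) *
          y ^ ((n : ℝ) + 2 - 2 * (q / (q - 1))) ≤ E := by
        rw [hE]; gcongr
      have h8 : (∫ x, u t x) * ((n + 2) * (n + 1) * y ^ n) ≤ B * y ^ n * X := by
        rw [← hB, mul_comm]
        have := le_abs_self (∫ x, u t x)
        gcongr
      have hall : a' * U ≤ ∫ x, H t x := by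
        have h9 := hint.2.2 (fun _ => 1) continuous_const (fun _ => zero_le_one)
        simp only [mul_one] at h9
        have h10 : 0 ≤ ∫ x, |v t x| ^ p := integral_nonneg fun x => by positivity
        nlinarith
      by_cases hm : t ∈ Icc (R / 4) (R / 2)
      · have h9 := hsrct (by linarith [hm.1])
        have h10 : R ^ κ ≤ 4 ^ |κ| * (1 + t) ^ κ :=
          rpow_le_of_comparable κ (by norm_num) hR0 ht1 (by linarith [hm.1]) (by linarith [hm.2])
        have h11 : (1 / 2) ^ (n + 2) * R ^ (n + 2) ≤ y ^ (n + 2) := by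
          rw [← mul_pow]
          apply pow_le_pow_left₀ (by positivity)
          rw [hy]; linarith [hm.2]
        have h12 : W t ≤ y ^ (n + 2) * (d * ε ^ r * (1 + t) ^ κ) := by
          rw [hW, indicator_of_mem hm]
          calc w₀ * ε ^ r * (R ^ (n + 2) * R ^ κ) =
                ((1 / 2) ^ (n + 2) * R ^ (n + 2)) * (d * ε ^ r * (((4 : ℝ) ^ |κ|)⁻¹ * R ^ κ)) := by
                rw [hw₀]; ring
            _ ≤ y ^ (n + 2) * (d * ε ^ r * (((4 : ℝ) ^ |κ|)⁻¹ * (4 ^ |κ| * (1 + t) ^ κ))) := by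
                gcongr
            _ = _ := by field_simp
        have h13 : y ^ (n + 2) * (A * X ^ q + d * ε ^ r * (1 + t) ^ κ) ≤
            y ^ (n + 2) * ∫ x, H t x := by
          gcongr; linarith
        linarith
      · have h12 : W t = 0 := by rw [hW, indicator_of_notMem hm]
        have h13 : y ^ (n + 2) * (A * X ^ q) ≤ y ^ (n + 2) * ∫ x, H t x := by
          gcongr; linarith
        linarith
    have hWi : IntegrableOn W (Ioo 0 R) :=
      (integrable_indicator_iff measurableSet_Icc).2
        (by
          rw [integrableOn_const_iff]
          right
          exact (Measure.restrict_apply_le _ _).trans_lt measure_Icc_lt_top)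
    have hFi : IntegrableOn (fun t => (∫ x, u t x) * ((n + 2) * (n + 1) * (R - t) ^ n))
        (Ioo 0 R) := by
      have hsub : Icc 0 R ⊆ Ico 0 T := fun t ht => ⟨ht.1, ht.2.trans_lt hRT⟩
      have hFd := h.hasDeriv 0 le_rfl
      simp only [waveProfile_zero, mul_one] at hFd
      have hFc : ContinuousOn (fun t => ∫ x, u t x) (Icc 0 R) := fun t ht =>
        ((hFd t (hsub ht)).mono hsub).continuousWithinAt
      exact ((hFc.mul (by fun_prop)).integrableOn_compact isCompact_Icc).mono_set
        Ioo_subset_Icc_self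
    have hHi : IntegrableOn (fun t => (R - t) ^ (n + 2) * ∫ x, H t x) (Ioo 0 R) := by
      have hi := h.integrable_pairing 0 le_rfl
      simp only [waveProfile_zero, mul_one] at hi
      have hi' : IntegrableOn (fun t => ∫ x, H t x) (Ioo 0 R) :=
        hi.mono_set fun t ht => ⟨ht.1, ht.2.trans hRT⟩
      refine Integrable.bdd_mul (c := R ^ (n + 2)) hi'
        (Continuous.aestronglyMeasurable (by fun_prop)) ?_
      filter_upwards [ae_restrict_mem measurableSet_Ioo] with t ht
      rw [norm_pow, Real.norm_eq_abs, abs_of_pos (by linarith [ht.2])]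
      exact pow_le_pow_left₀ (by linarith [ht.2]) (by linarith [ht.1]) _
    have hEi : IntegrableOn (fun _ : ℝ => E) (Ioo 0 R) := integrableOn_const measure_Ioo_lt_top.ne
    have hmono := integral_mono_ae (hWi.add hFi) (hHi.add hEi) hpt
    simp only [Pi.add_apply] at hmono
    rw [integral_add hWi hFi, integral_add hHi hEi] at hmono
    have hIcc : Icc (R / 4) (R / 2) ⊆ Ioo 0 R := fun t ht =>
      ⟨by linarith [ht.1], by linarith [ht.2]⟩
    have hWint : ∫ t in Ioo 0 R, W t = R / 4 * (w₀ * ε ^ r * (R ^ (n + 2) * R ^ κ)) := by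
      rw [hW, integral_indicator measurableSet_Icc, Measure.restrict_restrict measurableSet_Icc,
        inter_eq_left.2 hIcc, setIntegral_const,
        Real.volume_real_Icc_of_le (by linarith), smul_eq_mul]
      ring
    have hEint : ∫ t in Ioo 0 R, E = R * E := by
      rw [setIntegral_const, Real.volume_real_Ioo_of_le hR0.le, smul_eq_mul, sub_zero]
    rw [hWint, hEint] at hmono
    -- The terms with `∫ u` cancel against the tested equation. Only the source and Young's
    -- remainder are left.
    have h1 : R / 4 * (w₀ * ε ^ r * (R ^ (n + 2) * R ^ κ)) ≤ R * E := by linarith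
    have h2 : E = D * (R ^ (n + 2) * R ^ κ * R ^ (-(r * Γ))) := by
      have e1 : A ^ (-(1 / (q - 1))) = A₀ ^ (-(1 / (q - 1))) * R ^ (N : ℝ) := by
        rw [hA, Real.mul_rpow hA₀0.le (by positivity), ← Real.rpow_neg hR0.le,
          ← Real.rpow_mul hR0.le]
        congr 2
        field_simp
      rw [hE, e1, hD, ← Real.rpow_natCast R (n + 2), ← Real.rpow_add hR0, ← Real.rpow_add hR0]
      rw [show B ^ (q / (q - 1)) * (A₀ ^ (-(1 / (q - 1))) * R ^ (N : ℝ)) *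
        R ^ ((n : ℝ) + 2 - 2 * (q / (q - 1))) = B ^ (q / (q - 1)) * A₀ ^ (-(1 / (q - 1))) *
        (R ^ (N : ℝ) * R ^ ((n : ℝ) + 2 - 2 * (q / (q - 1)))) by ring, ← Real.rpow_add hR0]
      congr 2
      -- The scaling identity `N - 2q/(q-1) - κ = -rΓ`, from which the lifespan exponent arises.
      rw [hΓd, GammaComb, hκ]
      push_cast
      field_simp
      ring
    have hRn : 0 < R ^ (n + 2) * R ^ κ := by positivity
    rw [h2] at h1
    have h3 : w₀ * ε ^ r ≤ 4 * D * R ^ (-(r * Γ)) := by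
      have h4 : (R * (R ^ (n + 2) * R ^ κ)) * (w₀ * ε ^ r) ≤
          (R * (R ^ (n + 2) * R ^ κ)) * (4 * D * R ^ (-(r * Γ))) := by linarith
      exact le_of_mul_le_mul_left h4 (by positivity)
    rw [Real.rpow_neg hR0.le] at h3
    rw [hC₁, le_div_iff₀ hw₀0]
    have hRΓ : 0 < R ^ (r * Γ) := by positivity
    calc ε ^ r * R ^ (r * Γ) * w₀ = w₀ * ε ^ r * R ^ (r * Γ) := by ring
      _ ≤ 4 * D * (R ^ (r * Γ))⁻¹ * R ^ (r * Γ) := by gcongr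
      _ = 4 * D := by field_simp
  refine ⟨R₀ + C₁ ^ (1 / (r * Γ)), by positivity, fun ε T u v H hε hε1 h hsrc => ?_⟩
  have hε' : 1 ≤ ε ^ (-Γ⁻¹) :=
    Real.one_le_rpow_of_pos_of_le_one_of_nonpos hε hε1 (by simpa using hΓ.le)
  have hC' : 0 < C₁ ^ (1 / (r * Γ)) := by positivity
  refine le_of_forall_lt_imp_le_of_dense fun R hR => ?_
  rcases le_total R R₀ with hc | hc
  · nlinarith
  · have h1 := key ε T u v H hε h hsrc R hc hR
    have hR0 : 0 < R := by linarith
    have h2 : R ^ (r * Γ) ≤ C₁ * ε ^ (-r) := by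
      rw [Real.rpow_neg hε.le, ← div_eq_mul_inv, le_div_iff₀ (by positivity)]; linarith
    have h3 : R ≤ C₁ ^ (1 / (r * Γ)) * ε ^ (-Γ⁻¹) := by
      calc R = (R ^ (r * Γ)) ^ (1 / (r * Γ)) := by
            rw [← Real.rpow_mul hR0.le, mul_one_div_cancel (by positivity), Real.rpow_one]
        _ ≤ (C₁ * ε ^ (-r)) ^ (1 / (r * Γ)) := by gcongr
        _ = _ := by
          rw [Real.mul_rpow hC₁0.le (by positivity), ← Real.rpow_mul hε.le]
          congr 2
          field_simp
    nlinarith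


/-! ### The parameter regions -/

lemma GammaS_eq {N : ℕ} {q : ℝ} (hq : 1 < q) :
    GammaS N q = gammaStrauss N q / (2 * (q * (q - 1))) := by
  have : q - 1 ≠ 0 := by linarith
  have : q ≠ 0 := by linarith
  rw [GammaS, gammaStrauss]
  field_simp
  ring

/-- `γ_S(r)/r = 2/r + (N+1) - (N-1)r` is strictly decreasing. Hence `γ_S` passes from positive to
negative at most once, and the supremum defining `p_S` can be tested by a sign. -/
lemma gammaStrauss_cross_le {N : ℕ} (hN : 1 ≤ N) {q r : ℝ} (hq : 0 < q) (hqr : q < r) :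
    q * gammaStrauss N r < r * gammaStrauss N q := by
  have hN' : (0 : ℝ) ≤ (N : ℝ) - 1 := by
    have : (1 : ℝ) ≤ N := by exact_mod_cast hN
    linarith
  have h : 0 ≤ ((N : ℝ) - 1) * (q * r * (r - q)) :=
    mul_nonneg hN' (mul_nonneg (mul_nonneg hq.le (hq.trans hqr).le) (by linarith))
  rw [gammaStrauss, gammaStrauss]
  nlinarith

lemma continuous_gammaStrauss (N : ℕ) : Continuous (gammaStrauss N) := by
  unfold gammaStrauss
  fun_prop

lemma lt_pS_iff {N : ℕ} (hN : 1 ≤ N) {q : ℝ} (hq : 1 < q) :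
    (q : EReal) < pS N ↔ 0 < gammaStrauss N q := by
  constructor
  · intro h
    obtain ⟨_, ⟨r, ⟨-, hr⟩, rfl⟩, hqr⟩ := lt_sSup_iff.1 h
    have hqr' : q < r := EReal.coe_lt_coe_iff.1 hqr
    have h1 := gammaStrauss_cross_le hN (by linarith) hqr'
    have h2 : 0 < q * gammaStrauss N r := mul_pos (by linarith) hr
    exact pos_of_mul_pos_right (h2.trans h1) (by linarith)
  · intro h
    have hev := (continuous_gammaStrauss N).continuousAt.eventually (lt_mem_nhds h)
    obtain ⟨r, hr, hqr⟩ :=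
      ((hev.filter_mono nhdsWithin_le_nhds).and (self_mem_nhdsWithin (s := Ioi q))).exists
    have hqr : q < r := hqr
    exact lt_sSup_iff.2 ⟨r, ⟨r, ⟨by linarith, hr⟩, rfl⟩, by exact_mod_cast hqr⟩

lemma eq_pS_iff {N : ℕ} (hN : 1 ≤ N) {q : ℝ} (hq : 1 < q) :
    (q : EReal) = pS N ↔ gammaStrauss N q = 0 := by
  constructor
  · intro h
    refine le_antisymm ?_ ?_
    · exact not_lt.1 fun h' => ((lt_pS_iff hN hq).2 h').ne h
    · refine not_lt.1 fun h' => ?_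
      have hev := (continuous_gammaStrauss N).continuousAt.eventually (gt_mem_nhds h')
      obtain ⟨r, ⟨hr, hr1⟩, hqr⟩ := (((hev.filter_mono nhdsWithin_le_nhds).and
        ((lt_mem_nhds hq).filter_mono nhdsWithin_le_nhds)).and
          (self_mem_nhdsWithin (s := Iio q))).exists
      have hqr : r < q := hqr
      have : (r : EReal) < pS N := by rw [← h]; exact_mod_cast hqr
      have := (lt_pS_iff hN hr1).1 this
      linarith
  · intro h
    refine le_antisymm ?_ ?_
    · refine not_lt.1 fun h' => ?_
      obtain ⟨r, hr1, hr2⟩ := EReal.lt_iff_exists_real_btwn.1 h'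
      have hrq : r < q := by exact_mod_cast hr2
      -- The maximum keeps the comparison point above `1`, as membership in the set defining `p_S`
      -- requires.
      have hs : max r ((1 + q) / 2) < q := max_lt hrq (by linarith)
      have hs1 : 1 < max r ((1 + q) / 2) := lt_max_of_lt_right (by linarith)
      have h1 := gammaStrauss_cross_le hN (by linarith) hs
      rw [h, mul_zero] at h1
      have h2 := pos_of_mul_pos_right h1 (by linarith)
      have h3 := (lt_pS_iff hN hs1).2 h2
      have h4 : (r : EReal) ≤ (max r ((1 + q) / 2) : ℝ) := by exact_mod_cast le_max_left _ _
      exact absurd (hr1.trans_le h4) (not_lt.2 h3.le)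
    · exact not_lt.1 fun h' => ((lt_pS_iff hN hq).1 h').ne' h

lemma lt_pG_iff {N : ℕ} (hN : 1 ≤ N) {p : ℝ} :
    (p : EReal) < pG N ↔ ((N : ℝ) - 1) / 2 * (p - 1) < 1 := by
  rw [pG]
  split_ifs with h
  · subst h; simp [EReal.coe_lt_top]
  · have hN' : (0 : ℝ) < (N : ℝ) - 1 := by
      have : (2 : ℝ) ≤ N := by exact_mod_cast (by omega : 2 ≤ N)
      linarith
    rw [EReal.coe_lt_coe_iff, lt_div_iff₀ hN']
    constructor <;> intro h <;> linarith

lemma eq_pG_iff {N : ℕ} (hN : 1 ≤ N) {p : ℝ} :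
    (p : EReal) = pG N ↔ ((N : ℝ) - 1) / 2 * (p - 1) = 1 := by
  rw [pG]
  split_ifs with h
  · subst h; simp [EReal.coe_ne_top]
  · have hN' : (0 : ℝ) < (N : ℝ) - 1 := by
      have : (2 : ℝ) ≤ N := by exact_mod_cast (by omega : 2 ≤ N)
      linarith
    rw [EReal.coe_eq_coe_iff, eq_div_iff hN'.ne']
    constructor <;> intro h <;> linarith

lemma GammaG_eq {N : ℕ} {p : ℝ} (hp : 1 < p) :
    GammaG N p = (1 - ((N : ℝ) - 1) / 2 * (p - 1)) / (p - 1) := by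
  have : p - 1 ≠ 0 := by linarith
  rw [GammaG]
  field_simp

lemma GammaComb_self (N : ℕ) {q : ℝ} (hq : 1 < q) : GammaComb N q q = GammaS N q := by
  have : q - 1 ≠ 0 := by linarith
  have : q ≠ 0 := by linarith
  rw [GammaComb, GammaS]
  field_simp

lemma GammaComb_sub_GammaS {N : ℕ} {p q : ℝ} (hp : 1 < p) (hq : 1 < q) :
    GammaComb N p q - GammaS N q = (q + 1) * (q - p) / (p * q * (q - 1)) := by
  have : q - 1 ≠ 0 := by linarith
  have : q ≠ 0 := by linarith
  have : p ≠ 0 := by linarith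
  rw [GammaComb, GammaS]
  field_simp
  ring

lemma GammaComb_sub_GammaG {N : ℕ} {p q : ℝ} (hp : 1 < p) (hq : 1 < q) :
    GammaComb N p q - GammaG N p = (2 * p - 1 - q) / (p * (p - 1) * (q - 1)) := by
  have : q - 1 ≠ 0 := by linarith
  have : p - 1 ≠ 0 := by linarith
  have : p ≠ 0 := by linarith
  rw [GammaComb, GammaG]
  field_simp
  ring

/-- For `q < p` both `Γ_comb` and `Γ_G` are at most `Γ_S`, and for `q > 2p - 1` both `Γ_comb` and
`Γ_S` lie below `Γ_G`; there the hypothesis becomes a sign condition on one exponent. In between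
`Γ_comb` dominates. If it is not positive, then it vanishes together with `Γ_S` or `Γ_G`, which
happens only on the edges `q = p` and `q = 2p - 1`, and these belong to the critical cases. -/
theorem exists_case {N : ℕ} (hN : 1 ≤ N) {p q : ℝ} (hp : 1 < p) (hq : 1 < q)
    (hΓ : 0 ≤ max (GammaS N q) (GammaG N p) ∨ 0 < GammaComb N p q) :
    CaseGlasseyCritical N p q ∨ CaseGlasseySubcritical N p q ∨ CaseCombined N p q ∨
      CaseStraussSubcritical N p q ∨ CaseStraussCritical N p q := by
  have hp1 : 0 < p - 1 := by linarith
  have hq1 : 0 < q - 1 := by linarith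
  have hq0 : 0 < q := by linarith
  have hp0 : 0 < p := by linarith
  have hS := GammaComb_sub_GammaS (N := N) hp hq
  have hG := GammaComb_sub_GammaG (N := N) hp hq
  have hGe := GammaG_eq (N := N) hp
  have hSe := GammaS_eq (N := N) hq
  have hSG : q < p → GammaG N p ≤ GammaS N q := fun hqp => by
    have h1 : 1 / (p - 1) ≤ 1 / (q - 1) := by
      apply one_div_le_one_div_of_le hq1; linarith
    have h2 : 1 / (q - 1) ≤ (1 + 1 / q) * (q - 1)⁻¹ := by
      rw [one_div]
      have h3 : 0 < 1 / q := by positivity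
      have h4 : 0 < (q - 1)⁻¹ := by positivity
      nlinarith
    rw [GammaG, GammaS]
    linarith
  have hGcrit : GammaG N p = 0 → 2 * p - 1 ≤ q → CaseGlasseyCritical N p q := fun h hpq => by
    rw [hGe, div_eq_zero_iff] at h
    have h1 : ((N : ℝ) - 1) / 2 * (p - 1) = 1 := by
      rcases h with h | h <;> linarith
    refine ⟨(eq_pG_iff hN).2 h1, ?_⟩
    have hN0 : (N : ℝ) - 1 ≠ 0 := fun h0 => by rw [h0] at h1; norm_num at h1
    -- At `p = p_G` the threshold `1 + 4/(N-1)` is exactly `2p - 1`.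
    have h2 : 4 / ((N : ℝ) - 1) = 2 * (p - 1) := by
      rw [div_eq_iff hN0]; linarith
    rw [h2]; linarith
  have hScrit : GammaS N q = 0 → q ≤ p → CaseStraussCritical N p q := fun h hqp => by
    rw [hSe, div_eq_zero_iff] at h
    refine ⟨hqp, (eq_pS_iff hN hq).2 ?_⟩
    rcases h with h | h
    · exact h
    · exact absurd h (by positivity)
  rcases lt_or_ge q p with hqp | hpq
  · have h1 : (q + 1) * (q - p) / (p * q * (q - 1)) ≤ 0 := by
      apply div_nonpos_of_nonpos_of_nonneg _ (by positivity)
      exact mul_nonpos_of_nonneg_of_nonpos (by linarith) (by linarith)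
    have h2 : 0 ≤ GammaS N q := by
      rcases hΓ with h | h
      · rcases le_max_iff.1 h with h | h
        · exact h
        · exact h.trans (hSG hqp)
      · linarith
    rcases h2.eq_or_lt with h | h
    · exact Or.inr (Or.inr (Or.inr (Or.inr (hScrit h.symm hqp.le))))
    · refine Or.inr (Or.inr (Or.inr (Or.inl ⟨hqp, (lt_pS_iff hN hq).2 ?_⟩)))
      rw [hSe] at h
      exact (div_pos_iff_of_pos_right (by positivity)).1 h
  have h1 : 0 ≤ (q + 1) * (q - p) / (p * q * (q - 1)) :=
    div_nonneg (mul_nonneg (by linarith) (by linarith)) (by positivity)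
  rcases le_or_gt q (2 * p - 1) with hq2 | hq2
  · have h2 : 0 ≤ (2 * p - 1 - q) / (p * (p - 1) * (q - 1)) :=
      div_nonneg (by linarith) (by positivity)
    by_cases hc : 0 < GammaComb N p q
    · exact Or.inr (Or.inr (Or.inl ⟨hpq, hq2, hc⟩))
    rcases hΓ with h | h
    · rcases le_max_iff.1 h with h | h
      · have h3 : (q + 1) * (q - p) / (p * q * (q - 1)) = 0 := by linarith
        have h4 : q - p = 0 := by
          rw [div_eq_zero_iff] at h3
          rcases h3 with h3 | h3
          · exact (mul_eq_zero.1 h3).resolve_left (by linarith)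
          · exact absurd h3 (by positivity)
        exact Or.inr (Or.inr (Or.inr (Or.inr (hScrit (by linarith) (by linarith)))))
      · have h3 : (2 * p - 1 - q) / (p * (p - 1) * (q - 1)) = 0 := by linarith
        have h4 : 2 * p - 1 - q = 0 := by
          rw [div_eq_zero_iff] at h3
          exact h3.resolve_right (by positivity)
        exact Or.inl (hGcrit (by linarith) (by linarith))
    · exact absurd h hc
  · have h2 : (2 * p - 1 - q) / (p * (p - 1) * (q - 1)) < 0 :=
      div_neg_of_neg_of_pos (by linarith) (by positivity)
    have h3 : 0 ≤ GammaG N p := by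
      rcases hΓ with h | h
      · rcases le_max_iff.1 h with h | h
        · linarith
        · exact h
      · linarith
    rcases h3.eq_or_lt with h | h
    · exact Or.inl (hGcrit h.symm hq2.le)
    · refine Or.inr (Or.inl ⟨(lt_pG_iff hN).2 ?_, hq2⟩)
      rw [hGe] at h
      have := (div_pos_iff_of_pos_right hp1).1 h
      linarith


/-! ### The logarithmic blow-up mechanism -/

lemma hasDerivAt_max_zero_pow (n : ℕ) (x : ℝ) :
    HasDerivAt (fun x : ℝ => (max 0 x) ^ (n + 2)) ((n + 2) * (max 0 x) ^ (n + 1)) x := by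
  rcases lt_trichotomy x 0 with h | h | h
  · have he : (fun x : ℝ => (max 0 x) ^ (n + 2)) =ᶠ[nhds x] fun _ => 0 := by
      filter_upwards [gt_mem_nhds h] with y hy
      rw [max_eq_left hy.le, zero_pow (by omega)]
    rw [max_eq_left h.le, zero_pow (by omega), mul_zero]
    exact (hasDerivAt_const x (0 : ℝ)).congr_of_eventuallyEq he
  · subst h
    rw [max_self, zero_pow (by omega), mul_zero]
    rw [hasDerivAt_iff_isLittleO]
    simp only [max_self, ne_eq, Nat.add_eq_zero_iff, OfNat.ofNat_ne_zero, and_false,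
      not_false_eq_true, zero_pow, sub_zero, smul_eq_mul, mul_zero]
    refine Asymptotics.IsBigO.trans_isLittleO (g := fun x : ℝ => x ^ (n + 2)) ?_ ?_
    · refine Asymptotics.IsBigO.of_bound 1 (Filter.Eventually.of_forall fun y => ?_)
      rw [one_mul, norm_pow, norm_pow]
      refine pow_le_pow_left₀ (norm_nonneg _) ?_ _
      rw [Real.norm_eq_abs, Real.norm_eq_abs, abs_of_nonneg (le_max_left _ _)]
      exact max_le (abs_nonneg _) (le_abs_self _)
    · simpa using Asymptotics.isLittleO_pow_pow (𝕜 := ℝ) (show 1 < n + 2 by omega)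
  · have he : (fun x : ℝ => (max 0 x) ^ (n + 2)) =ᶠ[nhds x] fun x => x ^ (n + 2) := by
      filter_upwards [lt_mem_nhds h] with y hy
      rw [max_eq_right hy.le]
    rw [max_eq_right h.le]
    refine HasDerivAt.congr_of_eventuallyEq ?_ he
    simpa using hasDerivAt_pow (n + 2) x

/-- The weighted mean `∫ (1 - (t + A) / ρ)₊^k B(t) dt`. -/
noncomputable def coneMean (B : ℝ → ℝ) (A T : ℝ) (n : ℕ) (ρ : ℝ) : ℝ :=
  ∫ t in Ioo 0 T, (max 0 (1 - (t + A) / ρ)) ^ (n + 2) * B t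

/-- The weighted mean appearing in the derivative of `coneMean`. -/
noncomputable def coneMeanDeriv (B : ℝ → ℝ) (A T : ℝ) (n : ℕ) (ρ : ℝ) : ℝ :=
  ∫ t in Ioo 0 T, (t + A) / ρ * (max 0 (1 - (t + A) / ρ)) ^ (n + 1) * B t

lemma max_zero_one_sub_le {A t ρ : ℝ} (hA : 0 ≤ A) (ht : 0 ≤ t) (hρ : 0 < ρ) :
    max 0 (1 - (t + A) / ρ) ≤ 1 := by
  have : 0 ≤ (t + A) / ρ := by positivity
  exact max_le zero_le_one (by linarith)

lemma integrableOn_coneMean {B : ℝ → ℝ} {A T : ℝ} (hA : 0 ≤ A) (hB : IntegrableOn B (Ioo 0 T))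
    (n : ℕ) {ρ : ℝ} (hρ : 0 < ρ) :
    IntegrableOn (fun t => (max 0 (1 - (t + A) / ρ)) ^ n * B t) (Ioo 0 T) := by
  refine Integrable.bdd_mul (c := 1) hB (Continuous.aestronglyMeasurable (by fun_prop)) ?_
  filter_upwards [ae_restrict_mem measurableSet_Ioo] with t ht
  have h0 : 0 ≤ max 0 (1 - (t + A) / ρ) := le_max_left _ _
  rw [norm_pow, Real.norm_eq_abs, abs_of_nonneg h0]
  exact pow_le_one₀ h0 (max_zero_one_sub_le hA ht.1.le hρ)

/-- The weight is a power at least two of a positive part, hence `C¹` in `ρ`, and so differentiation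
under the integral needs no boundary term at `t + A = ρ`. For `ρ > 1` the derivative is dominated by
a multiple of `|B|`. -/
lemma hasDerivAt_coneMean {B : ℝ → ℝ} {A T : ℝ} (hA : 0 ≤ A) (hB : IntegrableOn B (Ioo 0 T))
    (n : ℕ) {ρ : ℝ} (hρ : 1 < ρ) :
    HasDerivAt (coneMean B A T n) ((n + 2) / ρ * coneMeanDeriv B A T n ρ) ρ := by
  have h := hasDerivAt_integral_of_dominated_loc_of_deriv_le (μ := volume.restrict (Ioo 0 T))
    (F := fun ρ t => (max 0 (1 - (t + A) / ρ)) ^ (n + 2) * B t)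
    (F' := fun ρ t => (n + 2) / ρ * ((t + A) / ρ * (max 0 (1 - (t + A) / ρ)) ^ (n + 1) * B t))
    (bound := fun t => (n + 2) * (T + A) * ‖B t‖) (s := Ioi 1) (x₀ := ρ) (Ioi_mem_nhds hρ)
    ?_ ?_ ?_ ?_ ?_ ?_
  · refine h.2.congr_deriv ?_
    rw [integral_const_mul]
    rfl
  · refine Filter.Eventually.of_forall fun σ => ?_
    exact (Continuous.aestronglyMeasurable (by fun_prop)).mul hB.1
  · exact integrableOn_coneMean hA hB _ (by linarith)
  · exact ((Continuous.aestronglyMeasurable (by fun_prop)).mul hB.1).const_mul _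
  · filter_upwards [ae_restrict_mem measurableSet_Ioo] with t ht σ hσ
    have hσ : 1 < σ := hσ
    have h0 : 0 ≤ max 0 (1 - (t + A) / σ) := le_max_left _ _
    have h1 : (max 0 (1 - (t + A) / σ)) ^ (n + 1) ≤ 1 :=
      pow_le_one₀ h0 (max_zero_one_sub_le hA ht.1.le (by linarith))
    have ht0 := ht.1
    have h2 : 0 ≤ t + A := by linarith
    have h3 : (t + A) / σ ≤ T + A := (div_le_self h2 hσ.le).trans (by linarith [ht.2])
    have h4 : ((n : ℝ) + 2) / σ ≤ n + 2 := div_le_self (by positivity) hσ.le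
    rw [norm_mul, norm_mul, norm_mul, Real.norm_of_nonneg (by positivity),
      Real.norm_of_nonneg (by positivity), Real.norm_of_nonneg (by positivity)]
    calc ((n : ℝ) + 2) / σ * ((t + A) / σ * (max 0 (1 - (t + A) / σ)) ^ (n + 1) * ‖B t‖) ≤
          (n + 2) * ((T + A) * 1 * ‖B t‖) := by
          have : 0 ≤ T + A := by linarith [ht.2]
          gcongr
      _ = _ := by ring
  · exact hB.norm.const_mul _
  · refine Filter.Eventually.of_forall fun t σ hσ => ?_
    have hσ : 1 < σ := hσ
    have hσ0 : σ ≠ 0 := by linarith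
    have h1 : HasDerivAt (fun σ : ℝ => 1 - (t + A) / σ) ((t + A) / σ ^ 2) σ := by
      have := ((hasDerivAt_inv hσ0).const_mul (t + A)).const_sub 1
      simp only [← div_eq_mul_inv] at this
      refine this.congr_deriv ?_
      field_simp
    refine (((hasDerivAt_max_zero_pow n (1 - (t + A) / σ)).comp σ h1).mul_const (B t)).congr_deriv ?_
    field_simp

/-- Where `t + A ≤ ρ/2` the weight is at least `2^(-(n+2))`, and `d/(t+A)` integrates to `d(log(ρ/2)
- log(t₁+A))`. For large `ρ` at least half of `log ρ` survives. -/
lemma coneMean_lower {B : ℝ → ℝ} {A T t₁ d : ℝ} (hA : 1 ≤ A) (hB : IntegrableOn B (Ioo 0 T))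
    (hB0 : ∀ᵐ t ∂(volume.restrict (Ioo 0 T)), 0 ≤ B t) (hd : 0 < d) (ht₁ : 0 ≤ t₁)
    (hBl : ∀ᵐ t ∂(volume.restrict (Ioo 0 T)), t₁ ≤ t → d / (t + A) ≤ B t) (n : ℕ) {ρ : ℝ}
    (hρ0 : 0 < ρ) (hρ : 2 * (Real.log 2 + Real.log (t₁ + A)) ≤ Real.log ρ) (hρT : ρ < T + A) :
    (1 / 2) ^ (n + 3) * d * Real.log ρ ≤ coneMean B A T n ρ := by
  have hlog2 := Real.log_pos one_lt_two
  have hlA : 0 ≤ Real.log (t₁ + A) := Real.log_nonneg (by linarith)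
  have hsum : Real.log 2 + Real.log (t₁ + A) ≤ Real.log ρ := by linarith
  have hle : t₁ + A ≤ ρ / 2 := by
    rw [← Real.log_mul two_ne_zero (by linarith), Real.log_le_log_iff (by linarith) hρ0] at hsum
    linarith
  have hlt : ρ / 2 - A < T := by linarith
  have h1 : ∫ t in t₁..(ρ / 2 - A), d / (t + A) = d * (Real.log (ρ / 2) - Real.log (t₁ + A)) := by
    have hd' : ∀ t ∈ uIcc t₁ (ρ / 2 - A), HasDerivAt (fun t => d * Real.log (t + A)) (d / (t + A)) t :=
      fun t ht => by
        rw [uIcc_of_le (by linarith)] at ht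
        have := (((hasDerivAt_id t).add_const A).log (by simp only [id]; linarith [ht.1])).const_mul d
        simpa [div_eq_mul_inv] using this
    rw [intervalIntegral.integral_eq_sub_of_hasDerivAt hd']
    · rw [sub_add_cancel]; ring
    · apply ContinuousOn.intervalIntegrable
      rw [uIcc_of_le (by linarith)]
      exact continuousOn_const.div (by fun_prop) fun t ht => by linarith [ht.1]
  rw [intervalIntegral.integral_of_le (by linarith), integral_Ioc_eq_integral_Ioo] at h1
  have hsub : Ioo t₁ (ρ / 2 - A) ⊆ Ioo 0 T := fun t ht =>
    ⟨ht₁.trans_lt ht.1, ht.2.trans hlt⟩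
  have hi := integrableOn_coneMean (A := A) (by linarith) hB (n + 2) hρ0
  have h2 : ∫ t in Ioo t₁ (ρ / 2 - A), (1 / 2) ^ (n + 2) * (d / (t + A)) ≤ coneMean B A T n ρ := by
    refine le_trans ?_ (setIntegral_mono_set hi ?_ hsub.eventuallyLE)
    · refine setIntegral_mono_on_ae ?_ (hi.mono_set hsub) measurableSet_Ioo ?_
      · have hc : ContinuousOn (fun t => (1 / 2) ^ (n + 2) * (d / (t + A)))
            (Icc t₁ (ρ / 2 - A)) :=
          continuousOn_const.mul (continuousOn_const.div (by fun_prop) fun t ht => by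
            linarith [ht.1])
        exact (hc.integrableOn_compact isCompact_Icc).mono_set Ioo_subset_Icc_self
      · rw [← ae_restrict_iff' measurableSet_Ioo]
        filter_upwards [ae_restrict_of_ae_restrict_of_subset hsub hBl,
          ae_restrict_mem measurableSet_Ioo] with t hb ht
        have hb := hb ht.1.le
        have h3 : (t + A) / ρ ≤ 1 / 2 := by
          rw [div_le_iff₀ hρ0]; linarith [ht.2]
        have h4 : 1 / 2 ≤ max 0 (1 - (t + A) / ρ) := le_max_of_le_right (by linarith)
        have h5 : 0 < t + A := by linarith [ht.1]
        gcongr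
    · filter_upwards [hB0] with t ht
      exact mul_nonneg (pow_nonneg (le_max_left _ _) _) ht
  rw [integral_const_mul, h1, Real.log_div hρ0.ne' two_ne_zero] at h2
  refine le_trans ?_ h2
  have h3 : (0 : ℝ) < (1 / 2) ^ (n + 2) * d := by positivity
  rw [pow_succ]
  calc (1 / 2 : ℝ) ^ (n + 2) * (1 / 2) * d * Real.log ρ =
        (1 / 2 : ℝ) ^ (n + 2) * d * (Real.log ρ / 2) := by ring
    _ ≤ (1 / 2 : ℝ) ^ (n + 2) * d * (Real.log ρ - Real.log 2 - Real.log (t₁ + A)) := by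
        gcongr; linarith
    _ = _ := by ring

/-- The lifespan bound obtained from the differential inequality for `coneMean`. -/
theorem exists_log_lifespan_le {q A K t₁ ρ₀ : ℝ} (hq : 1 < q) (hA : 1 ≤ A) (hK : 0 < K)
    (ht₁ : 0 ≤ t₁) (n : ℕ) :
    ∃ L ≥ 0, ∃ C > 0, ∀ (B : ℝ → ℝ) (T d : ℝ), 0 < d → 0 < T → IntegrableOn B (Ioo 0 T) →
      (∀ᵐ t ∂(volume.restrict (Ioo 0 T)), 0 ≤ B t) →
      (∀ᵐ t ∂(volume.restrict (Ioo 0 T)), t₁ ≤ t → d / (t + A) ≤ B t) →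
      (∀ ρ, ρ₀ ≤ ρ → 1 ≤ Real.log ρ → A < ρ → ρ < T + A → coneMean B A T n ρ ^ q ≤
        K * Real.log ρ ^ (q - 1) * coneMeanDeriv B A T n ρ) →
      Real.log (T + A) ≤ L + C * d ^ (1 - q) := by
  have hq1 : 0 < q - 1 := by linarith
  set L₀ : ℝ := max (max 1 (2 * (Real.log 2 + Real.log (t₁ + A)))) (Real.log (max 1 ρ₀)) with hL₀
  set c : ℝ := (q - 1) * ((n + 2) / (K * 2 ^ (q - 1))) with hc
  have hc0 : 0 < c := by positivity
  set C : ℝ := ((1 / 2) ^ (n + 3)) ^ (1 - q) / c with hC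
  have hC0 : 0 < C := by positivity
  have hL1 : 1 ≤ L₀ := (le_max_left _ _).trans (le_max_left _ _)
  refine ⟨2 * L₀, by linarith, 2 * C, by positivity, fun B T d hd hT hB hB0 hBl hineq => ?_⟩
  -- Separate variables on `[e^x, e^(2x)]`, where `log ρ` is comparable to `x`. The integration
  -- yields a multiple of `x · x^(1-q)` and the initial value `M(e^x) ≥ c d x` yields `(dx)^(1-q)`.
  -- The powers `x^(1-q)` cancel, leaving `x ≤ C d^(1-q)`.
  have key : ∀ x, L₀ ≤ x → 2 * x < Real.log (T + A) → x ≤ C * d ^ (1 - q) := by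
    intro x hx hxT
    have hx0 : 0 < x := by linarith
    set ρ₁ := Real.exp x with hρ₁
    set ρ₂ := Real.exp (2 * x) with hρ₂
    have h12 : ρ₁ ≤ ρ₂ := Real.exp_le_exp.2 (by linarith)
    have hρ₁1 : 1 < ρ₁ := Real.one_lt_exp_iff.2 hx0
    have hρ₂T : ρ₂ < T + A := (Real.lt_log_iff_exp_lt (by linarith)).1 hxT
    have hlog2 := Real.log_pos one_lt_two
    have hlow : ∀ ρ ∈ Icc ρ₁ ρ₂, (1 / 2) ^ (n + 3) * d * Real.log ρ ≤ coneMean B A T n ρ := by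
      intro ρ hρ
      have hρ0 : 0 < ρ := by linarith [hρ.1]
      refine coneMean_lower hA hB hB0 hd ht₁ hBl n hρ0 ?_ (hρ.2.trans_lt hρ₂T)
      have h1 : x ≤ Real.log ρ := (Real.le_log_iff_exp_le hρ0).2 hρ.1
      exact (((le_max_right _ _).trans (le_max_left _ _)).trans hx).trans h1
    have hpos : ∀ ρ ∈ Icc ρ₁ ρ₂, 0 < coneMean B A T n ρ := fun ρ hρ =>
      lt_of_lt_of_le (mul_pos (by positivity) (Real.log_pos (by linarith [hρ.1]))) (hlow ρ hρ)
    set m : ℝ := (n + 2) / (K * (2 * x) ^ (q - 1)) with hm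
    have hder : ∀ ρ ∈ Icc ρ₁ ρ₂, HasDerivAt (coneMean B A T n)
        ((n + 2) / ρ * coneMeanDeriv B A T n ρ) ρ := fun ρ hρ =>
      hasDerivAt_coneMean (by linarith) hB n (by linarith [hρ.1])
    have hΩ : ∀ ρ ∈ Icc ρ₁ ρ₂, HasDerivAt (fun ρ => m * Real.log ρ) (m * ρ⁻¹) ρ := fun ρ hρ =>
      (Real.hasDerivAt_log (by linarith [hρ.1])).const_mul m
    have hmain := sub_le_of_superlinear (p := q) (Z := coneMean B A T n)
      (Ω := fun ρ => m * Real.log ρ) hq h12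
      (fun ρ hρ => (hder ρ hρ).continuousAt.continuousWithinAt)
      (fun ρ hρ => hder ρ (Ioo_subset_Icc_self hρ))
      (fun ρ hρ => (hΩ ρ hρ).continuousAt.continuousWithinAt)
      (fun ρ hρ => hΩ ρ (Ioo_subset_Icc_self hρ)) hpos (by
        intro ρ hρ
        have hρ0 : 0 < ρ := by linarith [hρ.1]
        have h1 : x ≤ Real.log ρ := (Real.le_log_iff_exp_le hρ0).2 hρ.1.le
        have h2 : Real.log ρ ≤ 2 * x := (Real.log_le_iff_le_exp hρ0).2 hρ.2.le
        have h3 : Real.log (max 1 ρ₀) ≤ Real.log ρ := ((le_max_right _ _).trans hx).trans h1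
        have h4 : ρ₀ ≤ ρ := by
          rw [Real.log_le_log_iff (lt_max_of_lt_left one_pos) hρ0] at h3
          exact (le_max_right _ _).trans h3
        have h5 : A < ρ := by
          have h6 : 2 * (Real.log 2 + Real.log (t₁ + A)) ≤ Real.log ρ :=
            (((le_max_right _ _).trans (le_max_left _ _)).trans hx).trans h1
          have h7 : Real.log A ≤ Real.log (t₁ + A) := Real.log_le_log (by linarith) (by linarith)
          have h8 : 0 ≤ Real.log A := Real.log_nonneg hA
          exact (Real.log_lt_log_iff (by linarith) hρ0).1 (by linarith)
        have h6 := hineq ρ h4 (by linarith) h5 (hρ.2.trans hρ₂T)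
        have hpos' := hpos ρ (Ioo_subset_Icc_self hρ)
        have hl0 : 0 < Real.log ρ := by linarith
        have hD0 : 0 ≤ coneMeanDeriv B A T n ρ := by
          have h7 : 0 < coneMean B A T n ρ ^ q := by positivity
          exact (pos_of_mul_pos_right (h7.trans_le h6) (by positivity)).le
        have h7 : coneMean B A T n ρ ^ q ≤
            K * (2 * x) ^ (q - 1) * coneMeanDeriv B A T n ρ := by
          refine h6.trans ?_
          gcongr
        calc m * ρ⁻¹ * coneMean B A T n ρ ^ q ≤
              m * ρ⁻¹ * (K * (2 * x) ^ (q - 1) * coneMeanDeriv B A T n ρ) := by gcongr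
          _ = _ := by rw [hm]; field_simp)
    rw [← mul_sub, hρ₂, hρ₁, Real.log_exp, Real.log_exp] at hmain
    have h1 := hlow ρ₁ ⟨le_rfl, h12⟩
    rw [hρ₁, Real.log_exp] at h1
    have h2 : coneMean B A T n (Real.exp x) ^ (1 - q) ≤
        ((1 / 2) ^ (n + 3) * d * x) ^ (1 - q) :=
      Real.rpow_le_rpow_of_nonpos (by positivity) h1 (by linarith)
    have h3 : (q - 1) * (m * (2 * x - x)) = c * (x * x ^ (1 - q)) := by
      rw [hm, hc, Real.mul_rpow two_pos.le hx0.le, show (1 : ℝ) - q = -(q - 1) by ring,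
        Real.rpow_neg hx0.le]
      field_simp
      ring
    rw [h3] at hmain
    rw [Real.mul_rpow (by positivity) hx0.le, Real.mul_rpow (by positivity) hd.le] at h2
    have h4 : (c * x) * x ^ (1 - q) ≤
        (((1 / 2) ^ (n + 3)) ^ (1 - q) * d ^ (1 - q)) * x ^ (1 - q) := by linarith
    have h5 := le_of_mul_le_mul_right h4 (by positivity)
    rw [hC, div_mul_eq_mul_div, le_div_iff₀ hc0]
    linarith
  have hd' : 0 < d ^ (1 - q) := by positivity
  by_contra! hcon
  set x₀ := L₀ + C * d ^ (1 - q) with hx₀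
  have h1 : x₀ < Real.log (T + A) / 2 := by linarith
  obtain ⟨x, hx1, hx2⟩ := exists_between h1
  have h2 : 0 < C * d ^ (1 - q) := by positivity
  have h3 := key x (by linarith) (by linarith)
  linarith


/-! ### Dyadic superpositions of the exponential solutions -/

/-- The bump `y/(1+y)²` is at most `(1-ρ)^(-1)` times the increment of `y/(1+y)` between `ρy` and
`y`, so the sum telescopes with a bound independent of `x` and `J`. -/
lemma sum_geometric_bump_le {x ρ : ℝ} (hx : 0 < x) (hρ : 0 < ρ) (hρ1 : ρ < 1) (J : ℕ) :
    ∑ j ∈ Finset.range J, x * ρ ^ j / (1 + x * ρ ^ j) ^ 2 ≤ (1 - ρ)⁻¹ := by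
  have h1ρ : 0 < 1 - ρ := by linarith
  set h : ℕ → ℝ := fun j => x * ρ ^ j / (1 + x * ρ ^ j) with hh
  have h0 : ∀ j, 0 ≤ h j := fun j => by positivity
  have hstep : ∀ j, x * ρ ^ j / (1 + x * ρ ^ j) ^ 2 ≤ (1 - ρ)⁻¹ * (h j - h (j + 1)) := by
    intro j
    set y := x * ρ ^ j with hy
    have hy0 : 0 < y := by positivity
    have e : h j - h (j + 1) = (1 - ρ) * (y / ((1 + y) * (1 + ρ * y))) := by
      simp only [hh]
      rw [pow_succ, ← mul_assoc, ← hy]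
      field_simp
      ring
    rw [e, inv_mul_cancel_left₀ h1ρ.ne', sq]
    have : ρ * y ≤ y := by nlinarith
    gcongr
  calc _ ≤ ∑ j ∈ Finset.range J, (1 - ρ)⁻¹ * (h j - h (j + 1)) :=
        Finset.sum_le_sum fun j _ => hstep j
    _ = (1 - ρ)⁻¹ * (h 0 - h J) := by rw [← Finset.mul_sum, Finset.sum_range_sub']
    _ ≤ (1 - ρ)⁻¹ * 1 := by
        have h1 : h 0 ≤ 1 := by
          simp only [hh]
          rw [div_le_one (by positivity)]
          linarith
        have := h0 J
        gcongr
        linarith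
    _ = _ := mul_one _

/-- A function decaying like a power at `0` and at `∞` lies below a multiple of `X^δ/(1+X^δ)²`, and
dyadic sums of that telescope. The constant does not depend on `J`, which is what allows the number
of terms to grow with `T`. -/
lemma exists_sum_dyadic_le {δ₁ δ₂ K : ℝ} (hδ₁ : 0 < δ₁) (hδ₂ : 0 < δ₂) (hK : 0 < K) :
    ∃ C > 0, ∀ F : ℝ → ℝ, (∀ X, 0 < X → F X ≤ K * X ^ δ₁) → (∀ X, 0 < X → F X ≤ K * X ^ (-δ₂)) →
      ∀ z, 0 < z → ∀ J, ∑ j ∈ Finset.range J, F (z * (1 / 2) ^ j) ≤ C := by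
  set δ := min δ₁ δ₂ with hδ
  have hδ0 : 0 < δ := lt_min hδ₁ hδ₂
  set ρ : ℝ := (1 / 2) ^ δ with hρ
  have hρ0 : 0 < ρ := by positivity
  have hρ1 : ρ < 1 := Real.rpow_lt_one (by norm_num) (by norm_num) hδ0
  have h1ρ : 0 < 1 - ρ := by linarith
  refine ⟨4 * K * (1 - ρ)⁻¹, by positivity, fun F h1 h2 z hz J => ?_⟩
  have hpt : ∀ X, 0 < X → F X ≤ 4 * K * (X ^ δ / (1 + X ^ δ) ^ 2) := by
    intro X hX
    have hXδ : 0 < X ^ δ := by positivity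
    rcases le_total X 1 with hX1 | hX1
    · have h3 : X ^ δ₁ ≤ X ^ δ := Real.rpow_le_rpow_of_exponent_ge hX hX1 (min_le_left _ _)
      have h4 : X ^ δ ≤ 1 := Real.rpow_le_one hX.le hX1 hδ0.le
      have h5 : X ^ δ ≤ 4 * (X ^ δ / (1 + X ^ δ) ^ 2) := by
        rw [← mul_div_assoc, le_div_iff₀ (by positivity), mul_comm]
        have : (1 + X ^ δ) ^ 2 ≤ 4 := by nlinarith
        gcongr
      calc F X ≤ K * X ^ δ₁ := h1 X hX
        _ ≤ K * (4 * (X ^ δ / (1 + X ^ δ) ^ 2)) := by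
          have := h3.trans h5
          gcongr
        _ = _ := by ring
    · have h3 : X ^ (-δ₂) ≤ X ^ (-δ) :=
        Real.rpow_le_rpow_of_exponent_le hX1 (neg_le_neg (min_le_right _ _))
      have h4 : 1 ≤ X ^ δ := Real.one_le_rpow hX1 hδ0.le
      have h5 : X ^ (-δ) ≤ 4 * (X ^ δ / (1 + X ^ δ) ^ 2) := by
        rw [Real.rpow_neg hX.le, ← mul_div_assoc, le_div_iff₀ (by positivity),
          inv_mul_le_iff₀ hXδ]
        nlinarith
      calc F X ≤ K * X ^ (-δ₂) := h2 X hX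
        _ ≤ K * (4 * (X ^ δ / (1 + X ^ δ) ^ 2)) := by
          have := h3.trans h5
          gcongr
        _ = _ := by ring
  calc _ ≤ ∑ j ∈ Finset.range J, 4 * K * (z ^ δ * ρ ^ j / (1 + z ^ δ * ρ ^ j) ^ 2) := by
        refine Finset.sum_le_sum fun j _ => ?_
        have h3 := hpt (z * (1 / 2) ^ j) (by positivity)
        rw [Real.mul_rpow hz.le (by positivity), ← Real.rpow_natCast (1 / 2 : ℝ) j,
          ← Real.rpow_mul (by norm_num), mul_comm (j : ℝ) δ, Real.rpow_mul (by norm_num),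
          ← hρ] at h3
        simpa only [Real.rpow_natCast] using h3
    _ ≤ _ := by
        rw [← Finset.mul_sum]
        have := sum_geometric_bump_le (x := z ^ δ) (by positivity) hρ0 hρ1 J
        gcongr

/-- `∑_{j<J} l_j^γ e^{-l_j (t + A)} φ_{l_j}(x)` with `l_j = l 2^{-j}`. -/
noncomputable def dyadicProfile (N : ℕ) (l A : ℝ) (J : ℕ) (γ t : ℝ) (x : Space N) : ℝ :=
  ∑ j ∈ Finset.range J, (l * (1 / 2) ^ j) ^ γ *
    (Real.exp (-(l * (1 / 2) ^ j * (t + A))) * waveProfile N (l * (1 / 2) ^ j) x)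

lemma continuous_dyadicProfile {N : ℕ} (hN : 1 ≤ N) (l A : ℝ) (J : ℕ) (γ t : ℝ) :
    Continuous (dyadicProfile N l A J γ t) := by
  unfold dyadicProfile
  exact continuous_finsetSum _ fun j _ =>
    continuous_const.mul (continuous_const.mul (contDiff_waveProfile hN _).continuous)

lemma dyadicProfile_nonneg {N : ℕ} (hN : 1 ≤ N) {l : ℝ} (hl : 0 ≤ l) (A : ℝ) (J : ℕ) (γ t : ℝ)
    (x : Space N) : 0 ≤ dyadicProfile N l A J γ t x :=
  Finset.sum_nonneg fun j _ => mul_nonneg (Real.rpow_nonneg (by positivity) _)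
    (mul_nonneg (Real.exp_pos _).le (waveProfile_pos hN _ x).le)

/-- Replacing `1 + l|x|` by the larger `1 + ls` in the decay factor costs `(1+y)^m` with `y =
l(s-|x|)`; half of `e^(-y)` pays for it. -/
lemma exists_exp_mul_waveProfile_le {N : ℕ} (hN : 1 ≤ N) : ∃ C > 0, ∀ l, 0 ≤ l → ∀ s, ∀ x : Space N,
    ‖x‖ ≤ s → Real.exp (-(l * s)) * waveProfile N l x ≤
      C * ((1 + l * s) ^ (-(((N : ℝ) - 1) / 2)) * Real.exp (-(1 / 2 * (l * (s - ‖x‖))))) := by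
  set m : ℝ := ((N : ℝ) - 1) / 2 with hm
  have hN1 : (1 : ℝ) ≤ N := by exact_mod_cast hN
  have hm0 : 0 ≤ m := by rw [hm]; linarith
  obtain ⟨C₀, hC₀, hφ⟩ := exists_waveProfile_le hN
  obtain ⟨C₁, hC₁, hexp⟩ := exists_rpow_mul_exp_le m (σ := 1 / 2) (by norm_num)
  refine ⟨C₀ * C₁, by positivity, fun l hl s x hx => ?_⟩
  have hx0 := norm_nonneg x
  set r := ‖x‖ with hr
  set y := l * (s - r) with hy
  have hy0 : 0 ≤ y := mul_nonneg hl (by linarith)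
  have hs0 : 0 ≤ s := by linarith
  have hlr : 0 ≤ l * r := by positivity
  have hls : 0 ≤ l * s := by positivity
  have h1 : (1 + l * r) ^ (-m) ≤ (1 + y) ^ m * (1 + l * s) ^ (-m) := by
    rw [Real.rpow_neg (by linarith), Real.rpow_neg (by linarith), ← div_eq_mul_inv,
      le_div_iff₀ (by positivity), inv_mul_le_iff₀ (by positivity),
      ← Real.mul_rpow (by linarith) (by linarith)]
    refine Real.rpow_le_rpow (by linarith) ?_ hm0
    have : l * s = l * r + y := by rw [hy]; ring
    nlinarith
  have h2 : Real.exp (-(l * s)) * Real.exp (l * r) =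
      Real.exp (-(1 / 2 * y)) * Real.exp (-(1 / 2 * y)) := by
    rw [← Real.exp_add, ← Real.exp_add, hy]; congr 1; ring
  calc Real.exp (-(l * s)) * waveProfile N l x ≤
        Real.exp (-(l * s)) * (C₀ * ((1 + l * r) ^ (-m) * Real.exp (l * r))) := by
        gcongr; exact hφ l hl x
    _ = C₀ * (1 + l * r) ^ (-m) * (Real.exp (-(l * s)) * Real.exp (l * r)) := by ring
    _ ≤ C₀ * ((1 + y) ^ m * (1 + l * s) ^ (-m)) *
          (Real.exp (-(1 / 2 * y)) * Real.exp (-(1 / 2 * y))) := by rw [h2]; gcongr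
    _ = C₀ * (1 + l * s) ^ (-m) * ((1 + y) ^ m * Real.exp (-(1 / 2 * y))) *
          Real.exp (-(1 / 2 * y)) := by ring
    _ ≤ C₀ * (1 + l * s) ^ (-m) * C₁ * Real.exp (-(1 / 2 * y)) := by gcongr; exact hexp y hy0
    _ = _ := by ring

/-- With `X = l_j(t+A)` each term is at most `(t+A)^(-β) X^β (1+X)^(-m)` up to a constant. The sum
over dyadic `X` is bounded exactly because `0 < β < m`. -/
lemma exists_dyadicProfile_le {N : ℕ} (hN : 1 ≤ N) {l A β : ℝ} (hl : 0 < l)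
    (hβ : 0 < β) (hβm : β < ((N : ℝ) - 1) / 2) :
    ∃ C > 0, ∀ J : ℕ, ∀ t, 0 < t + A → ∀ x : Space N, ‖x‖ ≤ t + A →
      dyadicProfile N l A J β t x ≤ C * (t + A) ^ (-β) := by
  set m : ℝ := ((N : ℝ) - 1) / 2 with hm
  obtain ⟨C₀, hC₀, hφ⟩ := exists_exp_mul_waveProfile_le hN
  obtain ⟨C₁, hC₁, hsum⟩ := exists_sum_dyadic_le hβ (sub_pos.2 hβm) hC₀
  refine ⟨C₁, hC₁, fun J t ht x hx => ?_⟩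
  have h := hsum (fun X => C₀ * (X ^ β * (1 + X) ^ (-m))) (fun X hX => by
      have h1 : (1 + X) ^ (-m) ≤ 1 :=
        Real.rpow_le_one_of_one_le_of_nonpos (by linarith) (by linarith)
      have h2 : 0 < X ^ β := by positivity
      have : X ^ β * (1 + X) ^ (-m) ≤ X ^ β := mul_le_of_le_one_right h2.le h1
      gcongr) (fun X hX => by
      have h1 : (1 + X) ^ (-m) ≤ X ^ (-m) :=
        Real.rpow_le_rpow_of_nonpos hX (by linarith) (by linarith)
      have h2 : X ^ (-(m - β)) = X ^ β * X ^ (-m) := by rw [← Real.rpow_add hX]; congr 1; ring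
      rw [h2]
      gcongr) (l * (t + A)) (by positivity) J
  have h3 : dyadicProfile N l A J β t x ≤ (t + A) ^ (-β) * ∑ j ∈ Finset.range J,
      C₀ * ((l * (t + A) * (1 / 2) ^ j) ^ β * (1 + l * (t + A) * (1 / 2) ^ j) ^ (-m)) := by
    rw [dyadicProfile, Finset.mul_sum]
    refine Finset.sum_le_sum fun j _ => ?_
    set lj := l * (1 / 2) ^ j with hlj
    have hlj0 : 0 < lj := by positivity
    have e : l * (t + A) * (1 / 2) ^ j = lj * (t + A) := by rw [hlj]; ring
    have h4 := hφ lj hlj0.le (t + A) x hx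
    have h5 : Real.exp (-(1 / 2 * (lj * (t + A - ‖x‖)))) ≤ 1 := by
      rw [Real.exp_le_one_iff]
      have : 0 ≤ lj * (t + A - ‖x‖) := mul_nonneg hlj0.le (by linarith)
      linarith
    rw [e, Real.mul_rpow hlj0.le ht.le]
    calc lj ^ β * (Real.exp (-(lj * (t + A))) * waveProfile N lj x) ≤
          lj ^ β * (C₀ * ((1 + lj * (t + A)) ^ (-m) * 1)) := by
          refine mul_le_mul_of_nonneg_left (h4.trans ?_) (by positivity)
          gcongr
      _ = (t + A) ^ (-β) * (t + A) ^ β * (lj ^ β * (C₀ * ((1 + lj * (t + A)) ^ (-m) * 1))) := by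
          rw [← Real.rpow_add ht]; simp
      _ = _ := by ring
  calc _ ≤ _ := h3
    _ ≤ (t + A) ^ (-β) * C₁ := by gcongr
    _ = _ := mul_comm _ _

/-- Above the exponent `m` convergence for large `l_j` must come from the exponential, so the
natural variable is `X = l_j(t+A-|x|)`. The terms become `X^θ e^(-X/2)`, and a singularity at the
cone appears. -/
lemma exists_dyadicProfile_le_of_lt {N : ℕ} (hN : 1 ≤ N) {l A θ : ℝ} (hl : 0 < l) (hθ : 0 < θ) :
    ∃ C > 0, ∀ J : ℕ, ∀ t, ∀ x : Space N, ‖x‖ < t + A →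
      dyadicProfile N l A J (((N : ℝ) - 1) / 2 + θ) t x ≤
        C * ((t + A) ^ (-(((N : ℝ) - 1) / 2)) * (t + A - ‖x‖) ^ (-θ)) := by
  set m : ℝ := ((N : ℝ) - 1) / 2 with hm
  have hN1 : (1 : ℝ) ≤ N := by exact_mod_cast hN
  have hm0 : 0 ≤ m := by rw [hm]; linarith
  obtain ⟨C₀, hC₀, hφ⟩ := exists_exp_mul_waveProfile_le hN
  obtain ⟨C₂, hC₂, hexp⟩ := exists_rpow_mul_exp_le (2 * θ) (σ := 1 / 2) (by norm_num)
  obtain ⟨C₁, hC₁, hsum⟩ := exists_sum_dyadic_le hθ hθ (show 0 < C₀ * max 1 C₂ by positivity)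
  refine ⟨C₁, hC₁, fun J t x hx => ?_⟩
  have hx0 := norm_nonneg x
  set y := t + A - ‖x‖ with hy
  have hy0 : 0 < y := by rw [hy]; linarith
  have ht : 0 < t + A := by linarith
  have h := hsum (fun X => C₀ * (X ^ θ * Real.exp (-(1 / 2 * X)))) (fun X hX => by
      have h1 : Real.exp (-(1 / 2 * X)) ≤ max 1 C₂ := by
        refine le_max_of_le_left (Real.exp_le_one_iff.2 (by linarith))
      have h2 : 0 < X ^ θ := by positivity
      calc C₀ * (X ^ θ * Real.exp (-(1 / 2 * X))) ≤ C₀ * (X ^ θ * max 1 C₂) := by gcongr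
        _ = _ := by ring) (fun X hX => by
      have h1 := (hexp X hX.le).trans (le_max_right 1 C₂)
      have h2 : X ^ θ * X ^ θ ≤ (1 + X) ^ (2 * θ) := by
        rw [← Real.rpow_add hX, ← two_mul]
        exact Real.rpow_le_rpow hX.le (by linarith) (by positivity)
      rw [Real.rpow_neg hX.le, ← div_eq_mul_inv, le_div_iff₀ (by positivity)]
      calc C₀ * (X ^ θ * Real.exp (-(1 / 2 * X))) * X ^ θ =
            C₀ * (X ^ θ * X ^ θ * Real.exp (-(1 / 2 * X))) := by ring
        _ ≤ C₀ * ((1 + X) ^ (2 * θ) * Real.exp (-(1 / 2 * X))) := by gcongr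
        _ ≤ _ := by gcongr) (l * y) (by positivity) J
  have h3 : dyadicProfile N l A J (m + θ) t x ≤ (t + A) ^ (-m) * y ^ (-θ) *
      ∑ j ∈ Finset.range J,
        C₀ * ((l * y * (1 / 2) ^ j) ^ θ * Real.exp (-(1 / 2 * (l * y * (1 / 2) ^ j)))) := by
    rw [dyadicProfile, Finset.mul_sum]
    refine Finset.sum_le_sum fun j _ => ?_
    set lj := l * (1 / 2) ^ j with hlj
    have hlj0 : 0 < lj := by positivity
    have e : l * y * (1 / 2) ^ j = lj * y := by rw [hlj]; ring
    have h4 := hφ lj hlj0.le (t + A) x hx.le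
    have h5 : (1 + lj * (t + A)) ^ (-m) ≤ lj ^ (-m) * (t + A) ^ (-m) := by
      rw [← Real.mul_rpow hlj0.le ht.le]
      exact Real.rpow_le_rpow_of_nonpos (by positivity) (by linarith) (by linarith)
    have h6 : y ^ (-θ) * y ^ θ = 1 := by rw [← Real.rpow_add hy0]; simp
    have h7 : lj ^ (m + θ) * lj ^ (-m) = lj ^ θ := by rw [← Real.rpow_add hlj0]; congr 1; ring
    rw [e, Real.mul_rpow hlj0.le hy0.le]
    calc lj ^ (m + θ) * (Real.exp (-(lj * (t + A))) * waveProfile N lj x) ≤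
          lj ^ (m + θ) * (C₀ * (lj ^ (-m) * (t + A) ^ (-m) * Real.exp (-(1 / 2 * (lj * y))))) := by
          refine mul_le_mul_of_nonneg_left (h4.trans ?_) (by positivity)
          gcongr
      _ = (lj ^ (m + θ) * lj ^ (-m)) * (y ^ (-θ) * y ^ θ) *
          ((t + A) ^ (-m) * C₀ * Real.exp (-(1 / 2 * (lj * y)))) := by rw [h6]; ring
      _ = _ := by rw [h7]; ring
  calc _ ≤ _ := h3
    _ ≤ (t + A) ^ (-m) * y ^ (-θ) * C₁ := by gcongr
    _ = _ := by ring

/-- A single term suffices: the one with `1 ≤ l_j(t+A) ≤ 2`, which the range reaches because `l(t+A)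
< 2^J`. If already `l(t+A) ≤ 1`, the term `j = 0` works. -/
lemma exists_le_dyadicProfile {N : ℕ} (hN : 1 ≤ N) {l β : ℝ} (hl : 0 < l) (hβ : 0 < β) :
    ∃ c > 0, ∀ A : ℝ, ∀ J : ℕ, 0 < J → ∀ t, 1 ≤ t + A → l * (t + A) < 2 ^ J → ∀ x : Space N,
      c * (t + A) ^ (-β) ≤ dyadicProfile N l A J β t x := by
  refine ⟨min (Real.exp (-2)) (l ^ β * Real.exp (-1)), by positivity, fun A J hJ t ht hJt x => ?_⟩
  have ht0 : 0 < t + A := by linarith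
  have hterm : ∀ j ∈ Finset.range J, (l * (1 / 2) ^ j) ^ β *
      Real.exp (-(l * (1 / 2) ^ j * (t + A))) ≤ dyadicProfile N l A J β t x := by
    intro j hj
    refine le_trans ?_ (Finset.single_le_sum (f := fun j => (l * (1 / 2) ^ j) ^ β *
      (Real.exp (-(l * (1 / 2) ^ j * (t + A))) * waveProfile N (l * (1 / 2) ^ j) x)) ?_ hj)
    · have h1 := one_le_waveProfile hN (l * (1 / 2) ^ j) x
      have h2 := Real.exp_pos (-(l * (1 / 2) ^ j * (t + A)))
      refine mul_le_mul_of_nonneg_left ?_ (by positivity)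
      exact le_mul_of_one_le_right h2.le h1
    · intro i _
      exact mul_nonneg (by positivity) (mul_nonneg (Real.exp_pos _).le (waveProfile_pos hN _ x).le)
  rcases le_total (l * (t + A)) 1 with hc | hc
  · refine le_trans ?_ (hterm 0 (Finset.mem_range.2 hJ))
    rw [pow_zero, mul_one]
    have h1 : (t + A) ^ (-β) ≤ 1 := Real.rpow_le_one_of_one_le_of_nonpos ht (by linarith)
    have h2 : Real.exp (-1) ≤ Real.exp (-(l * (t + A))) := Real.exp_le_exp.2 (by linarith)
    calc _ ≤ l ^ β * Real.exp (-1) * 1 := by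
          gcongr
          exact min_le_right _ _
      _ ≤ _ := by rw [mul_one]; gcongr
  · obtain ⟨j, hj1, hj2⟩ := exists_nat_pow_near hc one_lt_two
    have hjJ : j < J := by
      by_contra! h
      exact absurd (hj1.trans_lt hJt) (not_lt.2 (pow_le_pow_right₀ one_le_two h))
    have e1 : 1 ≤ l * (1 / 2) ^ j * (t + A) := by
      rw [one_div, inv_pow, mul_right_comm, ← div_eq_mul_inv, le_div_iff₀ (by positivity)]
      linarith
    have e2 : l * (1 / 2) ^ j * (t + A) ≤ 2 := by
      rw [one_div, inv_pow, mul_right_comm, ← div_eq_mul_inv, div_le_iff₀ (by positivity),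
        ← pow_succ']
      exact hj2.le
    refine le_trans ?_ (hterm j (Finset.mem_range.2 hjJ))
    rw [mul_comm (min _ _)]
    have h1 : (t + A) ^ (-β) ≤ (l * (1 / 2) ^ j) ^ β := by
      rw [Real.rpow_neg ht0.le, ← Real.inv_rpow ht0.le]
      refine Real.rpow_le_rpow (by positivity) ?_ hβ.le
      rwa [inv_le_iff_one_le_mul₀ ht0]
    have h2 : min (Real.exp (-2)) (l ^ β * Real.exp (-1)) ≤
        Real.exp (-(l * (1 / 2) ^ j * (t + A))) :=
      (min_le_left _ _).trans (Real.exp_le_exp.2 (by linarith))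
    gcongr


/-! ### The differential inequality for the cone mean -/

lemma setIntegral_rpow_le {g : ℝ → ℝ} {q R : ℝ} (hq : 1 < q) (hR : 0 < R)
    (hg : ContinuousOn g (Icc 0 R)) :
    |∫ t in Ioo 0 R, g t| ^ q ≤ R ^ (q - 1) * ∫ t in Ioo 0 R, |g t| ^ q := by
  have hq0 : 0 < q := by linarith
  have hi : IntegrableOn (fun t => |g t|) (Ioo 0 R) :=
    (hg.abs.integrableOn_compact isCompact_Icc).mono_set Ioo_subset_Icc_self
  have hiq : IntegrableOn (fun t => |g t| ^ q) (Ioo 0 R) :=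
    ((hg.abs.rpow_const fun t _ => Or.inr hq0.le).integrableOn_compact isCompact_Icc).mono_set
      Ioo_subset_Icc_self
  have h := (convexOn_rpow hq.le).map_set_average_le (μ := volume) (t := Ioo 0 R)
    (f := fun t => |g t|) (continuousOn_id.rpow_const fun x _ => Or.inr hq0.le) isClosed_Ici
    (by simp [hR]) (by simp) (Filter.Eventually.of_forall fun t => mem_Ici.2 (abs_nonneg _)) hi hiq
  rw [setAverage_eq, setAverage_eq, Real.volume_real_Ioo_of_le hR.le, sub_zero, smul_eq_mul,
    smul_eq_mul] at h
  have h0 : 0 ≤ ∫ t in Ioo 0 R, |g t| := integral_nonneg fun t => abs_nonneg _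
  rw [Real.mul_rpow (by positivity) h0, Real.inv_rpow hR.le, inv_mul_le_iff₀ (by positivity)] at h
  calc |∫ t in Ioo 0 R, g t| ^ q ≤ (∫ t in Ioo 0 R, |g t|) ^ q :=
        Real.rpow_le_rpow (abs_nonneg _) abs_integral_le_integral_abs hq0.le
    _ ≤ _ := h
    _ = _ := by
        rw [Real.rpow_sub_one hR.ne']
        ring

lemma coneMean_mul_pow {B : ℝ → ℝ} {A T : ℝ} (n : ℕ) {ρ : ℝ} (hρ0 : 0 < ρ) (hρT : ρ < T + A) :
    coneMean B A T n ρ * ρ ^ (n + 2) = ∫ t in Ioo 0 (ρ - A), (ρ - A - t) ^ (n + 2) * B t := by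
  have hsub : Ioo 0 (ρ - A) ⊆ Ioo 0 T := Ioo_subset_Ioo_right (by linarith)
  rw [coneMean, ← integral_mul_const]
  rw [setIntegral_eq_of_subset_of_forall_sdiff_eq_zero measurableSet_Ioo hsub]
  · refine setIntegral_congr_fun measurableSet_Ioo fun t ht => ?_
    have h1 : (t + A) / ρ ≤ 1 := by rw [div_le_one hρ0]; linarith [ht.2]
    have h2 : ρ - A - t = (1 - (t + A) / ρ) * ρ := by field_simp; ring
    rw [max_eq_right (by linarith), h2, mul_pow]
    ring
  · intro t ht
    have h1 : ρ - A ≤ t := by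
      by_contra! h
      exact ht.2 ⟨ht.1.1, h⟩
    have h2 : 1 ≤ (t + A) / ρ := by rw [one_le_div hρ0]; linarith
    rw [max_eq_left (by linarith), zero_pow (by omega)]
    ring

lemma coneMeanDeriv_mul_pow {B : ℝ → ℝ} {A T : ℝ} (n : ℕ) {ρ : ℝ} (hρ0 : 0 < ρ)
    (hρT : ρ < T + A) : coneMeanDeriv B A T n ρ * ρ ^ (n + 2) =
      ∫ t in Ioo 0 (ρ - A), (t + A) * (ρ - A - t) ^ (n + 1) * B t := by
  have hsub : Ioo 0 (ρ - A) ⊆ Ioo 0 T := Ioo_subset_Ioo_right (by linarith)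
  rw [coneMeanDeriv, ← integral_mul_const]
  rw [setIntegral_eq_of_subset_of_forall_sdiff_eq_zero measurableSet_Ioo hsub]
  · refine setIntegral_congr_fun measurableSet_Ioo fun t ht => ?_
    have h1 : (t + A) / ρ ≤ 1 := by rw [div_le_one hρ0]; linarith [ht.2]
    have h2 : ρ - A - t = (1 - (t + A) / ρ) * ρ := by field_simp; ring
    rw [max_eq_right (by linarith), h2, mul_pow]
    field_simp
    ring
  · intro t ht
    have h1 : ρ - A ≤ t := by
      by_contra! h
      exact ht.2 ⟨ht.1.1, h⟩
    have h2 : 1 ≤ (t + A) / ρ := by rw [one_le_div hρ0]; linarith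
    rw [max_eq_left (by linarith), zero_pow (by omega)]
    ring

lemma add_rpow_le_two_rpow {x y q : ℝ} (hx : 0 ≤ x) (hy : 0 ≤ y) (hq : 0 ≤ q) :
    (x + y) ^ q ≤ 2 ^ q * (x ^ q + y ^ q) := by
  have h1 : (x + y) ^ q ≤ (2 * max x y) ^ q :=
    Real.rpow_le_rpow (by positivity)
      (by linarith [le_max_left x y, le_max_right x y]) hq
  rw [Real.mul_rpow two_pos.le (le_max_of_le_left hx)] at h1
  refine h1.trans ?_
  gcongr
  have hx' := Real.rpow_nonneg hx q
  have hy' := Real.rpow_nonneg hy q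
  rcases max_cases x y with ⟨h, -⟩ | ⟨h, -⟩ <;> rw [h] <;> linarith

/-- Jensen's inequality moves the power `q` inside the time integral of the tested equation. The
bounds on `P` and `Q` then turn both terms into multiples of `(t+A)(R-t)^(n+1) B`, the integrand of
`coneMeanDeriv`. The powers of `ρ` balance exactly, so a factor `(log ρ)^(q-1)` is the only loss. -/
theorem coneMean_rpow_le {q A K₀ T ρ : ℝ} (hq : 1 < q) (hA : 1 ≤ A) (hK₀ : 0 < K₀) {n : ℕ}
    (hn : (n : ℝ) + 1 ≤ n * q) {B P Q : ℝ → ℝ} (hB : IntegrableOn B (Ioo 0 T))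
    (hB0 : ∀ᵐ t ∂(volume.restrict (Ioo 0 T)), 0 ≤ B t)
    (hPc : ContinuousOn P (Ico 0 T)) (hQc : ContinuousOn Q (Ico 0 T))
    (hP : ∀ᵐ t ∂(volume.restrict (Ioo 0 T)), |P t| ^ q ≤ K₀ * (t + A) ^ (q + 1) * B t)
    (hQ : ∀ᵐ t ∂(volume.restrict (Ioo 0 T)),
      |Q t| ^ q ≤ K₀ * ((t + A) * Real.log (t + A) ^ (q - 1)) * B t)
    (hρ1 : 1 ≤ Real.log ρ) (hAρ : A < ρ) (hρT : ρ < T + A)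
    (htest : ∫ t in Ioo 0 (ρ - A), (ρ - A - t) ^ (n + 2) * B t ≤
      ∫ t in Ioo 0 (ρ - A), ((n + 2) * (n + 1) * (ρ - A - t) ^ n * P t +
        2 * (n + 2) * (ρ - A - t) ^ (n + 1) * Q t)) :
    coneMean B A T n ρ ^ q ≤ 2 ^ q * (2 * (((n : ℝ) + 2) * (n + 2)) ^ q * K₀) *
      Real.log ρ ^ (q - 1) * coneMeanDeriv B A T n ρ := by
  have hq0 : 0 < q := by linarith
  have hq1 : 0 < q - 1 := by linarith
  have hρ0 : 0 < ρ := by linarith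
  set R := ρ - A with hR
  have hR0 : 0 < R := by rw [hR]; linarith
  have hRT : R < T := by rw [hR]; linarith
  have hsub : Ioo 0 R ⊆ Ioo 0 T := Ioo_subset_Ioo_right hRT.le
  have hsub' : Icc 0 R ⊆ Ico 0 T := fun t ht => ⟨ht.1, ht.2.trans_lt hRT⟩
  set k : ℝ := ((n : ℝ) + 2) * (n + 2) with hk
  have hk0 : 0 < k := by positivity
  set g : ℝ → ℝ := fun t => (n + 2) * (n + 1) * (R - t) ^ n * P t +
    2 * (n + 2) * (R - t) ^ (n + 1) * Q t with hg
  have hgc : ContinuousOn g (Icc 0 R) :=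
    (ContinuousOn.mul (by fun_prop) (hPc.mono hsub')).add
      (ContinuousOn.mul (by fun_prop) (hQc.mono hsub'))
  set Λ := Real.log ρ ^ (q - 1) with hΛ
  have hΛ1 : 1 ≤ Λ := Real.one_le_rpow hρ1 hq1.le
  set S : ℝ := ρ ^ (((n : ℝ) + 1) * (q - 1)) with hS
  have hS0 : 0 < S := by positivity
  have hpt : ∀ᵐ t ∂(volume.restrict (Ioo 0 R)), |g t| ^ q ≤
      2 ^ q * (2 * k ^ q * K₀) * Λ * S * ((t + A) * (R - t) ^ (n + 1) * B t) := by
    filter_upwards [ae_restrict_of_ae_restrict_of_subset hsub hB0,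
      ae_restrict_of_ae_restrict_of_subset hsub hP, ae_restrict_of_ae_restrict_of_subset hsub hQ,
      ae_restrict_mem measurableSet_Ioo] with t hBt hPt hQt ht
    set y := R - t with hy
    have hy0 : 0 < y := by rw [hy]; linarith [ht.2]
    have hyρ : y ≤ ρ := by rw [hy]; linarith [ht.1]
    have htA : 1 ≤ t + A := by linarith [ht.1]
    have htρ : t + A ≤ ρ := by linarith [ht.2]
    have hlog0 : 0 ≤ Real.log (t + A) := Real.log_nonneg htA
    have hn0 : (0 : ℝ) ≤ n := n.cast_nonneg
    have h1 : (|P t| * y ^ n) ^ q ≤ K₀ * Λ * S * ((t + A) * y ^ (n + 1) * B t) := by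
      have e1 : (t + A) ^ (q + 1) ≤ ρ ^ q * (t + A) := by
        rw [Real.rpow_add_one (by linarith)]
        gcongr
      have e2 : (y ^ n) ^ q * ρ ^ q ≤ S * y ^ (n + 1) := by
        rw [← Real.rpow_natCast, ← Real.rpow_mul hy0.le, hS, ← Real.rpow_natCast y (n + 1)]
        have e3 : y ^ ((n : ℝ) * q) = y ^ ((n : ℝ) * q - (n + 1)) * y ^ ((n + 1 : ℕ) : ℝ) := by
          rw [← Real.rpow_add hy0]; congr 1; push_cast; ring
        have e4 : ρ ^ (((n : ℝ) + 1) * (q - 1)) = ρ ^ ((n : ℝ) * q - (n + 1)) * ρ ^ q := by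
          rw [← Real.rpow_add hρ0]; congr 1; ring
        rw [e3, e4]
        -- The condition `n + 1 ≤ nq` makes this exponent nonnegative, so the surplus power of `R -
        -- t` may be estimated by `ρ`.
        have e5 : y ^ ((n : ℝ) * q - (n + 1)) ≤ ρ ^ ((n : ℝ) * q - (n + 1)) :=
          Real.rpow_le_rpow hy0.le hyρ (by linarith)
        calc _ = y ^ ((n : ℝ) * q - (n + 1)) * (ρ ^ q * y ^ ((n + 1 : ℕ) : ℝ)) := by ring
          _ ≤ ρ ^ ((n : ℝ) * q - (n + 1)) * (ρ ^ q * y ^ ((n + 1 : ℕ) : ℝ)) := by gcongr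
          _ = _ := by ring
      rw [Real.mul_rpow (abs_nonneg _) (by positivity)]
      calc |P t| ^ q * (y ^ n) ^ q ≤ (K₀ * (ρ ^ q * (t + A)) * B t) * (y ^ n) ^ q := by
            refine mul_le_mul_of_nonneg_right (hPt.trans ?_) (by positivity)
            gcongr
        _ = K₀ * ((t + A) * B t) * ((y ^ n) ^ q * ρ ^ q) := by ring
        _ ≤ K₀ * ((t + A) * B t) * (S * y ^ (n + 1)) := by gcongr
        _ = K₀ * 1 * S * ((t + A) * y ^ (n + 1) * B t) := by ring
        _ ≤ _ := by gcongr
    have h2 : (|Q t| * y ^ (n + 1)) ^ q ≤ K₀ * Λ * S * ((t + A) * y ^ (n + 1) * B t) := by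
      have e1 : Real.log (t + A) ^ (q - 1) ≤ Λ :=
        Real.rpow_le_rpow hlog0 (Real.log_le_log (by linarith) htρ) hq1.le
      have e2 : (y ^ (n + 1)) ^ q ≤ S * y ^ (n + 1) := by
        rw [← Real.rpow_natCast, ← Real.rpow_mul hy0.le, hS]
        have e3 : y ^ (((n + 1 : ℕ) : ℝ) * q) =
            y ^ (((n : ℝ) + 1) * (q - 1)) * y ^ ((n + 1 : ℕ) : ℝ) := by
          rw [← Real.rpow_add hy0]; congr 1; push_cast; ring
        rw [e3]
        gcongr
      rw [Real.mul_rpow (abs_nonneg _) (by positivity)]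
      calc |Q t| ^ q * (y ^ (n + 1)) ^ q ≤ (K₀ * ((t + A) * Λ) * B t) * (S * y ^ (n + 1)) := by
            refine mul_le_mul (hQt.trans ?_) e2 (by positivity) (by positivity)
            gcongr
        _ = _ := by ring
    have h3 : |g t| ≤ k * (|P t| * y ^ n) + k * (|Q t| * y ^ (n + 1)) := by
      have e1 : (0 : ℝ) ≤ (n + 2) * (n + 1) * y ^ n := by positivity
      have e2 : (0 : ℝ) ≤ 2 * (n + 2) * y ^ (n + 1) := by positivity
      have hgt : g t = (n + 2) * (n + 1) * y ^ n * P t + 2 * (n + 2) * y ^ (n + 1) * Q t := rfl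
      rw [hgt]
      refine (abs_add_le _ _).trans ?_
      rw [abs_mul (_ * y ^ n), abs_mul (_ * y ^ (n + 1)), abs_of_nonneg e1, abs_of_nonneg e2]
      have e3 : ((n : ℝ) + 2) * (n + 1) ≤ k := by rw [hk]; gcongr; norm_num
      have e4 : 2 * ((n : ℝ) + 2) ≤ k := by rw [hk]; gcongr; linarith
      calc _ = ((n : ℝ) + 2) * (n + 1) * (|P t| * y ^ n) +
            2 * ((n : ℝ) + 2) * (|Q t| * y ^ (n + 1)) := by ring
        _ ≤ _ := by gcongr
    calc |g t| ^ q ≤ (k * (|P t| * y ^ n) + k * (|Q t| * y ^ (n + 1))) ^ q :=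
          Real.rpow_le_rpow (abs_nonneg _) h3 hq0.le
      _ ≤ 2 ^ q * ((k * (|P t| * y ^ n)) ^ q + (k * (|Q t| * y ^ (n + 1))) ^ q) :=
          add_rpow_le_two_rpow (by positivity) (by positivity) hq0.le
      _ = 2 ^ q * (k ^ q * (|P t| * y ^ n) ^ q + k ^ q * (|Q t| * y ^ (n + 1)) ^ q) := by
          rw [Real.mul_rpow hk0.le (by positivity), Real.mul_rpow hk0.le (by positivity)]
      _ ≤ 2 ^ q * (k ^ q * (K₀ * Λ * S * ((t + A) * y ^ (n + 1) * B t)) +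
            k ^ q * (K₀ * Λ * S * ((t + A) * y ^ (n + 1) * B t))) := by gcongr
      _ = _ := by ring
  have hDi : IntegrableOn (fun t => (t + A) * (R - t) ^ (n + 1) * B t) (Ioo 0 R) := by
    refine Integrable.bdd_mul (c := ρ * ρ ^ (n + 1)) (hB.mono_set hsub)
      (Continuous.aestronglyMeasurable (by fun_prop)) ?_
    filter_upwards [ae_restrict_mem measurableSet_Ioo] with t ht
    rw [norm_mul, norm_pow, Real.norm_eq_abs, Real.norm_eq_abs, abs_of_pos (by linarith [ht.1]),
      abs_of_pos (by linarith [ht.2])]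
    have h1 : 0 ≤ R - t := by linarith [ht.2]
    have h2 : R - t ≤ ρ := by linarith [ht.1]
    have h3 : t + A ≤ ρ := by linarith [ht.2]
    gcongr
  have hgi : IntegrableOn (fun t => |g t| ^ q) (Ioo 0 R) :=
    ((hgc.abs.rpow_const fun t _ => Or.inr hq0.le).integrableOn_compact isCompact_Icc).mono_set
      Ioo_subset_Icc_self
  have hmono := integral_mono_ae hgi (hDi.const_mul _) hpt
  rw [integral_const_mul, ← coneMeanDeriv_mul_pow n hρ0 hρT] at hmono
  have hM0 : 0 ≤ ∫ t in Ioo 0 R, (R - t) ^ (n + 2) * B t := by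
    refine integral_nonneg_of_ae ?_
    filter_upwards [ae_restrict_of_ae_restrict_of_subset hsub hB0,
      ae_restrict_mem measurableSet_Ioo] with t hBt ht
    have h1 : 0 ≤ R - t := by linarith [ht.2]
    exact mul_nonneg (by positivity) hBt
  have hM : (∫ t in Ioo 0 R, (R - t) ^ (n + 2) * B t) ^ q ≤ R ^ (q - 1) *
      ∫ t in Ioo 0 R, |g t| ^ q :=
    (Real.rpow_le_rpow hM0 (htest.trans (le_abs_self _)) hq0.le).trans
      (setIntegral_rpow_le hq hR0 hgc)
  rw [← coneMean_mul_pow n hρ0 hρT] at hM hM0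
  have hc0 : 0 ≤ coneMean B A T n ρ := nonneg_of_mul_nonneg_left hM0 (by positivity)
  have hgn : 0 ≤ ∫ t in Ioo 0 R, |g t| ^ q := integral_nonneg fun t => by positivity
  have hRρ : R ^ (q - 1) ≤ ρ ^ (q - 1) := Real.rpow_le_rpow hR0.le (by linarith) hq1.le
  rw [Real.mul_rpow hc0 (by positivity)] at hM
  -- Exact balance of powers: `(n+2)q = (q-1) + (n+1)(q-1) + (n+2)`.
  have hpow : (ρ ^ (n + 2)) ^ q = ρ ^ (q - 1) * S * ρ ^ (n + 2) := by
    rw [hS, ← Real.rpow_natCast, ← Real.rpow_mul hρ0.le, ← Real.rpow_add hρ0, ← Real.rpow_add hρ0]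
    congr 1
    push_cast
    ring
  have hfin : coneMean B A T n ρ ^ q * (ρ ^ (n + 2)) ^ q ≤
      (2 ^ q * (2 * k ^ q * K₀) * Λ * coneMeanDeriv B A T n ρ) * (ρ ^ (n + 2)) ^ q := by
    calc _ ≤ _ := hM
      _ ≤ ρ ^ (q - 1) * (2 ^ q * (2 * k ^ q * K₀) * Λ * S *
          (coneMeanDeriv B A T n ρ * ρ ^ (n + 2))) := by gcongr
      _ = _ := by rw [hpow]; ring
  exact le_of_mul_le_mul_right hfin (by positivity)


/-! ### Pairings with the dyadic profiles -/

lemma exists_integral_cone_inv_le {N : ℕ} (hN : 1 ≤ N) {r₀ : ℝ} (hr₀ : 0 ≤ r₀) :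
    ∃ C > 0, ∀ t : ℝ, 0 ≤ t →
      ∫ x in Metric.closedBall (0 : Space N) (r₀ + t), (t + (r₀ + 1) - ‖x‖) ^ (-1 : ℝ) ≤
        C * ((t + (r₀ + 1)) ^ ((N : ℝ) - 1) * Real.log (t + (r₀ + 1))) := by
  obtain ⟨c, hc, hpolar⟩ := exists_integral_closedBall_norm N hN
  refine ⟨c, hc, fun t ht => ?_⟩
  set s := t + (r₀ + 1) with hs
  have hρ : 0 ≤ r₀ + t := by linarith
  rw [hpolar (fun r => (s - r) ^ (-1 : ℝ)) (r₀ + t) hρ]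
  have hd : ∀ r ∈ uIcc 0 (r₀ + t), HasDerivAt (fun r => -Real.log (s - r)) ((s - r) ^ (-1 : ℝ)) r := by
    intro r hr
    rw [uIcc_of_le hρ] at hr
    have h1 : s - r ≠ 0 := by rw [hs]; linarith [hr.2]
    have := (((hasDerivAt_id r).const_sub s).log h1).neg
    rw [Real.rpow_neg_one]
    refine this.congr_deriv ?_
    simp only [id]
    field_simp
  have hcont : ContinuousOn (fun r => (s - r) ^ (-1 : ℝ)) (Icc 0 (r₀ + t)) :=
    ContinuousOn.rpow_const (by fun_prop) fun r hr => Or.inl (by rw [hs]; linarith [hr.2])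
  have hint : IntervalIntegrable (fun r => (s - r) ^ (-1 : ℝ)) volume 0 (r₀ + t) :=
    ContinuousOn.intervalIntegrable (by rwa [uIcc_of_le hρ])
  have h1 := intervalIntegral.integral_eq_sub_of_hasDerivAt hd hint
  -- The shift `r₀ + 1` keeps the support at distance at least `1` from the singular cone, so the
  -- radial integral is exactly `log s`.
  have h2 : s - (r₀ + t) = 1 := by rw [hs]; ring
  rw [h2, Real.log_one, sub_zero] at h1
  have h3 : ∫ r in (0 : ℝ)..(r₀ + t), r ^ (N - 1) * (s - r) ^ (-1 : ℝ) ≤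
      ∫ r in (0 : ℝ)..(r₀ + t), s ^ ((N : ℝ) - 1) * (s - r) ^ (-1 : ℝ) := by
    refine intervalIntegral.integral_mono_on hρ ?_ (hint.const_mul _) fun r hr => ?_
    · apply ContinuousOn.intervalIntegrable
      rw [uIcc_of_le hρ]
      exact ContinuousOn.mul (by fun_prop) hcont
    · have h4 : 0 < s - r := by rw [hs]; linarith [hr.2]
      have h5 : r ^ (N - 1) ≤ s ^ ((N : ℝ) - 1) := by
        have e : (N : ℝ) - 1 = ((N - 1 : ℕ) : ℝ) := by push_cast [hN]; ring
        rw [e, Real.rpow_natCast]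
        exact pow_le_pow_left₀ hr.1 (by linarith) _
      gcongr
  rw [intervalIntegral.integral_const_mul, h1] at h3
  refine mul_le_mul_of_nonneg_left (h3.trans_eq ?_) hc.le
  ring

lemma setIntegral_closedBall_le_mul {N : ℕ} {F G : Space N → ℝ} {ρ : ℝ}
    (hF : ContinuousOn F (Metric.closedBall 0 ρ)) (hG : ContinuousOn G (Metric.closedBall 0 ρ))
    (h : ∀ x, ‖x‖ ≤ ρ → F x ≤ G x) :
    ∫ x in Metric.closedBall (0 : Space N) ρ, F x ≤ ∫ x in Metric.closedBall (0 : Space N) ρ, G x :=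
  setIntegral_mono_on (hF.integrableOn_compact (isCompact_closedBall _ _))
    (hG.integrableOn_compact (isCompact_closedBall _ _)) Metric.isClosed_closedBall.measurableSet
    fun x hx => h x (by simpa using hx)

/-- The pairing with the dyadic profile of exponent `β`. -/
lemma exists_abs_integral_mul_dyadicProfile_le {N : ℕ} (hN : 1 ≤ N) {q l r₀ β : ℝ} (hq : 1 < q)
    (hl : 0 < l) (hr₀ : 0 ≤ r₀) (hβ : 0 < β) (hβm : β < ((N : ℝ) - 1) / 2) :
    ∃ C > 0, ∀ (J : ℕ) (t : ℝ), 0 ≤ t → ∀ U : Space N → ℝ, AEStronglyMeasurable U →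
      (Integrable fun x => |U x| ^ q) → (∀ᵐ x, r₀ + t < ‖x‖ → U x = 0) →
      |∫ x, U x * dyadicProfile N l (r₀ + 1) J β t x| ^ q ≤
        C * (t + (r₀ + 1)) ^ ((N : ℝ) * (q - 1) - β * q) * ∫ x, |U x| ^ q := by
  have hq1 : 0 < q - 1 := by linarith
  obtain ⟨C₀, hC₀, hΦ⟩ := exists_dyadicProfile_le hN (A := r₀ + 1) hl hβ hβm
  set ω₁ := (volume : Measure (Space N)).real (Metric.ball 0 1) with hω
  have hω0 : 0 < ω₁ :=
    ENNReal.toReal_pos (Metric.measure_ball_pos _ _ one_pos).ne' measure_ball_lt_top.ne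
  refine ⟨C₀ ^ q * ω₁ ^ (q - 1), by positivity, fun J t ht U hU hUi hUs => ?_⟩
  set s := t + (r₀ + 1) with hs
  have hs0 : 0 < s := by rw [hs]; linarith
  have hc := continuous_dyadicProfile hN l (r₀ + 1) J β t
  have h := abs_integral_mul_rpow_le hq hU hUi hUs hc (dyadicProfile_nonneg hN hl.le _ _ _ _)
  refine h.trans ?_
  rw [mul_comm]
  refine mul_le_mul_of_nonneg_right ?_ (integral_nonneg fun x => by positivity)
  have hqq : 0 ≤ q / (q - 1) := by positivity
  have h1 : ∫ x in Metric.closedBall (0 : Space N) (r₀ + t),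
      dyadicProfile N l (r₀ + 1) J β t x ^ (q / (q - 1)) ≤
      (C₀ * s ^ (-β)) ^ (q / (q - 1)) * (s ^ (N : ℝ) * ω₁) := by
    calc _ ≤ ∫ x in Metric.closedBall (0 : Space N) (r₀ + t), (C₀ * s ^ (-β)) ^ (q / (q - 1)) := by
          refine setIntegral_closedBall_le_mul
            (hc.rpow_const fun x => Or.inr hqq).continuousOn continuousOn_const fun x hx => ?_
          refine Real.rpow_le_rpow (dyadicProfile_nonneg hN hl.le _ _ _ _ _) ?_ hqq
          exact hΦ J t hs0 x (by linarith)
      _ = (C₀ * s ^ (-β)) ^ (q / (q - 1)) * ((r₀ + t) ^ N * ω₁) := by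
          rw [setIntegral_const, smul_eq_mul, Measure.addHaar_real_closedBall _ _ (by linarith),
            finrank_euclideanSpace, Fintype.card_fin, mul_comm]
      _ ≤ _ := by
          rw [Real.rpow_natCast]
          have : r₀ + t ≤ s := by rw [hs]; linarith
          have : 0 ≤ r₀ + t := by linarith
          gcongr
  have h0 : 0 ≤ ∫ x in Metric.closedBall (0 : Space N) (r₀ + t),
      dyadicProfile N l (r₀ + 1) J β t x ^ (q / (q - 1)) :=
    integral_nonneg fun x => Real.rpow_nonneg (dyadicProfile_nonneg hN hl.le _ _ _ _ _) _
  refine (Real.rpow_le_rpow h0 h1 hq1.le).trans_eq ?_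
  rw [Real.mul_rpow (by positivity) (by positivity), Real.mul_rpow (by positivity) hω0.le,
    ← Real.rpow_mul (by positivity), ← Real.rpow_mul hs0.le, div_mul_cancel₀ _ hq1.ne',
    Real.mul_rpow hC₀.le (by positivity), ← Real.rpow_mul hs0.le,
    show (N : ℝ) * (q - 1) - β * q = -β * q + (N : ℝ) * (q - 1) by ring, Real.rpow_add hs0]
  ring

/-- The pairing with the dyadic profile whose power weight is borderline integrable. -/
lemma exists_abs_integral_mul_dyadicProfile_le_log {N : ℕ} (hN : 1 ≤ N) {q l r₀ : ℝ} (hq : 1 < q)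
    (hl : 0 < l) (hr₀ : 0 ≤ r₀) :
    ∃ C > 0, ∀ (J : ℕ) (t : ℝ), 0 ≤ t → ∀ U : Space N → ℝ, AEStronglyMeasurable U →
      (Integrable fun x => |U x| ^ q) → (∀ᵐ x, r₀ + t < ‖x‖ → U x = 0) →
      |∫ x, U x * dyadicProfile N l (r₀ + 1) J (((N : ℝ) - 1) / 2 + (1 - 1 / q)) t x| ^ q ≤
        C * ((t + (r₀ + 1)) ^ (((N : ℝ) - 1) * (q - 1) - ((N : ℝ) - 1) / 2 * q) *
          Real.log (t + (r₀ + 1)) ^ (q - 1)) * ∫ x, |U x| ^ q := by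
  have hq0 : 0 < q := by linarith
  have hq1 : 0 < q - 1 := by linarith
  set θ := 1 - 1 / q with hθ
  have hθ0 : 0 < θ := by
    rw [hθ, sub_pos, div_lt_one hq0]; exact hq
  set m : ℝ := ((N : ℝ) - 1) / 2 with hm
  obtain ⟨C₀, hC₀, hΦ⟩ := exists_dyadicProfile_le_of_lt hN (A := r₀ + 1) hl hθ0
  obtain ⟨C₁, hC₁, hlog⟩ := exists_integral_cone_inv_le hN hr₀
  refine ⟨C₀ ^ q * C₁ ^ (q - 1), by positivity, fun J t ht U hU hUi hUs => ?_⟩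
  set s := t + (r₀ + 1) with hs
  have hs1 : 1 ≤ s := by rw [hs]; linarith
  have hs0 : 0 < s := by linarith
  have hlog0 : 0 ≤ Real.log s := Real.log_nonneg hs1
  have hc := continuous_dyadicProfile hN l (r₀ + 1) J (m + θ) t
  have h := abs_integral_mul_rpow_le hq hU hUi hUs hc (dyadicProfile_nonneg hN hl.le _ _ _ _)
  refine h.trans ?_
  rw [mul_comm]
  refine mul_le_mul_of_nonneg_right ?_ (integral_nonneg fun x => by positivity)
  have hqq : 0 ≤ q / (q - 1) := by positivity
  have h1 : ∫ x in Metric.closedBall (0 : Space N) (r₀ + t),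
      dyadicProfile N l (r₀ + 1) J (m + θ) t x ^ (q / (q - 1)) ≤
      (C₀ * s ^ (-m)) ^ (q / (q - 1)) * (C₁ * (s ^ ((N : ℝ) - 1) * Real.log s)) := by
    calc _ ≤ ∫ x in Metric.closedBall (0 : Space N) (r₀ + t),
          (C₀ * s ^ (-m)) ^ (q / (q - 1)) * (s - ‖x‖) ^ (-1 : ℝ) := by
          refine setIntegral_closedBall_le_mul
            (hc.rpow_const fun x => Or.inr hqq).continuousOn ?_ fun x hx => ?_
          · refine continuousOn_const.mul (ContinuousOn.rpow_const (by fun_prop) fun x hx =>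
              Or.inl ?_)
            have hx : ‖x‖ ≤ r₀ + t := by simpa using hx
            rw [hs]; linarith
          · have hy : 0 < s - ‖x‖ := by rw [hs]; linarith
            -- `θ = 1 - 1/q` is the reciprocal of the conjugate exponent, so the weight becomes the
            -- borderline power `-1`.
            have e : (s - ‖x‖) ^ (-1 : ℝ) = ((s - ‖x‖) ^ (-θ)) ^ (q / (q - 1)) := by
              rw [← Real.rpow_mul hy.le]
              congr 1
              rw [hθ]
              field_simp
            rw [e, ← Real.mul_rpow (by positivity) (by positivity)]
            refine Real.rpow_le_rpow (dyadicProfile_nonneg hN hl.le _ _ _ _ _) ?_ hqq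
            rw [mul_assoc]
            exact hΦ J t x (by linarith)
      _ ≤ _ := by
          rw [integral_const_mul]
          exact mul_le_mul_of_nonneg_left (hlog t ht) (by positivity)
  have h0 : 0 ≤ ∫ x in Metric.closedBall (0 : Space N) (r₀ + t),
      dyadicProfile N l (r₀ + 1) J (m + θ) t x ^ (q / (q - 1)) :=
    integral_nonneg fun x => Real.rpow_nonneg (dyadicProfile_nonneg hN hl.le _ _ _ _ _) _
  refine (Real.rpow_le_rpow h0 h1 hq1.le).trans_eq ?_
  rw [Real.mul_rpow (by positivity) (by positivity), Real.mul_rpow hC₁.le (by positivity),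
    Real.mul_rpow (by positivity) hlog0, ← Real.rpow_mul (by positivity), ← Real.rpow_mul hs0.le,
    div_mul_cancel₀ _ hq1.ne', Real.mul_rpow hC₀.le (by positivity), ← Real.rpow_mul hs0.le,
    show ((N : ℝ) - 1) * (q - 1) - m * q = -m * q + ((N : ℝ) - 1) * (q - 1) by ring,
    Real.rpow_add hs0]
  ring

/-- The dyadic combination of the exponentially weighted pairings of `W`. -/
noncomputable def pairingSum (N : ℕ) (l A : ℝ) (J : ℕ) (γ : ℝ) (W : ℝ → Space N → ℝ) (t : ℝ) : ℝ :=
  ∑ j ∈ Finset.range J, (l * (1 / 2) ^ j) ^ γ * (Real.exp (-(l * (1 / 2) ^ j * A)) *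
    (Real.exp (-(l * (1 / 2) ^ j * t)) * ∫ x, W t x * waveProfile N (l * (1 / 2) ^ j) x))

lemma pairingSum_eq {N : ℕ} {l A : ℝ} {J : ℕ} {γ t : ℝ} {W : ℝ → Space N → ℝ}
    (h : ∀ l, Integrable fun x => W t x * waveProfile N l x) :
    pairingSum N l A J γ W t = ∫ x, W t x * dyadicProfile N l A J γ t x := by
  rw [pairingSum]
  simp only [dyadicProfile, Finset.mul_sum]
  rw [integral_finsetSum]
  · refine Finset.sum_congr rfl fun j _ => ?_
    rw [← integral_const_mul, ← integral_const_mul, ← integral_const_mul]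
    congr 1
    funext x
    rw [mul_add, neg_add, Real.exp_add]
    ring
  · intro j _
    refine ((h (l * (1 / 2) ^ j)).const_mul ((l * (1 / 2) ^ j) ^ γ *
      Real.exp (-(l * (1 / 2) ^ j * (t + A))))).congr (Filter.Eventually.of_forall fun x => ?_)
    simp only
    ring

lemma integrable_mul_of_supp {N : ℕ} {U ψ : Space N → ℝ} {ρ : ℝ}
    (hU : IntegrableOn U (Metric.closedBall 0 ρ)) (hs : ∀ᵐ x, ρ < ‖x‖ → U x = 0)
    (hψ : Continuous ψ) : Integrable fun x => U x * ψ x := by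
  have h1 : IntegrableOn (fun x => U x * ψ x) (Metric.closedBall 0 ρ) :=
    hU.mul_continuousOn hψ.continuousOn (isCompact_closedBall _ _)
  refine ((integrable_indicator_iff Metric.isClosed_closedBall.measurableSet).2 h1).congr ?_
  filter_upwards [hs] with x hx
  by_cases h : x ∈ Metric.closedBall 0 ρ
  · rw [indicator_of_mem h]
  · rw [indicator_of_notMem h, hx (by simpa using h), zero_mul]

section

variable {N : ℕ} {p q a b : ℝ} {f g : Space N → ℝ} {ε T r₀ : ℝ} {u v H : ℝ → Space N → ℝ}

lemma ConeSolution.pairingSum_u (h : ConeSolution p q a b f g ε T r₀ u v H) (hN : 1 ≤ N)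
    (l A : ℝ) (J : ℕ) (γ : ℝ) {t : ℝ} (ht : t ∈ Ico 0 T) :
    pairingSum N l A J γ u t = ∫ x, u t x * dyadicProfile N l A J γ t x := by
  refine pairingSum_eq fun l => ?_
  have : IsFiniteMeasure (volume.restrict (Metric.closedBall (0 : Space N) (r₀ + t))) :=
    ⟨by simpa using (isCompact_closedBall (0 : Space N) (r₀ + t)).measure_lt_top⟩
  exact integrable_mul_of_supp (((h.memLp_u t).restrict _).integrable one_le_two) (h.supp_u t ht)
    (contDiff_waveProfile hN l).continuous

lemma ConeSolution.pairingSum_H (h : ConeSolution p q a b f g ε T r₀ u v H) (hN : 1 ≤ N)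
    (l A : ℝ) (J : ℕ) (γ : ℝ) : ∀ᵐ t ∂(volume.restrict (Ioo 0 T)),
    pairingSum N l A J γ H t = ∫ x, H t x * dyadicProfile N l A J γ t x := by
  filter_upwards [h.supp_H] with t ht
  exact pairingSum_eq fun l => integrable_mul_of_supp (h.integrable_H t).integrableOn ht
    (contDiff_waveProfile hN l).continuous

lemma ConeSolution.continuousOn_pairingSum (h : ConeSolution p q a b f g ε T r₀ u v H) {l : ℝ}
    (hl : 0 ≤ l) (A : ℝ) (J : ℕ) (γ : ℝ) : ContinuousOn (pairingSum N l A J γ u) (Ico 0 T) := by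
  unfold pairingSum
  refine continuousOn_finsetSum _ fun j _ => continuousOn_const.mul (continuousOn_const.mul
    (ContinuousOn.mul (by fun_prop) fun t ht => ?_))
  exact (h.hasDeriv (l * (1 / 2) ^ j) (by positivity) t ht).continuousWithinAt

lemma ConeSolution.integrableOn_pairingSum (h : ConeSolution p q a b f g ε T r₀ u v H) {l : ℝ}
    (hl : 0 ≤ l) (A : ℝ) (J : ℕ) (γ : ℝ) :
    IntegrableOn (pairingSum N l A J γ H) (Ioo 0 T) := by
  unfold pairingSum
  exact integrable_finsetSum _ fun j _ =>
    ((h.integrableOn_exp_pairing (show 0 ≤ l * (1 / 2) ^ j by positivity)).const_mul _).const_mul _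

lemma ConeSolution.pairingSum_nonneg (h : ConeSolution p q a b f g ε T r₀ u v H) (hN : 1 ≤ N)
    (ha : 0 < a) (hb : 0 < b) {l : ℝ} (hl : 0 ≤ l) (A : ℝ) (J : ℕ) (γ : ℝ) :
    ∀ᵐ t ∂(volume.restrict (Ioo 0 T)), 0 ≤ pairingSum N l A J γ H t := by
  have hall : ∀ᵐ t ∂(volume.restrict (Ioo 0 T)), ∀ j : ℕ,
      0 ≤ ∫ x, H t x * waveProfile N (l * (1 / 2) ^ j) x :=
    ae_all_iff.2 fun j => h.ae_pairing_nonneg hN ha hb _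
  filter_upwards [hall] with t ht
  exact Finset.sum_nonneg fun j _ => mul_nonneg (Real.rpow_nonneg (by positivity) _)
    (mul_nonneg (Real.exp_pos _).le (mul_nonneg (Real.exp_pos _).le (ht j)))

/-- The single-frequency inequality summed with nonnegative weights. The factor `2l_j` in its last
term raises the weight exponent from `γ` to `γ + 1`, which is why two different superpositions of
`u` occur. -/
theorem ConeSolution.dyadic_test_inequality (h : ConeSolution p q a b f g ε T r₀ u v H)
    (hN : 1 ≤ N) {l R : ℝ} (hl : 0 < l) (hR : 0 < R) (hRT : R < T) (hε : 0 ≤ ε) (n : ℕ)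
    (hf : Continuous f) (hfc : HasCompactSupport f) (hg : Continuous g) (hgc : HasCompactSupport g)
    (hdata : ∀ l', 0 ≤ l' → l' ≤ l →
      0 ≤ ∫ x, (g x + (l' + (n + 2) / R) * f x) * waveProfile N l' x) (A : ℝ) (J : ℕ) (γ : ℝ) :
    ∫ t in Ioo 0 R, (R - t) ^ (n + 2) * pairingSum N l A J γ H t ≤
      ∫ t in Ioo 0 R, ((n + 2) * (n + 1) * (R - t) ^ n * pairingSum N l A J γ u t +
        2 * (n + 2) * (R - t) ^ (n + 1) * pairingSum N l A J (γ + 1) u t) := by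
  set w : ℕ → ℝ := fun j => (l * (1 / 2) ^ j) ^ γ * Real.exp (-(l * (1 / 2) ^ j * A)) with hw
  have hw0 : ∀ j, 0 ≤ w j := fun j => by positivity
  have e1 : ∀ t, (R - t) ^ (n + 2) * pairingSum N l A J γ H t = ∑ j ∈ Finset.range J, w j *
      ((R - t) ^ (n + 2) * (Real.exp (-(l * (1 / 2) ^ j * t)) *
        ∫ x, H t x * waveProfile N (l * (1 / 2) ^ j) x)) := fun t => by
    rw [pairingSum, Finset.mul_sum]
    refine Finset.sum_congr rfl fun j _ => ?_
    simp only [hw]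
    ring
  have e2 : ∀ t, (n + 2) * (n + 1) * (R - t) ^ n * pairingSum N l A J γ u t +
      2 * (n + 2) * (R - t) ^ (n + 1) * pairingSum N l A J (γ + 1) u t =
      ∑ j ∈ Finset.range J, w j * (Real.exp (-(l * (1 / 2) ^ j * t)) *
        (∫ x, u t x * waveProfile N (l * (1 / 2) ^ j) x) * ((n + 2) * (n + 1) * (R - t) ^ n +
          2 * (l * (1 / 2) ^ j) * ((n + 2) * (R - t) ^ (n + 1)))) := fun t => by
    rw [pairingSum, pairingSum, Finset.mul_sum, Finset.mul_sum, ← Finset.sum_add_distrib]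
    refine Finset.sum_congr rfl fun j _ => ?_
    simp only [hw]
    rw [Real.rpow_add_one (show l * (1 / 2) ^ j ≠ 0 by positivity)]
    ring
  have hsub : Icc 0 R ⊆ Ico 0 T := fun t ht => ⟨ht.1, ht.2.trans_lt hRT⟩
  have hsub' : Ioo 0 R ⊆ Ioo 0 T := Ioo_subset_Ioo_right hRT.le
  simp_rw [e1, e2]
  rw [integral_finsetSum, integral_finsetSum]
  · refine Finset.sum_le_sum fun j _ => ?_
    rw [integral_const_mul, integral_const_mul]
    refine mul_le_mul_of_nonneg_left ?_ (hw0 j)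
    have hlj : l * (1 / 2) ^ j ≤ l :=
      mul_le_of_le_one_right hl.le (pow_le_one₀ (by norm_num) (by norm_num))
    exact h.test_inequality (by positivity) hR hRT hε n hN hf hfc hg hgc
      (hdata _ (by positivity) hlj)
  · intro j _
    have hc : ContinuousOn (fun t => ∫ x, u t x * waveProfile N (l * (1 / 2) ^ j) x) (Icc 0 R) :=
      fun t ht => ((h.hasDeriv (l * (1 / 2) ^ j) (by positivity) t
        (hsub ht)).mono hsub).continuousWithinAt
    refine Integrable.const_mul ?_ _
    have hc' : ContinuousOn (fun t => Real.exp (-(l * (1 / 2) ^ j * t)) *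
        (∫ x, u t x * waveProfile N (l * (1 / 2) ^ j) x) * ((n + 2) * (n + 1) * (R - t) ^ n +
          2 * (l * (1 / 2) ^ j) * ((n + 2) * (R - t) ^ (n + 1)))) (Icc 0 R) :=
      (ContinuousOn.mul (by fun_prop) hc).mul (by fun_prop)
    exact (hc'.integrableOn_compact isCompact_Icc).mono_set Ioo_subset_Icc_self
  · intro j _
    refine Integrable.const_mul ?_ _
    refine Integrable.bdd_mul (c := R ^ (n + 2))
      ((h.integrableOn_exp_pairing (show 0 ≤ l * (1 / 2) ^ j by positivity)).mono_set hsub')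
      (Continuous.aestronglyMeasurable (by fun_prop)) ?_
    filter_upwards [ae_restrict_mem measurableSet_Ioo] with t ht
    rw [norm_pow, Real.norm_eq_abs, abs_of_pos (by linarith [ht.2])]
    exact pow_le_pow_left₀ (by linarith [ht.2]) (by linarith [ht.1]) _

end


-- `γ_S(q) = 0` reads `mq = 1/q + m + 1`. With `β = m - 1/q` this one relation makes all powers fit:
-- the source becomes `ε^q/(t+A)`, the pairing with exponent `β` gets weight `(t+A)^(q+1)`, and the
-- one with `β + 1` gets `t+A` times a power of the logarithm.
set_option maxHeartbeats 1000000 in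
theorem exists_lifespan_strauss_critical {N : ℕ} (hN : 1 ≤ N) {p q a b r₀ t₀ l₀ c : ℝ} (hq : 1 < q)
    (ha : 0 < a) (hb : 0 < b) (hc : 0 < c) (hr₀ : 0 ≤ r₀) (hl₀ : 0 < l₀) {f g : Space N → ℝ}
    (hf : Continuous f) (hfc : HasCompactSupport f) (hg : Continuous g) (hgc : HasCompactSupport g)
    (hdata : ∀ l, 0 ≤ l → l ≤ l₀ → ∀ μ, 0 ≤ μ → μ ≤ l₀ →
      0 < ∫ x, (g x + μ * f x) * waveProfile N l x)
    (hγ : gammaStrauss N q = 0) :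
    ∃ C > 0, ∀ ε T : ℝ, ∀ u v H : ℝ → Space N → ℝ, 0 < ε → ε ≤ 1 →
      ConeSolution p q a b f g ε T r₀ u v H →
      (∀ᵐ t ∂(volume.restrict (Ioo 0 T)), t₀ ≤ t →
        c * ε ^ q * (1 + t) ^ (((N : ℝ) - 1) * (1 - q / 2)) ≤ ∫ x, |u t x| ^ q) →
      T ≤ Real.exp (C * ε ^ (-(q * (q - 1)))) := by
  have hq0 : 0 < q := by linarith
  have hq1 : 0 < q - 1 := by linarith
  have hq1' : 0 < 1 / q := by positivity
  set A : ℝ := r₀ + 1 with hA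
  have hA1 : 1 ≤ A := by linarith
  set m : ℝ := ((N : ℝ) - 1) / 2 with hm
  have hcrit : m * q = 1 / q + m + 1 := by
    have h1 : gammaStrauss N q = 2 + (2 * m + 2) * q - 2 * m * q ^ 2 := by
      rw [gammaStrauss, hm]; ring
    rw [h1] at hγ
    field_simp
    nlinarith
  set β : ℝ := m - 1 / q with hβ
  have hβ0 : 0 < β := by
    have h1 : 0 < (m - 1 / q) * q := by
      have : 1 / q * q = 1 := by field_simp
      have h2 : 0 < m := by
        by_contra! h
        nlinarith
      nlinarith
    exact pos_of_mul_pos_left h1 hq0.le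
  have hβm : β < m := by linarith
  -- Half of `l₀` is left for the term `(n+2)/R` in the boundary data; the threshold `ρ₀` below
  -- ensures that it fits.
  set l : ℝ := l₀ / 2 with hl
  have hl0 : 0 < l := by positivity
  obtain ⟨n, hn⟩ := exists_nat_ge (1 / (q - 1))
  have hn' : (n : ℝ) + 1 ≤ n * q := by
    rw [div_le_iff₀ hq1] at hn
    linarith
  obtain ⟨c₀, hc₀, hlow⟩ := exists_le_dyadicProfile hN hl0 hβ0
  obtain ⟨C₁, hC₁, h₁⟩ := exists_abs_integral_mul_dyadicProfile_le hN hq hl0 hr₀ hβ0 hβm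
  obtain ⟨C₂, hC₂, h₂⟩ := exists_abs_integral_mul_dyadicProfile_le_log hN hq hl0 hr₀
  set K₀ : ℝ := max C₁ C₂ / (a * c₀) with hK₀
  have hK₀0 : 0 < K₀ := by
    have : 0 < max C₁ C₂ := lt_max_of_lt_left hC₁
    positivity
  set κ : ℝ := ((N : ℝ) - 1) * (1 - q / 2) with hκ
  set K : ℝ := 2 ^ q * (2 * (((n : ℝ) + 2) * (n + 2)) ^ q * K₀) with hK
  have hK0 : 0 < K := by positivity
  obtain ⟨L, hL, C, hC, hlife⟩ := exists_log_lifespan_le (K := K) (t₁ := max t₀ 0)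
    (ρ₀ := A + 2 * (n + 2) / l₀) hq hA1 hK0 (le_max_right _ _) n
  set d₀ : ℝ := a * c₀ * c * (A ^ |κ|)⁻¹ with hd₀
  have hA0 : 0 < A := by linarith
  have hd₀0 : 0 < d₀ := by positivity
  refine ⟨L + C * d₀ ^ (1 - q), by positivity, fun ε T u v H hε hε1 h hsrc => ?_⟩
  rcases le_or_gt T 0 with hT | hT
  · exact hT.trans (Real.exp_pos _).le
  -- Enough dyadic frequencies to reach the scale `1/(T+A)`, so that the lower bound of the profile
  -- holds up to time `T`. No constant depends on `J`.
  obtain ⟨J, hJ⟩ : ∃ J : ℕ, l * (T + A) < 2 ^ (J + 1) := by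
    obtain ⟨J, hJ⟩ := pow_unbounded_of_one_lt (l * (T + A)) one_lt_two
    exact ⟨J, hJ.trans (pow_lt_pow_right₀ one_lt_two (by omega))⟩
  set B : ℝ → ℝ := pairingSum N l A (J + 1) β H with hB
  have hBi : IntegrableOn B (Ioo 0 T) := h.integrableOn_pairingSum hl0.le A (J + 1) β
  have hB0 : ∀ᵐ t ∂(volume.restrict (Ioo 0 T)), 0 ≤ B t :=
    h.pairingSum_nonneg hN ha hb hl0.le A (J + 1) β
  have hBlow : ∀ᵐ t ∂(volume.restrict (Ioo 0 T)),
      a * c₀ * ∫ x, |u t x| ^ q ≤ (t + A) ^ β * B t := by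
    filter_upwards [h.ae_integrable ha hb, h.pairingSum_H hN l A (J + 1) β,
      ae_restrict_mem measurableSet_Ioo] with t hint hBt ht
    have hΦc := continuous_dyadicProfile hN l A (J + 1) β t
    have htA : 0 < t + A := by linarith [ht.1]
    have hΦ0 := dyadicProfile_nonneg hN hl0.le A (J + 1) β t
    have h1 := hint.2.2 (fun _ => c₀ * (t + A) ^ (-β)) continuous_const (fun _ => by positivity)
    have h2 : ∫ x, |u t x| ^ q * (c₀ * (t + A) ^ (-β)) ≤
        ∫ x, |u t x| ^ q * dyadicProfile N l A (J + 1) β t x := by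
      have hsupp : ∀ᵐ x, r₀ + t < ‖x‖ → |u t x| ^ q = 0 := by
        filter_upwards [h.supp_u t ⟨ht.1.le, ht.2⟩] with x hx hx'
        rw [hx hx', abs_zero, Real.zero_rpow hq0.ne']
      refine integral_mono (hint.1.mul_const _)
        (integrable_mul_of_supp hint.1.integrableOn hsupp hΦc) fun x => ?_
      refine mul_le_mul_of_nonneg_left ?_ (by positivity)
      refine hlow A (J + 1) (by omega) t (by linarith [ht.1]) (lt_trans ?_ hJ) x
      have := ht.2
      gcongr
    have h3 := hint.2.2 _ hΦc hΦ0
    have h4 : 0 ≤ ∫ x, |v t x| ^ p * dyadicProfile N l A (J + 1) β t x :=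
      integral_nonneg fun x => mul_nonneg (by positivity) (hΦ0 x)
    rw [integral_mul_const] at h2
    have h5 : (∫ x, |u t x| ^ q) * (a * c₀ * (t + A) ^ (-β)) ≤ B t := by
      rw [hB, hBt]
      have h6 := mul_le_mul_of_nonneg_left h2 ha.le
      have h7 := mul_nonneg hb.le h4
      linarith
    rw [Real.rpow_neg htA.le, ← div_eq_mul_inv, ← mul_div_assoc, div_le_iff₀ (by positivity)] at h5
    linarith
  have hPQ : ∀ᵐ t ∂(volume.restrict (Ioo 0 T)),
      |pairingSum N l A (J + 1) β u t| ^ q ≤ K₀ * (t + A) ^ (q + 1) * B t ∧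
      |pairingSum N l A (J + 1) (β + 1) u t| ^ q ≤
        K₀ * ((t + A) * Real.log (t + A) ^ (q - 1)) * B t := by
    filter_upwards [h.ae_integrable ha hb, hBlow, ae_restrict_mem measurableSet_Ioo]
      with t hint hBt ht
    have htT : t ∈ Ico 0 T := ⟨ht.1.le, ht.2⟩
    have htA1 : 1 ≤ t + A := by linarith [ht.1]
    have htA : 0 < t + A := by linarith
    have hlog : 0 ≤ Real.log (t + A) := Real.log_nonneg htA1
    have hM : ∫ x, |u t x| ^ q ≤ (t + A) ^ β * B t / (a * c₀) := by
      rw [le_div_iff₀ (by positivity)]; linarith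
    have hM0 : 0 ≤ ∫ x, |u t x| ^ q := integral_nonneg fun x => by positivity
    have e : β + 1 = m + (1 - 1 / q) := by rw [hβ]; ring
    rw [h.pairingSum_u hN _ _ _ _ htT, h.pairingSum_u hN _ _ _ _ htT, e]
    constructor
    · refine (h₁ (J + 1) t ht.1.le (u t) (h.memLp_u t).1 hint.1 (h.supp_u t htT)).trans ?_
      have e1 : (t + A) ^ (q + 1) = (t + A) ^ ((N : ℝ) * (q - 1) - β * q) * (t + A) ^ β := by
        rw [← Real.rpow_add htA]
        congr 1
        have h1 : (N : ℝ) = 2 * m + 1 := by rw [hm]; ring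
        have h2 : 1 / q * q = 1 := by field_simp
        rw [h1, hβ]
        linear_combination -h2 - hcrit
      calc _ ≤ max C₁ C₂ * (t + A) ^ ((N : ℝ) * (q - 1) - β * q) *
            ((t + A) ^ β * B t / (a * c₀)) := by
            gcongr
            exact le_max_left _ _
        _ = _ := by rw [e1, hK₀]; ring
    · refine (h₂ (J + 1) t ht.1.le (u t) (h.memLp_u t).1 hint.1 (h.supp_u t htT)).trans ?_
      have e1 : t + A = (t + A) ^ (((N : ℝ) - 1) * (q - 1) - m * q) * (t + A) ^ β := by
        rw [← Real.rpow_add htA]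
        conv_lhs => rw [← Real.rpow_one (t + A)]
        congr 1
        have h1 : (N : ℝ) = 2 * m + 1 := by rw [hm]; ring
        rw [h1, hβ]
        linear_combination -hcrit
      calc _ ≤ max C₁ C₂ * ((t + A) ^ (((N : ℝ) - 1) * (q - 1) - m * q) *
            Real.log (t + A) ^ (q - 1)) * ((t + A) ^ β * B t / (a * c₀)) := by
            gcongr
            exact le_max_right _ _
        _ = max C₁ C₂ / (a * c₀) * (((t + A) ^ (((N : ℝ) - 1) * (q - 1) - m * q) *
            (t + A) ^ β) * Real.log (t + A) ^ (q - 1)) * B t := by ring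
        _ = _ := by rw [← e1]
  have hBl : ∀ᵐ t ∂(volume.restrict (Ioo 0 T)), max t₀ 0 ≤ t →
      d₀ * ε ^ q / (t + A) ≤ B t := by
    filter_upwards [hsrc, hBlow, ae_restrict_mem measurableSet_Ioo] with t hs hBt ht ht'
    have h1 := hs ((le_max_left _ _).trans ht')
    have htA : 0 < t + A := by linarith [ht.1]
    have ht1 : 0 < 1 + t := by linarith [ht.1]
    have h2 : (t + A) ^ κ ≤ A ^ |κ| * (1 + t) ^ κ :=
      rpow_le_of_comparable κ hA1 htA ht1 (by nlinarith [ht.1]) (by nlinarith)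
    have h3 : a * c₀ * (c * ε ^ q * ((A ^ |κ|)⁻¹ * (t + A) ^ κ)) ≤ (t + A) ^ β * B t := by
      refine le_trans ?_ hBt
      refine mul_le_mul_of_nonneg_left (le_trans ?_ h1) (by positivity)
      refine mul_le_mul_of_nonneg_left ?_ (by positivity)
      rwa [inv_mul_le_iff₀ (by positivity)]
    -- `κ + 1 = β` at the critical exponent.
    have e1 : (t + A) ^ κ * (t + A) = (t + A) ^ β := by
      rw [← Real.rpow_add_one htA.ne']
      congr 1
      have h4 : (N : ℝ) = 2 * m + 1 := by rw [hm]; ring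
      rw [hκ, h4, hβ]
      linear_combination -hcrit
    rw [div_le_iff₀ htA]
    have h4 : (t + A) ^ κ * (d₀ * ε ^ q) ≤ (t + A) ^ κ * (B t * (t + A)) := by
      calc _ = a * c₀ * (c * ε ^ q * ((A ^ |κ|)⁻¹ * (t + A) ^ κ)) := by rw [hd₀]; ring
        _ ≤ _ := h3
        _ = _ := by rw [← e1]; ring
    exact le_of_mul_le_mul_left h4 (by positivity)
  have hmain := hlife B T (d₀ * ε ^ q) (by positivity) hT hBi hB0 hBl (by
    intro ρ hρ hρ1 hAρ hρT
    refine coneMean_rpow_le hq hA1 hK₀0 hn' hBi hB0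
      (h.continuousOn_pairingSum hl0.le A (J + 1) β)
      (h.continuousOn_pairingSum hl0.le A (J + 1) (β + 1))
      (hPQ.mono fun t ht => ht.1) (hPQ.mono fun t ht => ht.2) hρ1 hAρ hρT ?_
    have hR : 0 < ρ - A := by linarith
    refine h.dyadic_test_inequality hN hl0 hR (by linarith) hε.le n hf hfc hg hgc
      (fun l' hl' hl'' => (hdata l' hl' (by linarith) _ (by positivity) ?_).le) A (J + 1) β
    have h1 : ((n : ℝ) + 2) / (ρ - A) ≤ l := by
      rw [div_le_iff₀ hR, ← div_le_iff₀' hl0]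
      have : ((n : ℝ) + 2) / l = 2 * (n + 2) / l₀ := by rw [hl]; field_simp
      rw [this]
      linarith
    linarith)
  have hTA : 0 < T + A := by linarith
  have he1 : 1 ≤ ε ^ (-(q * (q - 1))) :=
    Real.one_le_rpow_of_pos_of_le_one_of_nonpos hε hε1 (by nlinarith)
  have he2 : (d₀ * ε ^ q) ^ (1 - q) = d₀ ^ (1 - q) * ε ^ (-(q * (q - 1))) := by
    rw [Real.mul_rpow hd₀0.le (by positivity), ← Real.rpow_mul hε.le]
    congr 2
    ring
  rw [he2, Real.log_le_iff_le_exp hTA] at hmain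
  have hstep : T ≤ T + A := by linarith
  refine hstep.trans (hmain.trans (Real.exp_le_exp.2 ?_))
  nlinarith


/-! ### Assembling the five cases -/

lemma exists_pos_of_imp {P : Prop} {Q : ℝ → Prop} (h : P → ∃ C > 0, Q C) :
    ∃ C > 0, P → Q C := by
  by_cases hP : P
  · obtain ⟨C, hC, hQ⟩ := h hP
    exact ⟨C, hC, fun _ => hQ⟩
  · exact ⟨1, one_pos, fun h => absurd h hP⟩

end CombWave

theorem mainTheorem7 (N : ℕ) (hN : 1 ≤ N) (p q a b : ℝ) (hp : 1 < p) (hq : 1 < q)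
    (ha : 0 < a) (hb : 0 < b)
    (G : ℝ × ℝ → ℝ) (hG : ContDiff ℝ 1 G) (hG0 : G (0, 0) = 0)
    (hGlow : ∀ s σ : ℝ, a * |s| ^ q + b * |σ| ^ p ≤ G (s, σ))
    (f g : CombWave.Space N → ℝ)
    (hf : ContDiff ℝ ∞ f) (hfc : HasCompactSupport f)
    (hg : ContDiff ℝ ∞ g) (hgc : HasCompactSupport g)
    (hI : 0 < ∫ x, g x)
    (hΓ : 0 ≤ max (CombWave.GammaS N q) (CombWave.GammaG N p) ∨
      0 < CombWave.GammaComb N p q) :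
    (CombWave.CaseGlasseyCritical N p q ∨ CombWave.CaseGlasseySubcritical N p q ∨
      CombWave.CaseCombined N p q ∨ CombWave.CaseStraussSubcritical N p q ∨
      CombWave.CaseStraussCritical N p q) ∧
    ∃ ε₀ > 0, ∃ C > 0, ∀ ε : ℝ, 0 < ε → ε ≤ ε₀ → ∀ T : ℝ, 0 < T →
      ∀ u : ℝ → CombWave.L2 N, CombWave.IsWeakSolution G f g ε T u →
        CombWave.SupportedInCone (CombWave.dataRadius f g) T u →
        (CombWave.CaseGlasseyCritical N p q → T ≤ Real.exp (C * ε ^ (-(p - 1)))) ∧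
        (CombWave.CaseGlasseySubcritical N p q → T ≤ C * ε ^ (-(CombWave.GammaG N p)⁻¹)) ∧
        (CombWave.CaseCombined N p q → T ≤ C * ε ^ (-(CombWave.GammaComb N p q)⁻¹)) ∧
        (CombWave.CaseStraussSubcritical N p q → T ≤ C * ε ^ (-(CombWave.GammaS N q)⁻¹)) ∧
        (CombWave.CaseStraussCritical N p q → T ≤ Real.exp (C * ε ^ (-(q * (q - 1))))) := by
  refine ⟨CombWave.exists_case hN hp hq hΓ, ?_⟩
  have hr₀ := CombWave.dataRadius_nonneg f g
  obtain ⟨l₀, hl₀, hdata⟩ :=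
    CombWave.exists_data_pairing_pos hN hf.continuous hfc hg.continuous hgc hI
  have hI' := hdata l₀ hl₀.le le_rfl l₀ hl₀.le le_rfl
  obtain ⟨t₀, ht₀, c, hc, _, _, hsol⟩ :=
    CombWave.exists_solution_bounds hN hp hq ha hb hr₀ hl₀ hI'
  obtain ⟨C₁, hC₁, h₁⟩ := CombWave.exists_pos_of_imp
    fun h : CombWave.CaseGlasseyCritical N p q =>
      CombWave.exists_lifespan_glassey_critical hN hp hq ha hb hr₀ hl₀ hI'
        ((CombWave.eq_pG_iff hN).1 h.1)
  obtain ⟨C₂, hC₂, h₂⟩ := CombWave.exists_pos_of_imp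
    fun h : CombWave.CaseGlasseySubcritical N p q =>
      CombWave.exists_lifespan_glassey_subcritical hN hp hq ha hb hr₀ hl₀ hI'
        ((CombWave.lt_pG_iff hN).1 h.1)
  obtain ⟨C₃, hC₃, h₃⟩ := CombWave.exists_pos_of_imp
    fun h : CombWave.CaseCombined N p q =>
      -- Source `r = p`: all of `a|u|^q` absorbs the mean of `u`, and `b|∂ₜu|^p` supplies the
      -- source.
      CombWave.exists_lifespan_of_source (p := p) (t₀ := t₀) hN hq hp ha hb ha le_rfl
        (mul_pos hb hc) hr₀ hl₀ hf.continuous hfc hg.continuous hgc hdata h.2.2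
  obtain ⟨C₄, hC₄, h₄⟩ := CombWave.exists_pos_of_imp
    fun h : CombWave.CaseStraussSubcritical N p q =>
      -- Source `r = q`: half of `a|u|^q` absorbs the mean, the other half is the source.
      CombWave.exists_lifespan_of_source (p := p) (t₀ := t₀) hN hq hq ha hb (half_pos ha)
        (half_le_self ha.le) (mul_pos (half_pos ha) hc) hr₀ hl₀ hf.continuous hfc hg.continuous
        hgc hdata (by
          rw [CombWave.GammaComb_self N hq, CombWave.GammaS_eq hq]
          have h1 := (CombWave.lt_pS_iff hN hq).1 h.2
          have h2 : 0 < q - 1 := by linarith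
          positivity)
  obtain ⟨C₅, hC₅, h₅⟩ := CombWave.exists_pos_of_imp
    fun h : CombWave.CaseStraussCritical N p q =>
      CombWave.exists_lifespan_strauss_critical (p := p) (t₀ := t₀) hN hq ha hb hc hr₀ hl₀
        hf.continuous hfc hg.continuous hgc hdata ((CombWave.eq_pS_iff hN hq).1 h.2)
  -- Each bound is increasing in its constant, so the sum of the five serves every case. `ε₀ = 1`
  -- makes the negative powers of `ε` at least `1`.
  refine ⟨1, one_pos, C₁ + C₂ + C₃ + C₄ + C₅, by positivity, fun ε hε hε1 T hT u hu hs => ?_⟩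
  obtain ⟨v, H, hcone⟩ := hu.exists_coneSolution hN hG0 hGlow hf hfc hg hgc hT hs
  obtain ⟨hlu, hlv, -⟩ := hsol ε T _ v H hε hcone
  have hH : ∀ᵐ t ∂(volume.restrict (Ioo 0 T)),
      a * (∫ x, |u t x| ^ q) + b * (∫ x, |v t x| ^ p) ≤ ∫ x, H t x := by
    filter_upwards [hcone.ae_integrable ha hb] with t ht
    simpa using ht.2.2 (fun _ => 1) continuous_const fun _ => zero_le_one
  refine ⟨fun h => (h₁ h ε T _ v H hε hε1 hcone).trans ?_,
    fun h => (h₂ h ε T _ v H hε hε1 hcone).trans ?_,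
    fun h => (h₃ h ε T _ v H hε hε1 hcone ?_).trans ?_,
    fun h => (h₄ h ε T _ v H hε hε1 hcone ?_).trans ?_,
    fun h => (h₅ h ε T _ v H hε hε1 hcone hlu).trans ?_⟩
  · gcongr; linarith
  · gcongr; linarith
  · filter_upwards [hH, hlv] with t h1 h2 ht
    have h3 := mul_le_mul_of_nonneg_left (h2 ht) hb.le
    linarith
  · gcongr; linarith
  · filter_upwards [hH, hlu] with t h1 h2 ht
    have h3 := mul_le_mul_of_nonneg_left (h2 ht) ha.le
    have h4 : 0 ≤ b * ∫ x, |v t x| ^ p :=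
      mul_nonneg hb.le (integral_nonneg fun x => by positivity)
    linarith
  · rw [← CombWave.GammaComb_self N hq]
    gcongr; linarith
  · gcongr; linarith
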